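/- Let $n\ge 2$, let $\Sigma$ be an $n$-dimensional smooth manifold, $\mathcal I\subset\mathbb R$ an open interval with coordinate $\tau$, and $M=\mathcal I\times\Sigma$. Let $(\mathcal P,Y)$ be a bundle gerbe on $\Sigma$ (a surjective submersion $\pi\colon Y\to\Sigma$, a principal $\mathrm U(1)$-bundle $\mathcal P\to Y\times_\Sigma Y$ and an associative multiplication), let $(\bar{\mathcal P},\bar Y)=(\mathcal I\times\mathcal P,\mathcal I\times Y)$ be its pull-back to $M$, with submersion $\bar\pi=\mathrm{id}\times\pi$, and let $\bar A$ be an arbitrary connective structure on it (a connection on $\bar{\mathcal P}$ preserved by the multiplication); such a $(\bar{\mathcal P},\bar A,\bar Y)$ is called a reducible bundle gerbe. Let $g=\mathrm d\tau\otimes\mathrm d\tau+h_\tau$ be a smooth Riemannian metric on $M$, with $h_\tau$ a family of metrics on $\Sigma$, let $\bar b=\mathrm d\tau\wedge a_\tau+b_\tau\in\Omega^2(\bar Y)$ be a curving ($\bar\pi_2^*\bar b-\bar\pi_1^*\bar b=F_{\bar A}$), with $a_\tau,b_\tau$ families of one- and two-forms on $Y$, and let $\bar\phi\in C^\infty(M)$,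 $\phi_\tau=\bar\phi|_{\{\tau\}\times\Sigma}$. The curvature $H_{\bar b}\in\Omega^3(M)$ is the unique form with $\bar\pi^*H_{\bar b}=\mathrm d\bar b$; similarly $\pi^*H_{b_\tau}=\mathrm d_Yb_\tau$ defines $H_{b_\tau}\in\Omega^3(\Sigma)$, and the derived family $\psi_\tau\in\Omega^2(\Sigma)$ is defined by $\pi^*\psi_\tau=\partial_\tau b_\tau-\mathrm d_Ya_\tau$. Conventions: norms and products $\langle\cdot,\cdot\rangle$ of differential forms are those of the determinant metric, $|\partial_\tau h_\tau|_{h_\tau}$ is the tensor norm, $T(v)$ is insertion of $v$ in the first slot, $(T\circ_g T)(v,w)=\langle T(v),T(w)\rangle_g$, $\delta^g=-\operatorname{div}_g$ (on forms and on symmetric tensors), $(\psi\lrcorner_hH)(v)=\langle\psi,H(v)\rangle_h$, and $S\,\Delta_1\psi=\sum_iS(e_i)\wedge\psi(e_i)$ for an $h_\tau$-orthonormal frame $(e_i)$. The triple $(g,\bar b,\bar\phi)$ is a gradient generalized Ricci soliton (in the Einstein frame) with constant $\lambda\in\mathbb R$ if \begin{align*} &\mathrm{Ric}^{g}-\tfrac{1}{n-1}\mathrm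 d\bar\phi\otimes\mathrm d\bar\phi+\tfrac1{n-1}\big(e^{-\frac{4\bar\phi}{n-1}}|H_{\bar b}|_g^2+\lambda e^{\frac{2\bar\phi}{n-1}}\big)g-\tfrac12e^{-\frac{4\bar\phi}{n-1}}H_{\bar b}\circ_gH_{\bar b}=0,\\ &\delta^gH_{\bar b}+\tfrac4{n-1}H_{\bar b}(\mathrm d\bar\phi^{\sharp_g})=0,\qquad \delta^g\mathrm d\bar\phi=e^{-\frac{4\bar\phi}{n-1}}|H_{\bar b}|_g^2+\lambda e^{\frac{2\bar\phi}{n-1}}, \end{align*} and a gradient generalized Ricci soliton if this holds for some $\lambda\in\mathbb R$. Then $(g,\bar b,\bar\phi)$ is a gradient generalized Ricci soliton with constant $\lambda$ if and only if $(h_\tau,a_\tau,b_\tau,\phi_\tau)$ satisfies, with the same $\lambda$ and for all $\tau\in\mathcal I$, the evolution equations \begin{align*} \partial_\tau^2h_\tau&=2\mathrm{Ric}^{h_\tau}+\partial_\tau h_\tau\circ_{h_\tau}\partial_\tau h_\tau-\tfrac12\mathrm{Tr}_{h_\tau}(\partial_\tau h_\tau)\,\partial_\tau h_\tau-\tfrac2{n-1}\mathrm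 d_\Sigma\phi_\tau\otimes\mathrm d_\Sigma\phi_\tau\\ &\quad+\tfrac2{n-1}\big(e^{-\frac{4\phi_\tau}{n-1}}(|\psi_\tau|^2_{h_\tau}+|H_{b_\tau}|^2_{h_\tau})+\lambda e^{\frac{2\phi_\tau}{n-1}}\big)h_\tau-e^{-\frac{4\phi_\tau}{n-1}}(\psi_\tau\circ_{h_\tau}\psi_\tau+H_{b_\tau}\circ_{h_\tau}H_{b_\tau}),\\ \partial_\tau\psi_\tau&=\delta^{h_\tau}H_{b_\tau}+\tfrac4{n-1}H_{b_\tau}(\mathrm d_\Sigma\phi_\tau^{\sharp_{h_\tau}})+\partial_\tau h_\tau\,\Delta_1\psi_\tau+\big(\tfrac4{n-1}\partial_\tau\phi_\tau-\tfrac12\mathrm{Tr}_{h_\tau}(\partial_\tau h_\tau)\big)\psi_\tau,\\ \partial_\tau^2\phi_\tau&=\delta^{h_\tau}\mathrm d_\Sigma\phi_\tau-\tfrac12\partial_\tau\phi_\tau\,\mathrm{Tr}_{h_\tau}(\partial_\tau h_\tau)-e^{-\frac{4\phi_\tau}{n-1}}(|\psi_\tau|^2_{h_\tau}+|H_{b_\tau}|^2_{h_\tau})-\lambda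 e^{\frac{2\phi_\tau}{n-1}}, \end{align*} together with the time-dependent constraints \begin{align*} &s^{h_\tau}+\tfrac14|\partial_\tau h_\tau|^2_{h_\tau}-\tfrac14\mathrm{Tr}_{h_\tau}(\partial_\tau h_\tau)^2+\lambda e^{\frac{2\phi_\tau}{n-1}}+\tfrac1{n-1}\big((\partial_\tau\phi_\tau)^2-|\mathrm d_\Sigma\phi_\tau|^2_{h_\tau}\big)+\tfrac12\big(|\psi_\tau|^2_{h_\tau}-|H_{b_\tau}|^2_{h_\tau}\big)e^{-\frac{4\phi_\tau}{n-1}}=0,\\ &\delta^{h_\tau}\partial_\tau h_\tau+\mathrm d_\Sigma\mathrm{Tr}_{h_\tau}(\partial_\tau h_\tau)+\tfrac2{n-1}\partial_\tau\phi_\tau\,\mathrm d_\Sigma\phi_\tau+e^{-\frac{4\phi_\tau}{n-1}}\psi_\tau\lrcorner_{h_\tau}H_{b_\tau}=0,\\ &\delta^{h_\tau}\psi_\tau+\tfrac4{n-1}\psi_\tau(\mathrm d_\Sigma\phi_\tau^{\sharp_{h_\tau}})=0, \end{align*} where $s^{h_\tau}$ is the scalar curvature of $h_\tau$. Consequently $(g,\bar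 b,\bar\phi)$ is a gradient generalized Ricci soliton if and only if its reduction satisfies these two systems for some $\lambda\in\mathbb R$. -/

import Mathlib

open scoped Manifold ContDiff Topology

noncomputable section

namespace GerbeSoliton

/-! ### Tensor fields and differential forms on manifolds -/

section Tensors

variable {E : Type*} [NormedAddCommGroup E] [NormedSpace ℝ E]
  {H : Type*} [TopologicalSpace H] (I : ModelWithCorners ℝ E H)
  (M : Type*) [TopologicalSpace M] [ChartedSpace H M]

/-- Covariant `k`-tensor fields on `M`, given by their values on `k`-tuples of tangent vectors. All
the tensor fields below arise from bilinear forms, alternating maps or differentials and are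
multilinear at each point. -/
abbrev CovTensor (k : ℕ) : Type _ := ∀ x : M, (Fin k → TangentSpace I x) → ℝ

/-- Fields of alternating `k`-forms on `M`, without any regularity. -/
abbrev FormField (k : ℕ) : Type _ := ∀ x : M, TangentSpace I x [⋀^Fin k]→L[ℝ] ℝ

variable {I M}

/-- The representative of a field of `k`-forms in the preferred chart at `x₀`: its pull-back by the
inverse of the chart. -/
def FormField.inChart {k : ℕ} (α : FormField I M k) (x₀ : M) : E → E [⋀^Fin k]→L[ℝ] ℝ :=
  fun u => (α ((extChartAt I x₀).symm u)).compContinuousLinearMap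
    (mfderiv 𝓘(ℝ, E) I (extChartAt I x₀).symm u)

/-- The exterior derivative. The tangent space at `x` is identified with the model space `E` by the
preferred chart at `x`, in which the exterior derivative is computed. -/
def FormField.d {k : ℕ} (α : FormField I M k) : FormField I M (k + 1) :=
  fun x => (extDeriv (α.inChart x) (extChartAt I x x) : E [⋀^Fin (k + 1)]→L[ℝ] ℝ)

/-- The pull-back of a field of forms by a map. -/
def FormField.pullback {E' : Type*} [NormedAddCommGroup E'] [NormedSpace ℝ E']
    {H' : Type*} [TopologicalSpace H'] {I' : ModelWithCorners ℝ E' H'}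
    {N : Type*} [TopologicalSpace N] [ChartedSpace H' N] {k : ℕ}
    (f : N → M) (α : FormField I M k) : FormField I' N k :=
  fun y => (α (f y)).compContinuousLinearMap (mfderiv I' I f y)

/-- The covariant tensor field underlying a field of forms. -/
def FormField.toTensor {k : ℕ} (α : FormField I M k) : CovTensor I M k := fun x v => α x v

/-- The value of a one-form on the velocity of a curve. -/
def FormField.along (A : FormField I M 1) (γ : ℝ → M) (t : ℝ) : ℝ :=
  A (γ t) (fun _ => mfderiv 𝓘(ℝ, ℝ) I γ t (1 : ℝ))

variable (I M) in
/-- Smooth differential `k`-forms on a manifold without boundary. -/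
structure DiffForm (k : ℕ) where
  /-- The underlying field of alternating forms. -/
  toField : FormField I M k
  /-- The representatives in charts are smooth. -/
  smooth : ∀ x₀ : M, ContDiffOn ℝ ∞ (toField.inChart x₀) (extChartAt I x₀).target

/-- The differential of a function. -/
def differential (I : ModelWithCorners ℝ E H) (f : M → ℝ) : CovTensor I M 1 :=
  fun x v => mfderiv I 𝓘(ℝ, ℝ) f x (v 0)

end Tensors

/-! ### Riemannian geometry in coordinates

`e` is a basis of the model space; at each point `x` it is identified with the coordinate frame at
`x` of the preferred chart at `x`. The tensor `g` is a Riemannian metric, and all the components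
below refer to this frame. -/

section Riemannian

variable {E : Type*} [NormedAddCommGroup E] [NormedSpace ℝ E]
  {H : Type*} [TopologicalSpace H] {I : ModelWithCorners ℝ E H}
  {M : Type*} [TopologicalSpace M] [ChartedSpace H M]
  {ι : Type*} [Fintype ι] [DecidableEq ι] (e : Module.Basis ι ℝ E)

/-- The components of a tensor field in the coordinate frame of the preferred chart at `x₀`, at the
point with coordinates `u`. -/
def chartComp {k : ℕ} (T : CovTensor I M k) (x₀ : M) (u : E) (a : Fin k → ι) : ℝ :=
  T ((extChartAt I x₀).symm u) (fun s => mfderiv 𝓘(ℝ, E) I (extChartAt I x₀).symm u (e (a s)))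

/-- The partial derivative `∂ᵢ F`. -/
def partialDeriv (F : E → ℝ) (i : ι) (u : E) : ℝ := fderiv ℝ F u (e i)

/-- The metric matrix `g i j` as a function of the coordinates `u`. -/
def chartGram (g : CovTensor I M 2) (x₀ : M) (u : E) : Matrix ι ι ℝ :=
  Matrix.of fun i j => chartComp e g x₀ u ![i, j]

/-- The Christoffel symbols `Γ k i j` (upper index first) of the Levi-Civita connection. -/
def christoffel (g : CovTensor I M 2) (x₀ : M) (k i j : ι) (u : E) : ℝ :=
  (1 / 2) * ∑ l, (chartGram e g x₀ u)⁻¹ k l *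
    (partialDeriv e (fun w => chartGram e g x₀ w j l) i u
      + partialDeriv e (fun w => chartGram e g x₀ w i l) j u
      - partialDeriv e (fun w => chartGram e g x₀ w i j) l u)

/-- The components of the Ricci curvature,
`∂ₖ Γᵏᵢⱼ - ∂ⱼ Γᵏᵢₖ + Γᵏₖₗ Γˡᵢⱼ - Γᵏⱼₗ Γˡᵢₖ` (positive on round spheres). -/
def ricci (g : CovTensor I M 2) (x : M) (i j : ι) : ℝ :=
  ∑ k, (partialDeriv e (christoffel e g x k i j) k (extChartAt I x x)
      - partialDeriv e (christoffel e g x k i k) j (extChartAt I x x))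
    + ∑ k, ∑ l,
      (christoffel e g x k k l (extChartAt I x x) * christoffel e g x l i j (extChartAt I x x)
      - christoffel e g x k j l (extChartAt I x x) * christoffel e g x l i k (extChartAt I x x))

/-- The inverse metric matrix at `x`. -/
def gramInv (g : CovTensor I M 2) (x : M) : Matrix ι ι ℝ :=
  (Matrix.of fun i j : ι => g x ![e i, e j])⁻¹

/-- The scalar curvature. -/
def scalarCurvature (g : CovTensor I M 2) (x : M) : ℝ :=
  ∑ i, ∑ j, gramInv e g x i j * ricci e g x i j

/-- The metric trace of a two-tensor. -/
def traceG (g T : CovTensor I M 2) (x : M) : ℝ :=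
  ∑ i, ∑ j, gramInv e g x i j * T x ![e i, e j]

/-- The inner product of tensors at `x` (full contraction). -/
def tensorInner (g : CovTensor I M 2) (x : M) {k : ℕ}
    (S T : (Fin k → TangentSpace I x) → ℝ) : ℝ :=
  ∑ a : Fin k → ι, ∑ b : Fin k → ι,
    (∏ s, gramInv e g x (a s) (b s)) * S (fun s => e (a s)) * T (fun s => e (b s))

/-- The determinant inner product of alternating `k`-forms at `x`: in an orthonormal frame, the sum
over increasing multi-indices of the products of components. -/
def formInner (g : CovTensor I M 2) (x : M) {k : ℕ}
    (S T : (Fin k → TangentSpace I x) → ℝ) : ℝ :=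
  tensorInner e g x S T / (k.factorial : ℝ)

/-- Insertion of `v` in the first slot of `T`. -/
def insert {k : ℕ} (T : CovTensor I M (k + 1)) (x : M) (v : TangentSpace I x) :
    (Fin k → TangentSpace I x) → ℝ :=
  fun w => T x (Matrix.vecCons v w)

/-- `(S ∘ T)(v, w) = ⟨S(v), T(w)⟩`. -/
def circ (g : CovTensor I M 2) {k : ℕ} (S T : CovTensor I M (k + 1)) (x : M)
    (v w : TangentSpace I x) : ℝ :=
  formInner e g x (insert S x v) (insert T x w)

/-- The gradient of a function, the metric dual of its differential. -/
def gradient (g : CovTensor I M 2) (f : M → ℝ) (x : M) : TangentSpace I x :=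
  (∑ i, ∑ j, (gramInv e g x i j * differential I f x ![e j]) • e i : E)

/-- The components `(∇ₗ T) a` of the Levi-Civita covariant derivative of a tensor field. -/
def covDeriv (g : CovTensor I M 2) {k : ℕ} (T : CovTensor I M k) (x : M) (l : ι)
    (a : Fin k → ι) : ℝ :=
  partialDeriv e (fun u => chartComp e T x u a) l (extChartAt I x x)
    - ∑ s, ∑ m, christoffel e g x m l (a s) (extChartAt I x x) *
        T x (fun r => e (Function.update a s m r))

/-- The components of the codifferential (divergence with a minus sign)
`(δ T)(…) = - ∑ g^{lm} (∇ₗ T)(eₘ, …)`. -/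
def codiff (g : CovTensor I M 2) {k : ℕ} (T : CovTensor I M (k + 1)) (x : M)
    (a : Fin k → ι) : ℝ :=
  - ∑ l, ∑ m, gramInv e g x l m * covDeriv e g T x l (Matrix.vecCons m a)

/-- `(S Δ₁ T)(v, w) = ∑ₖ (S(fₖ) ∧ T(fₖ))(v, w)` for an orthonormal frame `(fₖ)`. -/
def delta1 (g : CovTensor I M 2) (S T : CovTensor I M 2) (x : M) (v w : TangentSpace I x) : ℝ :=
  ∑ k, ∑ l, gramInv e g x k l *
    (S x ![e k, v] * T x ![e l, w] - S x ![e k, w] * T x ![e l, v])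

end Riemannian

/-! ### Bundle gerbes, connective structures and curvings -/

section Gerbes

variable {EM : Type*} [NormedAddCommGroup EM] [NormedSpace ℝ EM]
  {HM : Type*} [TopologicalSpace HM] (IM : ModelWithCorners ℝ EM HM)
  (M : Type*) [TopologicalSpace M] [ChartedSpace HM M]
  {EY : Type*} [NormedAddCommGroup EY] [NormedSpace ℝ EY]
  {HY : Type*} [TopologicalSpace HY] (IY : ModelWithCorners ℝ EY HY)
  (Y : Type*) [TopologicalSpace Y] [ChartedSpace HY Y]
  {EP : Type*} [NormedAddCommGroup EP] [NormedSpace ℝ EP]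
  {HP : Type*} [TopologicalSpace HP] (IP : ModelWithCorners ℝ EP HP)
  (P : Type*) [TopologicalSpace P] [ChartedSpace HP P]

/-- A bundle gerbe over `M`: a surjective submersion `Y → M`, a principal `U(1)`-bundle `P` over the
fibre product `Y ×_M Y`, and an associative product `P₁₂ ⊗ P₂₃ → P₁₃`.

The fibre products `Y ×_M Y` and `P ×_Y P` are embedded submanifolds of `Y × Y` and `P × P`, so that
smoothness of maps defined on them is `ContMDiffOn` on the corresponding subsets. The isomorphism of
`U(1)`-bundles `P₁₂ ⊗ P₂₃ → P₁₃` is given by the bi-equivariant map `mul`, whose values on pairs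
that cannot be composed are irrelevant. -/
structure BundleGerbe where
  /-- The submersion `Y → M`. -/
  proj : Y → M
  isSubmersion_proj : Manifold.IsSubmersion IY IM ∞ proj
  surjective_proj : Function.Surjective proj
  /-- First component of the bundle projection `P → Y ×_M Y`. -/
  fst : P → Y
  /-- Second component of the bundle projection `P → Y ×_M Y`. -/
  snd : P → Y
  contMDiff_fst : ContMDiff IP IY ∞ fst
  contMDiff_snd : ContMDiff IP IY ∞ snd
  proj_fst : ∀ p, proj (fst p) = proj (snd p)
  /-- The principal action of `U(1)`. -/
  act : Circle → P → P
  contMDiff_act : ContMDiff ((𝓡 1).prod IP) IP ∞ (fun zp : Circle × P => act zp.1 zp.2)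
  act_one : ∀ p, act 1 p = p
  act_act : ∀ z w p, act z (act w p) = act (z * w) p
  fst_act : ∀ z p, fst (act z p) = fst p
  snd_act : ∀ z p, snd (act z p) = snd p
  /-- The action is free and transitive on the fibres of `P → Y ×_M Y`. -/
  existsUnique_act : ∀ p q, fst p = fst q → snd p = snd q → ∃! z, act z p = q
  /-- Local triviality: near each point of `Y ×_M Y` there is a smooth section `s`, such that the
  bijection `(y, z) ↦ z • s y` has a smooth inverse `p ↦ ((fst p, snd p), c p)`. -/
  locally_trivial : ∀ y₁ y₂, proj y₁ = proj y₂ → ∃ U : Set (Y × Y), IsOpen U ∧ (y₁, y₂) ∈ U ∧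
    ∃ (s : Y × Y → P) (c : P → Circle),
      ContMDiffOn (IY.prod IY) IP ∞ s (U ∩ {q | proj q.1 = proj q.2}) ∧
      ContMDiffOn IP (𝓡 1) ∞ c {p | (fst p, snd p) ∈ U} ∧
      (∀ q ∈ U, proj q.1 = proj q.2 → fst (s q) = q.1 ∧ snd (s q) = q.2) ∧
      ∀ p, (fst p, snd p) ∈ U → act (c p) (s (fst p, snd p)) = p
  /-- The gerbe multiplication. -/
  mul : P → P → P
  contMDiffOn_mul : ContMDiffOn (IP.prod IP) IP ∞ (fun pq : P × P => mul pq.1 pq.2)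
    {pq | snd pq.1 = fst pq.2}
  fst_mul : ∀ p q, snd p = fst q → fst (mul p q) = fst p
  snd_mul : ∀ p q, snd p = fst q → snd (mul p q) = snd q
  act_mul : ∀ z p q, snd p = fst q → mul (act z p) q = act z (mul p q)
  mul_act : ∀ z p q, snd p = fst q → mul p (act z q) = act z (mul p q)
  mul_assoc : ∀ p q r, snd p = fst q → snd q = fst r → mul (mul p q) r = mul p (mul q r)

variable {IM M IY Y IP P} (G : BundleGerbe IM M IY Y IP P)

namespace BundleGerbe

/-- `A` is a connective structure: a (real-valued) principal connection on `P` which is preserved by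
the gerbe multiplication. The last condition is the equality of one-forms `mul^* A = A₁ + A₂` on
`P ×_Y P`, tested on the velocities of smooth curves in `P ×_Y P`. -/
structure IsConnectiveStructure (A : DiffForm IP P 1) : Prop where
  invariant : ∀ z, FormField.pullback (I' := IP) (G.act z) A.toField = A.toField
  normalized : ∀ p t, A.toField.along (fun t => G.act (Circle.exp t) p) t = 1
  multiplicative : ∀ γ₁ γ₂ : ℝ → P, ContMDiff 𝓘(ℝ, ℝ) IP ∞ γ₁ → ContMDiff 𝓘(ℝ, ℝ) IP ∞ γ₂ →
    (∀ t, G.snd (γ₁ t) = G.fst (γ₂ t)) → ∀ t,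
      A.toField.along (fun t => G.mul (γ₁ t) (γ₂ t)) t
        = A.toField.along γ₁ t + A.toField.along γ₂ t

/-- `b` is a curving of `(G, A)`: `π₂^* b - π₁^* b = F_A` on `Y ×_M Y`. The curvature `F_A` is the
two-form on `Y ×_M Y` whose pull-back to `P` is `dA`; since `P → Y ×_M Y` is a surjective
submersion, the equation may be written on `P`. -/
def IsCurving (A : DiffForm IP P 1) (b : DiffForm IY Y 2) : Prop :=
  FormField.pullback (I' := IP) G.snd b.toField - FormField.pullback (I' := IP) G.fst b.toField
    = A.toField.d

/-- `F` is the curvature `H_b` of the two-form `b` on `Y`, that is the three-form on `M` with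
`π^* F = db`. It is unique because `π` is a surjective submersion. -/
def IsCurvature (b : FormField IY Y 2) (F : FormField IM M 3) : Prop :=
  FormField.pullback (I' := IY) G.proj F = b.d

end BundleGerbe

end Gerbes

/-! ### Gradient generalized Ricci solitons in the Einstein frame -/

section Solitons

variable {EM : Type*} [NormedAddCommGroup EM] [NormedSpace ℝ EM]
  {HM : Type*} [TopologicalSpace HM] {IM : ModelWithCorners ℝ EM HM}
  {M : Type*} [TopologicalSpace M] [ChartedSpace HM M]
  {EY : Type*} [NormedAddCommGroup EY] [NormedSpace ℝ EY]
  {HY : Type*} [TopologicalSpace HY] {IY : ModelWithCorners ℝ EY HY}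
  {Y : Type*} [TopologicalSpace Y] [ChartedSpace HY Y]
  {EP : Type*} [NormedAddCommGroup EP] [NormedSpace ℝ EP]
  {HP : Type*} [TopologicalSpace HP] {IP : ModelWithCorners ℝ EP HP}
  {P : Type*} [TopologicalSpace P] [ChartedSpace HP P]
  {ι : Type*} [Fintype ι] [DecidableEq ι] (e : Module.Basis ι ℝ EM)

/-- The Einstein, Maxwell and dilaton equations, in the Einstein frame and with constant `lam`, for
a metric `g`, a three-form `F` and a function `φ` on a manifold of dimension `n + 1`. -/
structure NSNSEquations (n : ℕ) (lam : ℝ) (g : CovTensor IM M 2) (F : CovTensor IM M 3)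
    (φ : M → ℝ) : Prop where
  einstein : ∀ x i j,
    ricci e g x i j
      - 1 / (n - 1 : ℝ) * (differential IM φ x ![e i] * differential IM φ x ![e j])
      + 1 / (n - 1 : ℝ) * (Real.exp (-(4 * φ x) / (n - 1)) * formInner e g x (F x) (F x)
          + lam * Real.exp (2 * φ x / (n - 1))) * g x ![e i, e j]
      - 1 / 2 * Real.exp (-(4 * φ x) / (n - 1)) * circ e g F F x (e i) (e j) = 0
  maxwell : ∀ x i j,
    codiff e g F x ![i, j] + 4 / (n - 1 : ℝ) * F x ![gradient e g φ x, e i, e j] = 0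
  dilaton : ∀ x,
    codiff e g (differential IM φ) x ![]
      = Real.exp (-(4 * φ x) / (n - 1)) * formInner e g x (F x) (F x)
        + lam * Real.exp (2 * φ x / (n - 1))

/-- `(g, b, φ)` is a gradient generalized Ricci soliton (in the Einstein frame) with constant `lam`,
on a bundle gerbe over a manifold of dimension `n + 1`. -/
def IsGradientSolitonWith (G : BundleGerbe IM M IY Y IP P) (n : ℕ) (lam : ℝ)
    (g : CovTensor IM M 2) (b : DiffForm IY Y 2) (φ : M → ℝ) : Prop :=
  ∃ F : DiffForm IM M 3, G.IsCurvature b.toField F.toField ∧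
    NSNSEquations e n lam g F.toField.toTensor φ

/-- `(g, b, φ)` is a gradient generalized Ricci soliton (in the Einstein frame). -/
def IsGradientSoliton (G : BundleGerbe IM M IY Y IP P) (n : ℕ)
    (g : CovTensor IM M 2) (b : DiffForm IY Y 2) (φ : M → ℝ) : Prop :=
  ∃ lam : ℝ, IsGradientSolitonWith e G n lam g b φ

end Solitons

/-! ### Reducible bundle gerbes over `J × S` and families over `S` -/

section Cylinder

open TopologicalSpace

variable (J : Opens ℝ)
  {ES : Type*} [NormedAddCommGroup ES] [NormedSpace ℝ ES]
  {HS : Type*} [TopologicalSpace HS] {IS : ModelWithCorners ℝ ES HS}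
  {S : Type*} [TopologicalSpace S] [ChartedSpace HS S]
  {EY : Type*} [NormedAddCommGroup EY] [NormedSpace ℝ EY]
  {HY : Type*} [TopologicalSpace HY] {IY : ModelWithCorners ℝ EY HY}
  {Y : Type*} [TopologicalSpace Y] [ChartedSpace HY Y]
  {EP : Type*} [NormedAddCommGroup EP] [NormedSpace ℝ EP]
  {HP : Type*} [TopologicalSpace HP] {IP : ModelWithCorners ℝ EP HP}
  {P : Type*} [TopologicalSpace P] [ChartedSpace HP P]

/-- The pull-back to `J × S` of a bundle gerbe over `S`. -/
def BundleGerbe.cylinder [IsManifold IS ∞ S] [IsManifold IY ∞ Y]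
    (G : BundleGerbe IS S IY Y IP P) :
    BundleGerbe (𝓘(ℝ, ℝ).prod IS) (J × S) (𝓘(ℝ, ℝ).prod IY) (J × Y)
      (𝓘(ℝ, ℝ).prod IP) (J × P) where
  proj := Prod.map id G.proj
  isSubmersion_proj := Manifold.IsSubmersion.id.prodMap G.isSubmersion_proj
  surjective_proj := Function.surjective_id.prodMap G.surjective_proj
  fst := Prod.map id G.fst
  snd := Prod.map id G.snd
  contMDiff_fst := contMDiff_id.prodMap G.contMDiff_fst
  contMDiff_snd := contMDiff_id.prodMap G.contMDiff_snd
  proj_fst p := by simp [Prod.map, G.proj_fst]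
  act z p := (p.1, G.act z p.2)
  contMDiff_act := by
    refine (_root_.contMDiff_fst.comp _root_.contMDiff_snd).prodMk ?_
    exact G.contMDiff_act.comp (_root_.contMDiff_fst.prodMk (_root_.contMDiff_snd.comp _root_.contMDiff_snd))
  act_one p := by simp [G.act_one]
  act_act z w p := by simp [G.act_act]
  fst_act z p := by simp [Prod.map, G.fst_act]
  snd_act z p := by simp [Prod.map, G.snd_act]
  existsUnique_act p q h₁ h₂ := by
    simp only [Prod.map, Prod.mk.injEq, id] at h₁ h₂
    obtain ⟨z, hz, hu⟩ := G.existsUnique_act p.2 q.2 h₁.2 h₂.2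
    refine ⟨z, Prod.ext h₁.1 hz, fun w hw => hu w (congrArg Prod.snd hw)⟩
  locally_trivial y₁ y₂ h := by
    simp only [Prod.map, Prod.mk.injEq, id] at h
    obtain ⟨U, hU, hyU, s, c, hs, hc, hsec, htriv⟩ := G.locally_trivial y₁.2 y₂.2 h.2
    refine ⟨(fun q : (J × Y) × (J × Y) => (q.1.2, q.2.2)) ⁻¹' U,
      hU.preimage (by fun_prop), hyU,
      fun q => (q.1.1, s (q.1.2, q.2.2)), fun p => c p.2, ?_, ?_, ?_, ?_⟩
    · refine (_root_.contMDiff_fst.comp _root_.contMDiff_fst).contMDiffOn.prodMk ?_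
      refine hs.comp ((_root_.contMDiff_snd.comp _root_.contMDiff_fst).prodMk
        (_root_.contMDiff_snd.comp _root_.contMDiff_snd)).contMDiffOn ?_
      rintro q ⟨hq, hq'⟩
      exact ⟨hq, congrArg Prod.snd hq'⟩
    · exact hc.comp _root_.contMDiff_snd.contMDiffOn (fun p hp => hp)
    · intro q hq hq'
      have h' := hsec _ hq (congrArg Prod.snd hq')
      have h₁ : q.1.1 = q.2.1 := (Prod.ext_iff.1 hq').1
      exact ⟨Prod.ext rfl h'.1, Prod.ext h₁ h'.2⟩
    · intro p hp
      exact Prod.ext rfl (htriv p.2 hp)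
  mul p q := (p.1, G.mul p.2 q.2)
  contMDiffOn_mul := by
    refine (_root_.contMDiff_fst.comp _root_.contMDiff_fst).contMDiffOn.prodMk ?_
    exact G.contMDiffOn_mul.comp ((_root_.contMDiff_snd.comp _root_.contMDiff_fst).prodMk
      (_root_.contMDiff_snd.comp _root_.contMDiff_snd)).contMDiffOn (fun q hq => congrArg Prod.snd hq)
  fst_mul p q h := Prod.ext rfl (G.fst_mul _ _ (congrArg Prod.snd h))
  snd_mul p q h := Prod.ext (show p.1 = q.1 from (Prod.ext_iff.1 h).1) (G.snd_mul _ _ (congrArg Prod.snd h))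
  act_mul z p q h := Prod.ext rfl (G.act_mul z _ _ (congrArg Prod.snd h))
  mul_act z p q h := Prod.ext rfl (G.mul_act z _ _ (congrArg Prod.snd h))
  mul_assoc p q r h h' :=
    Prod.ext rfl (G.mul_assoc _ _ _ (congrArg Prod.snd h) (congrArg Prod.snd h'))

variable {J}

/-- The derivative of a real function of the time `τ ∈ J`. -/
def timeDeriv (f : J → ℝ) (τ : J) : ℝ := mfderiv 𝓘(ℝ, ℝ) 𝓘(ℝ, ℝ) f τ (1 : ℝ)

/-- The time derivative of a family of tensor fields on `S`. -/
def dotTensor {k : ℕ} (T : J → CovTensor IS S k) : J → CovTensor IS S k :=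
  fun τ x v => timeDeriv (fun t => T t x v) τ

/-- The vector field `∂_τ` on `J × S`. -/
def dTau (IS : ModelWithCorners ℝ ES HS) {S : Type*} [TopologicalSpace S] [ChartedSpace HS S]
    (p : J × S) : TangentSpace (𝓘(ℝ, ℝ).prod IS) p :=
  mfderiv 𝓘(ℝ, ℝ) (𝓘(ℝ, ℝ).prod IS) (fun t : J => (t, p.2)) p.1 (1 : ℝ)

/-- The differential at `x` of the inclusion `S → J × S` of the slice `{τ} × S`. -/
def sliceMap (IS : ModelWithCorners ℝ ES HS) {S : Type*} [TopologicalSpace S] [ChartedSpace HS S]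
    (τ : J) (x : S) :
    TangentSpace IS x →L[ℝ] TangentSpace (𝓘(ℝ, ℝ).prod IS) ((τ, x) : J × S) :=
  mfderiv IS (𝓘(ℝ, ℝ).prod IS) (fun y : S => ((τ, y) : J × S)) x

/-- The metric has the form `dτ² + h_τ`. -/
def IsCylindrical (g : CovTensor (𝓘(ℝ, ℝ).prod IS) (J × S) 2) : Prop :=
  (∀ p, g p ![dTau IS p, dTau IS p] = 1) ∧
    ∀ (τ : J) (x : S) (v : TangentSpace IS x), g (τ, x) ![dTau IS (τ, x), sliceMap IS τ x v] = 0

/-- The family `h_τ` of metrics induced on the slices. -/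
def sliceTensor {k : ℕ} (T : CovTensor (𝓘(ℝ, ℝ).prod IS) (J × S) k) (τ : J) : CovTensor IS S k :=
  fun x v => T (τ, x) (fun s => sliceMap IS τ x (v s))

/-- The family of forms `α_τ` induced on the slices. For a two-form `α = dτ ∧ a_τ + b_τ` it is
`b_τ`. -/
def sliceForm {k : ℕ} (α : FormField (𝓘(ℝ, ℝ).prod IS) (J × S) k) (τ : J) : FormField IS S k :=
  FormField.pullback (I' := IS) (fun x : S => ((τ, x) : J × S)) α

/-- The family of forms induced on the slices by the contraction of `α` with `∂_τ`. For a two-form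
`α = dτ ∧ a_τ + b_τ` it is `a_τ`. -/
def sliceContraction {k : ℕ} (α : FormField (𝓘(ℝ, ℝ).prod IS) (J × S) (k + 1)) (τ : J) :
    FormField IS S k :=
  fun x => ContinuousAlternatingMap.compContinuousLinearMap
    (ContinuousAlternatingMap.curryLeft (𝕜 := ℝ) (E := ℝ × ES) (F := ℝ) (α (τ, x)) (dTau IS (τ, x)))
    (sliceMap IS τ x : ES →L[ℝ] ℝ × ES)

variable (J IS S) in
/-- Smooth families of `k`-forms on `S` parametrized by `J`. -/
structure FormFamily (k : ℕ) where
  /-- The underlying family of fields of alternating forms. -/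
  toField : J → FormField IS S k
  /-- The representatives in charts depend smoothly on time and space together. -/
  smooth : ∀ x₀ : S, ContMDiffOn (𝓘(ℝ, ℝ).prod 𝓘(ℝ, ES)) 𝓘(ℝ, ES [⋀^Fin k]→L[ℝ] ℝ) ∞
    (fun p : J × ES => (toField p.1).inChart x₀ p.2) (Set.univ ×ˢ (extChartAt IS x₀).target)

/-- `ψ` is the derived family of two-forms of the curving `dτ ∧ a_τ + b_τ`, that is
`π^* ψ_τ = ∂_τ b_τ - d_Y a_τ`. -/
def BundleGerbe.IsDerivedFamily (G : BundleGerbe IS S IY Y IP P)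
    (a : J → FormField IY Y 1) (b : J → FormField IY Y 2) (ψ : J → FormField IS S 2) : Prop :=
  ∀ (τ : J) (y : Y) (v : Fin 2 → TangentSpace IY y),
    FormField.pullback (I' := IY) G.proj (ψ τ) y v
      = dotTensor (fun t => (b t).toTensor) τ y v - (a τ).d y v

variable {ι : Type*} [Fintype ι] [DecidableEq ι] (e : Module.Basis ι ℝ ES)

/-- The evolution equations, for families of metrics `h`, two-forms `ψ`, three-forms `F` and
functions `φ` on a manifold `S` of dimension `n`. -/
structure EvolutionEquations (n : ℕ) (lam : ℝ) (h : J → CovTensor IS S 2)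
    (ψ : J → CovTensor IS S 2) (F : J → CovTensor IS S 3) (φ : J → S → ℝ) : Prop where
  metric : ∀ τ x i j,
    dotTensor (dotTensor h) τ x ![e i, e j]
      = 2 * ricci e (h τ) x i j
        + circ e (h τ) (dotTensor h τ) (dotTensor h τ) x (e i) (e j)
        - 1 / 2 * traceG e (h τ) (dotTensor h τ) x * dotTensor h τ x ![e i, e j]
        - 2 / (n - 1 : ℝ) *
          (differential IS (φ τ) x ![e i] * differential IS (φ τ) x ![e j])
        + 2 / (n - 1 : ℝ) * (Real.exp (-(4 * φ τ x) / (n - 1)) *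
            (formInner e (h τ) x (ψ τ x) (ψ τ x) + formInner e (h τ) x (F τ x) (F τ x))
            + lam * Real.exp (2 * φ τ x / (n - 1))) * h τ x ![e i, e j]
        - Real.exp (-(4 * φ τ x) / (n - 1)) *
          (circ e (h τ) (ψ τ) (ψ τ) x (e i) (e j) + circ e (h τ) (F τ) (F τ) x (e i) (e j))
  twoForm : ∀ τ x i j,
    dotTensor ψ τ x ![e i, e j]
      = codiff e (h τ) (F τ) x ![i, j]
        + 4 / (n - 1 : ℝ) * F τ x ![gradient e (h τ) (φ τ) x, e i, e j]
        + delta1 e (h τ) (dotTensor h τ) (ψ τ) x (e i) (e j)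
        + (4 / (n - 1 : ℝ) * timeDeriv (fun t => φ t x) τ
            - 1 / 2 * traceG e (h τ) (dotTensor h τ) x) * ψ τ x ![e i, e j]
  dilaton : ∀ τ x,
    timeDeriv (timeDeriv (fun t => φ t x)) τ
      = codiff e (h τ) (differential IS (φ τ)) x ![]
        - 1 / 2 * timeDeriv (fun t => φ t x) τ * traceG e (h τ) (dotTensor h τ) x
        - Real.exp (-(4 * φ τ x) / (n - 1)) *
          (formInner e (h τ) x (ψ τ x) (ψ τ x) + formInner e (h τ) x (F τ x) (F τ x))
        - lam * Real.exp (2 * φ τ x / (n - 1))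

/-- The time-dependent constraints, for families of metrics `h`, two-forms `ψ`, three-forms `F` and
functions `φ` on a manifold `S` of dimension `n`. The one-form `ψ ⌟ F` is `v ↦ ⟨ψ, F(v)⟩`. -/
structure ConstraintEquations (n : ℕ) (lam : ℝ) (h : J → CovTensor IS S 2)
    (ψ : J → CovTensor IS S 2) (F : J → CovTensor IS S 3) (φ : J → S → ℝ) : Prop where
  hamiltonian : ∀ τ x,
    scalarCurvature e (h τ) x
      + 1 / 4 * tensorInner e (h τ) x (dotTensor h τ x) (dotTensor h τ x)
      - 1 / 4 * traceG e (h τ) (dotTensor h τ) x ^ 2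
      + lam * Real.exp (2 * φ τ x / (n - 1))
      + 1 / (n - 1 : ℝ) * (timeDeriv (fun t => φ t x) τ ^ 2
          - formInner e (h τ) x (differential IS (φ τ) x) (differential IS (φ τ) x))
      + 1 / 2 * (formInner e (h τ) x (ψ τ x) (ψ τ x) - formInner e (h τ) x (F τ x) (F τ x))
          * Real.exp (-(4 * φ τ x) / (n - 1)) = 0
  momentum : ∀ τ x i,
    codiff e (h τ) (dotTensor h τ) x ![i]
      + differential IS (traceG e (h τ) (dotTensor h τ)) x ![e i]
      + 2 / (n - 1 : ℝ) * timeDeriv (fun t => φ t x) τ * differential IS (φ τ) x ![e i]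
      + Real.exp (-(4 * φ τ x) / (n - 1)) * formInner e (h τ) x (ψ τ x) (insert (F τ) x (e i)) = 0
  gauss : ∀ τ x i,
    codiff e (h τ) (ψ τ) x ![i] + 4 / (n - 1 : ℝ) * ψ τ x ![gradient e (h τ) (φ τ) x, e i] = 0

/-- The tuple `(h_τ, a_τ, b_τ, φ_τ)` satisfies the evolution equations and the time-dependent
constraints with constant `lam`, where `ψ_τ` is the derived family of two-forms and `F_τ` is the
curvature of `b_τ`. -/
def SatisfiesReducedSystem (G : BundleGerbe IS S IY Y IP P) (n : ℕ) (lam : ℝ)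
    (h : J → CovTensor IS S 2) (a : J → FormField IY Y 1) (b : J → FormField IY Y 2)
    (φ : J → S → ℝ) : Prop :=
  ∃ (ψ : FormFamily J IS S 2) (F : FormFamily J IS S 3),
    G.IsDerivedFamily a b ψ.toField ∧ (∀ τ, G.IsCurvature (b τ) (F.toField τ)) ∧
    EvolutionEquations e n lam h
      (fun τ => (ψ.toField τ).toTensor) (fun τ => (F.toField τ).toTensor) φ ∧
    ConstraintEquations e n lam h
      (fun τ => (ψ.toField τ).toTensor) (fun τ => (F.toField τ).toTensor) φ

end Cylinder

/-- The standard basis of `ℝⁿ`. -/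
def stdBasis (n : ℕ) : Module.Basis (Fin n) ℝ (EuclideanSpace ℝ (Fin n)) :=
  (EuclideanSpace.basisFun (Fin n) ℝ).toBasis

/-- The standard basis of `ℝ × ℝⁿ`. -/
def cylBasis (n : ℕ) : Module.Basis (Unit ⊕ Fin n) ℝ (ℝ × EuclideanSpace ℝ (Fin n)) :=
  (Module.Basis.singleton Unit ℝ).prod (stdBasis n)

/-- The covariant two-tensor of a smooth Riemannian metric. -/
def metricTensor {E : Type*} [NormedAddCommGroup E] [NormedSpace ℝ E]
    {H : Type*} [TopologicalSpace H] {I : ModelWithCorners ℝ E H}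
    {M : Type*} [TopologicalSpace M] [ChartedSpace H M] [IsManifold I ∞ M]
    (g : Bundle.ContMDiffRiemannianMetric I ∞ E (fun x : M => TangentSpace I x)) :
    CovTensor I M 2 :=
  fun x v => g.inner x (v 0) (v 1)

end GerbeSoliton

end

noncomputable section


/-! The chart of `J` is the inclusion in `ℝ`, so the product chart of `J × S` at a point covers all
times at once. In it a cylindrical metric is the block matrix `1 ⊕ G(τ, y)`, and time and space
derivatives are directional derivatives, along constant and hence commuting vectors, of functions on
one open subset of `ℝ × E`. The theorem is the decomposition of the soliton equations into their
time and space components in this frame.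

Besides the Christoffel symbols of `G`, the metric `dτ² + G` only has `Γ⁰ᵢⱼ = -½ ∂₀Gᵢⱼ` and the
Weingarten map `Γᵏ₀ⱼ = ½ (G⁻¹∂₀G)ᵏⱼ` (`christoffelOf_cylGram`). They yield the Ricci tensor in
Gauss, Codazzi and Riccati form (`ricciOf_cylGram_space`, `ricciOf_cylGram_mixed`,
`ricciOf_cylGram_time`) and the codifferential of `H = dτ ∧ ψ + F` (`codiffOf_cylGram_inr_inr`,
`codiffOf_cylGram_inl_inr`), while `|H|² = |ψ|² + |F|²` (`formInner_cyl`).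

Up to a constant factor, the space-space Einstein equation is then the evolution of the metric, the
space-space Maxwell equation that of `ψ`, and the dilaton equation that of `φ`. The time-space
Einstein and Maxwell equations are the momentum and Gauss constraints. The time-time Einstein
equation contains the trace of `∂_τ²h`; eliminating it by the traced evolution equation, with `Tr h
= n`, leaves the Hamiltonian constraint. Thus these two are equivalent only in the presence of the
evolution equation of the metric (`nsnsEquations_cyl_iff`).

On the gerbe, `d(dτ ∧ a + b) = dτ ∧ (∂_τ b - d_Y a) + d_Y b`, and the submersion of the cylinder is
`id × π`. Hence `H` is the curvature of the curving exactly when its two parts are the derived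
family and the curvatures of the `b_τ` (`BundleGerbe.isCurvature_cylinder_iff`). Conversely,
families `ψ` and `F` assemble into a smooth form `dτ ∧ ψ + F` (`cylDiffForm`).

One point is not purely local in a fixed chart: the momentum constraint differentiates the trace of
`∂_τ h` along `S`, and this trace is defined at each point by that point's own chart.
`traceG_dotTensor_chart` shows that the choice does not matter. -/

namespace GerbeSoliton

/-! ### Directional derivatives of smooth functions on open sets. -/

section DirDeriv

variable {W : Type*} [NormedAddCommGroup W] [NormedSpace ℝ W]

/-- The directional derivative of a real function. -/
def dirDeriv (v : W) (F : W → ℝ) (u : W) : ℝ := fderiv ℝ F u v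

variable {U : Set W} {F F' : W → ℝ} {u : W}

lemma _root_.ContDiffOn.differentiableAt_of_isOpen {W' : Type*} [NormedAddCommGroup W']
    [NormedSpace ℝ W'] {f : W → W'} (hF : ContDiffOn ℝ ∞ f U) (hU : IsOpen U)
    (hu : u ∈ U) : DifferentiableAt ℝ f u :=
  (hF.contDiffAt (hU.mem_nhds hu)).differentiableAt (by simp)

lemma contDiffOn_dirDeriv (hU : IsOpen U) (hF : ContDiffOn ℝ ∞ F U) (v : W) :
    ContDiffOn ℝ ∞ (dirDeriv v F) U :=
  (hF.fderiv_of_isOpen hU (by simp)).clm_apply contDiffOn_const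

lemma dirDeriv_congr (hU : IsOpen U) (hu : u ∈ U) (h : ∀ w ∈ U, F w = F' w) (v : W) :
    dirDeriv v F u = dirDeriv v F' u := by
  have : F =ᶠ[𝓝 u] F' := Filter.eventually_of_mem (hU.mem_nhds hu) h
  simp [dirDeriv, this.fderiv_eq]

@[simp] lemma dirDeriv_const (v : W) (c : ℝ) : dirDeriv v (fun _ => c) u = 0 := by
  simp [dirDeriv]

lemma dirDeriv_const_mul (hU : IsOpen U) (hu : u ∈ U) (hF : ContDiffOn ℝ ∞ F U) (v : W) (c : ℝ) :
    dirDeriv v (fun w => c * F w) u = c * dirDeriv v F u := by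
  simp [dirDeriv, fderiv_const_mul (hF.differentiableAt_of_isOpen hU hu)]

lemma dirDeriv_neg (v : W) : dirDeriv v (fun w => - F w) u = - dirDeriv v F u := by
  simp [dirDeriv]

lemma dirDeriv_mul (hU : IsOpen U) (hu : u ∈ U) (hF : ContDiffOn ℝ ∞ F U)
    (hF' : ContDiffOn ℝ ∞ F' U) (v : W) :
    dirDeriv v (fun w => F w * F' w) u = dirDeriv v F u * F' u + F u * dirDeriv v F' u := by
  simp [dirDeriv, fderiv_fun_mul (hF.differentiableAt_of_isOpen hU hu)
    (hF'.differentiableAt_of_isOpen hU hu)]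
  ring

lemma dirDeriv_sum {α : Type*} {s : Finset α} {f : α → W → ℝ} (hU : IsOpen U) (hu : u ∈ U)
    (hf : ∀ a ∈ s, ContDiffOn ℝ ∞ (f a) U) (v : W) :
    dirDeriv v (fun w => ∑ a ∈ s, f a w) u = ∑ a ∈ s, dirDeriv v (f a) u := by
  simp [dirDeriv, fderiv_fun_sum (fun a ha => (hf a ha).differentiableAt_of_isOpen hU hu)]

lemma dirDeriv_comm (hU : IsOpen U) (hu : u ∈ U) (hF : ContDiffOn ℝ ∞ F U) (v w : W) :
    dirDeriv v (dirDeriv w F) u = dirDeriv w (dirDeriv v F) u := by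
  have hd : DifferentiableAt ℝ (fderiv ℝ F) u :=
    (hF.fderiv_of_isOpen (m := ∞) hU (by simp)).differentiableAt_of_isOpen hU hu
  have key : ∀ a b : W, dirDeriv a (dirDeriv b F) u = fderiv ℝ (fderiv ℝ F) u a b := by
    intro a b
    have : fderiv ℝ (fun y => fderiv ℝ F y b) u a = _ :=
      congrArg (· a) (fderiv_clm_apply hd (differentiableAt_const b))
    exact this.trans (by simp)
  rw [key, key]
  exact ((hF.contDiffAt (hU.mem_nhds hu)).isSymmSndFDerivAt
    (by rw [minSmoothness_of_isRCLikeNormedField]; exact WithTop.coe_le_coe.2 le_top)) v w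

/-- Together with `deriv_prodMk_right` this turns derivatives on a slice and in time into
directional derivatives on `ℝ × V`, so that the curvature computation takes place in a single space.
-/
lemma dirDeriv_prodMk_left {V : Type*} [NormedAddCommGroup V] [NormedSpace ℝ V]
    {f : ℝ × V → ℝ} {t : ℝ} {y : V} (hf : DifferentiableAt ℝ f (t, y)) (v : V) :
    dirDeriv v (fun z => f (t, z)) y = dirDeriv (0, v) f (t, y) := by
  have h : HasFDerivAt (fun z : V => ((t, z) : ℝ × V)) (ContinuousLinearMap.inr ℝ ℝ V) y :=
    hasFDerivAt_prodMk_right t y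
  have : dirDeriv v (fun z => f (t, z)) y = (fderiv ℝ f (t, y) ∘L ContinuousLinearMap.inr ℝ ℝ V) v :=
    congrArg (· v) (hf.hasFDerivAt.comp y h).fderiv
  simpa [dirDeriv] using this

lemma deriv_prodMk_right {V : Type*} [NormedAddCommGroup V] [NormedSpace ℝ V]
    {f : ℝ × V → ℝ} {t : ℝ} {y : V} (hf : DifferentiableAt ℝ f (t, y)) :
    deriv (fun s => f (s, y)) t = dirDeriv (1, 0) f (t, y) := by
  have h : HasFDerivAt (fun s : ℝ => ((s, y) : ℝ × V)) (ContinuousLinearMap.inl ℝ ℝ V) t :=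
    hasFDerivAt_prodMk_left t y
  rw [← fderiv_apply_one_eq_deriv]
  exact congrArg (· 1) (hf.hasFDerivAt.comp t h).fderiv

end DirDeriv

/-! ### Riemannian geometry of a matrix of functions along constant directions. -/

section LocalGeometry

variable {W : Type*} [NormedAddCommGroup W] [NormedSpace ℝ W]
  {κ : Type*} [Fintype κ] [DecidableEq κ]

/-- Smooth non-degenerate symmetric matrix functions on `U`. -/
structure IsMetricOn (G : W → Matrix κ κ ℝ) (U : Set W) : Prop where
  isOpen : IsOpen U
  smooth : ∀ i j, ContDiffOn ℝ ∞ (fun u => G u i j) U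
  symm : ∀ u ∈ U, ∀ i j, G u i j = G u j i
  isUnit_det : ∀ u ∈ U, IsUnit (G u).det

/-- The Christoffel symbols of a metric matrix with respect to commuting directions `d`. -/
def christoffelOf (d : κ → W) (G : W → Matrix κ κ ℝ) (k i j : κ) (u : W) : ℝ :=
  (1 / 2) * ∑ l, (G u)⁻¹ k l * (dirDeriv (d i) (fun w => G w j l) u
    + dirDeriv (d j) (fun w => G w i l) u - dirDeriv (d l) (fun w => G w i j) u)

/-- The Ricci curvature of a metric matrix with respect to commuting directions `d`. -/
def ricciOf (d : κ → W) (G : W → Matrix κ κ ℝ) (i j : κ) (u : W) : ℝ :=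
  ∑ k, (dirDeriv (d k) (christoffelOf d G k i j) u - dirDeriv (d j) (christoffelOf d G k i k) u)
    + ∑ k, ∑ l, (christoffelOf d G k k l u * christoffelOf d G l i j u
      - christoffelOf d G k j l u * christoffelOf d G l i k u)

/-- The codifferential of a tensor field, given by its components. -/
def codiffOf (d : κ → W) (G : W → Matrix κ κ ℝ) {k : ℕ} (T : W → (Fin (k + 1) → κ) → ℝ)
    (a : Fin k → κ) (u : W) : ℝ :=
  - ∑ l, ∑ m, (G u)⁻¹ l m * (dirDeriv (d l) (fun w => T w (Matrix.vecCons m a)) u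
    - ∑ s, ∑ r, christoffelOf d G r l (Matrix.vecCons m a s) u *
      T u (Function.update (Matrix.vecCons m a) s r))

lemma contDiffOn_det {U : Set W} {G : W → Matrix κ κ ℝ}
    (h : ∀ i j, ContDiffOn ℝ ∞ (fun u => G u i j) U) :
    ContDiffOn ℝ ∞ (fun u => (G u).det) U := by
  simp only [Matrix.det_apply]
  refine ContDiffOn.sum fun σ _ => ?_
  exact (contDiffOn_prod fun i _ => h (σ i) i).const_smul (Equiv.Perm.sign σ)

namespace IsMetricOn

variable {U : Set W} {G : W → Matrix κ κ ℝ} {u : W} (hG : IsMetricOn G U)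
include hG

/-- Cramer's rule: the entries of the inverse are polynomials in the entries of `G` divided by the
determinant. -/
lemma inv_smooth (i j : κ) : ContDiffOn ℝ ∞ (fun u => (G u)⁻¹ i j) U := by
  have hadj : ContDiffOn ℝ ∞ (fun u => (G u).adjugate i j) U := by
    simp only [Matrix.adjugate_apply]
    refine contDiffOn_det fun k l => ?_
    by_cases hk : k = j
    · subst hk; simpa using contDiffOn_const
    · simpa [Matrix.updateRow_ne hk] using hG.smooth k l
  have hdet := (contDiffOn_det hG.smooth).inv fun u hu => (hG.isUnit_det u hu).ne_zero
  refine (hdet.mul hadj).congr fun u hu => ?_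
  simp [Matrix.inv_def, Ring.inverse_eq_inv]

lemma inv_symm (hu : u ∈ U) (i j : κ) : (G u)⁻¹ i j = (G u)⁻¹ j i := by
  have h : (G u).transpose = G u := by ext i j; exact hG.symm u hu j i
  conv_lhs => rw [← h, ← Matrix.transpose_nonsing_inv]
  rfl

lemma inv_mul_sum (hu : u ∈ U) (i j : κ) :
    ∑ k, (G u)⁻¹ i k * G u k j = if i = j then 1 else 0 := by
  have := congrFun (congrFun (Matrix.nonsing_inv_mul (G u) (hG.isUnit_det u hu)) i) j
  simpa [Matrix.mul_apply, Matrix.one_apply] using this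

lemma mul_inv_sum (hu : u ∈ U) (i j : κ) :
    ∑ k, G u i k * (G u)⁻¹ k j = if i = j then 1 else 0 := by
  have := congrFun (congrFun (Matrix.mul_nonsing_inv (G u) (hG.isUnit_det u hu)) i) j
  simpa [Matrix.mul_apply, Matrix.one_apply] using this

/-- Differentiate `G⁻¹ G = 1` and multiply by `G⁻¹` on the right. -/
lemma dirDeriv_inv (hu : u ∈ U) (v : W) (i j : κ) :
    dirDeriv v (fun w => (G w)⁻¹ i j) u
      = - ∑ a, ∑ b, (G u)⁻¹ i a * dirDeriv v (fun w => G w a b) u * (G u)⁻¹ b j := by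
  have hU := hG.isOpen
  have h0 : ∀ b, ∑ a, (dirDeriv v (fun w => (G w)⁻¹ i a) u * G u a b
      + (G u)⁻¹ i a * dirDeriv v (fun w => G w a b) u) = 0 := by
    intro b
    have h1 := dirDeriv_congr hU hu (fun w hw => hG.inv_mul_sum hw i b) v
    rw [dirDeriv_const, dirDeriv_sum hU hu
      (fun a _ => (hG.inv_smooth i a).mul (hG.smooth a b))] at h1
    rw [← h1]
    exact Finset.sum_congr rfl fun a _ =>
      (dirDeriv_mul hU hu (hG.inv_smooth i a) (hG.smooth a b) v).symm
  have h2 : ∑ b, (∑ a, (dirDeriv v (fun w => (G w)⁻¹ i a) u * G u a b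
      + (G u)⁻¹ i a * dirDeriv v (fun w => G w a b) u)) * (G u)⁻¹ b j = 0 := by
    simp [h0]
  simp only [Finset.sum_add_distrib, add_mul] at h2
  have h3 : ∑ b, (∑ a, dirDeriv v (fun w => (G w)⁻¹ i a) u * G u a b) * (G u)⁻¹ b j
      = dirDeriv v (fun w => (G w)⁻¹ i j) u := by
    simp only [Finset.sum_mul]
    rw [Finset.sum_comm]
    simp only [mul_assoc, ← Finset.mul_sum, hG.mul_inv_sum hu]
    simp
  rw [h3] at h2
  rw [eq_neg_iff_add_eq_zero, ← h2]
  congr 1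
  rw [Finset.sum_comm]
  simp only [Finset.sum_mul]

lemma contDiffOn_christoffelOf (d : κ → W) (k i j : κ) :
    ContDiffOn ℝ ∞ (christoffelOf d G k i j) U := by
  have hd := fun v i j => contDiffOn_dirDeriv hG.isOpen (hG.smooth i j) v
  refine contDiffOn_const.mul (ContDiffOn.sum fun l _ => (hG.inv_smooth k l).mul ?_)
  exact ((hd _ _ _).add (hd _ _ _)).sub (hd _ _ _)

lemma dirDeriv_symm (hu : u ∈ U) (v : W) (i j : κ) :
    dirDeriv v (fun w => G w i j) u = dirDeriv v (fun w => G w j i) u :=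
  dirDeriv_congr hG.isOpen hu (fun w hw => hG.symm w hw i j) v

lemma christoffelOf_symm (hu : u ∈ U) (d : κ → W) (k i j : κ) :
    christoffelOf d G k i j u = christoffelOf d G k j i u := by
  unfold christoffelOf
  congr 1
  refine Finset.sum_congr rfl fun l _ => ?_
  rw [hG.dirDeriv_symm hu (d l) i j]
  ring

/-- The Christoffel symbols with all indices lowered. -/
lemma sum_mul_christoffelOf (hu : u ∈ U) (d : κ → W) (l i j : κ) :
    ∑ k, G u l k * christoffelOf d G k i j u
      = (1 / 2) * (dirDeriv (d i) (fun w => G w j l) u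
        + dirDeriv (d j) (fun w => G w i l) u - dirDeriv (d l) (fun w => G w i j) u) := by
  unfold christoffelOf
  simp only [Finset.mul_sum]
  rw [Finset.sum_comm]
  have : ∀ m k, G u l k * (1 / 2 * ((G u)⁻¹ k m * (dirDeriv (d i) (fun w => G w j m) u
        + dirDeriv (d j) (fun w => G w i m) u - dirDeriv (d m) (fun w => G w i j) u)))
      = (G u l k * (G u)⁻¹ k m) * (1 / 2 * (dirDeriv (d i) (fun w => G w j m) u
        + dirDeriv (d j) (fun w => G w i m) u - dirDeriv (d m) (fun w => G w i j) u)) := by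
    intros; ring
  simp only [this, ← Finset.sum_mul, hG.mul_inv_sum hu]
  simp

/-- Metric compatibility `∇g = 0`: adding two lowered Christoffel symbols cancels all derivatives
but one. -/
lemma dirDeriv_eq_christoffelOf (hu : u ∈ U) (d : κ → W) (l i j : κ) :
    dirDeriv (d l) (fun w => G w i j) u
      = ∑ k, (G u i k * christoffelOf d G k l j u + G u j k * christoffelOf d G k l i u) := by
  rw [Finset.sum_add_distrib, hG.sum_mul_christoffelOf hu, hG.sum_mul_christoffelOf hu,
    hG.dirDeriv_symm hu (d l) j i, hG.dirDeriv_symm hu (d j) l i, hG.dirDeriv_symm hu (d i) l j]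
  ring

/-- The dual statement `∇g⁻¹ = 0`, obtained by inserting metric compatibility into the derivative of
the inverse. -/
lemma dirDeriv_inv_eq_christoffelOf (hu : u ∈ U) (d : κ → W) (l i j : κ) :
    dirDeriv (d l) (fun w => (G w)⁻¹ i j) u
      = - ∑ k, (christoffelOf d G i l k u * (G u)⁻¹ k j + christoffelOf d G j l k u * (G u)⁻¹ i k) := by
  rw [hG.dirDeriv_inv hu]
  congr 1
  have h1 : ∀ a b, (G u)⁻¹ i a * dirDeriv (d l) (fun w => G w a b) u * (G u)⁻¹ b j
      = ∑ k, ((G u)⁻¹ i a * G u a k) * (christoffelOf d G k l b u * (G u)⁻¹ b j)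
        + ∑ k, ((G u)⁻¹ j b * G u b k) * (christoffelOf d G k l a u * (G u)⁻¹ i a) := by
    intro a b
    rw [hG.dirDeriv_eq_christoffelOf hu, hG.inv_symm hu b j, ← Finset.sum_add_distrib,
      Finset.mul_sum, Finset.sum_mul]
    exact Finset.sum_congr rfl fun k _ => by ring
  simp only [h1, Finset.sum_add_distrib]
  congr 1
  · rw [Finset.sum_comm]
    refine Finset.sum_congr rfl fun b _ => ?_
    rw [Finset.sum_comm]
    simp only [← Finset.sum_mul, hG.inv_mul_sum hu]
    simp
  · refine Finset.sum_congr rfl fun a _ => ?_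
    rw [Finset.sum_comm]
    simp only [← Finset.sum_mul, hG.inv_mul_sum hu]
    simp

/-- The other two derivative terms cancel because `G⁻¹` is symmetric. What remains is the
logarithmic derivative of `√|det G|`, whence the symmetry of mixed derivatives used later. -/
lemma christoffelOf_trace (hu : u ∈ U) (d : κ → W) (i : κ) :
    ∑ k, christoffelOf d G k i k u
      = (1 / 2) * ∑ k, ∑ l, (G u)⁻¹ k l * dirDeriv (d i) (fun w => G w k l) u := by
  unfold christoffelOf
  rw [← Finset.mul_sum]
  congr 1
  simp only [mul_sub, mul_add, Finset.sum_add_distrib, Finset.sum_sub_distrib]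
  have : ∑ k, ∑ l, (G u)⁻¹ k l * dirDeriv (d k) (fun w => G w i l) u
      = ∑ k, ∑ l, (G u)⁻¹ k l * dirDeriv (d l) (fun w => G w i k) u := by
    rw [Finset.sum_comm]
    exact Finset.sum_congr rfl fun k _ => Finset.sum_congr rfl fun l _ => by
      rw [hG.inv_symm hu]
  rw [this]
  ring

end IsMetricOn

end LocalGeometry

section Directions

variable {W ι : Type*}

/-- The directions `d` together with a distinguished direction `d₀`. -/
def cylDir (d₀ : W) (d : ι → W) : Unit ⊕ ι → W := Sum.elim (fun _ => d₀) d

@[simp] lemma cylDir_inl (d₀ : W) (d : ι → W) (x : Unit) : cylDir d₀ d (Sum.inl x) = d₀ := rfl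
@[simp] lemma cylDir_inr (d₀ : W) (d : ι → W) (i : ι) : cylDir d₀ d (Sum.inr i) = d i := rfl

end Directions

/-! ### Christoffel symbols and Ricci tensor of `dτ² + G`. -/

section CylindricalMetric

variable {W : Type*} [NormedAddCommGroup W] [NormedSpace ℝ W]
  {ι : Type*} [Fintype ι] [DecidableEq ι]

/-- The matrix of the metric `dτ² + G`. -/
def cylGram (G : W → Matrix ι ι ℝ) (u : W) : Matrix (Unit ⊕ ι) (Unit ⊕ ι) ℝ :=
  Matrix.fromBlocks 1 0 0 (G u)

/-- The Weingarten map `½ G⁻¹ ∂₀G`. -/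
def weingarten (d₀ : W) (G : W → Matrix ι ι ℝ) (k i : ι) (u : W) : ℝ :=
  (1 / 2) * ∑ l, (G u)⁻¹ k l * dirDeriv d₀ (fun w => G w i l) u

/-- The Christoffel symbols of the metric `dτ² + G`. -/
def cylChristoffel (d₀ : W) (d : ι → W) (G : W → Matrix ι ι ℝ) :
    Unit ⊕ ι → Unit ⊕ ι → Unit ⊕ ι → W → ℝ
  | .inl _, .inr i, .inr j => fun u => -(1 / 2) * dirDeriv d₀ (fun w => G w i j) u
  | .inr k, .inl _, .inr j => weingarten d₀ G k j
  | .inr k, .inr i, .inl _ => weingarten d₀ G k i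
  | .inr k, .inr i, .inr j => christoffelOf d G k i j
  | .inr _, .inl _, .inl _ => fun _ => 0
  | .inl _, .inl _, _ => fun _ => 0
  | .inl _, .inr _, .inl _ => fun _ => 0

lemma weingarten_trace (d₀ : W) (G : W → Matrix ι ι ℝ) (u : W) : ∑ k, weingarten d₀ G k k u
      = (1 / 2) * ∑ k, ∑ l, (G u)⁻¹ k l * dirDeriv d₀ (fun w => G w k l) u := by
  simp [weingarten, Finset.mul_sum]

namespace IsMetricOn

variable {U : Set W} {G : W → Matrix ι ι ℝ} {u : W} (hG : IsMetricOn G U)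
include hG

lemma cylGram_inv (hu : u ∈ U) : (cylGram G u)⁻¹ = Matrix.fromBlocks 1 0 0 (G u)⁻¹ := by
  apply Matrix.inv_eq_right_inv
  simp [cylGram, Matrix.fromBlocks_multiply, Matrix.mul_nonsing_inv _ (hG.isUnit_det u hu)]

lemma contDiffOn_weingarten (d₀ : W) (k i : ι) : ContDiffOn ℝ ∞ (weingarten d₀ G k i) U :=
  contDiffOn_const.mul (ContDiffOn.sum fun l _ => (hG.inv_smooth k l).mul
    (contDiffOn_dirDeriv hG.isOpen (hG.smooth i l) d₀))

/-- The blocks `1` and `0` are constant, so an index `0` can only survive in the derivative `∂₀G`.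
-/
lemma christoffelOf_cylGram (hu : u ∈ U) (d₀ : W) (d : ι → W) (k i j : Unit ⊕ ι) :
    christoffelOf (cylDir d₀ d) (cylGram G) k i j u = cylChristoffel d₀ d G k i j u := by
  unfold christoffelOf
  rw [hG.cylGram_inv hu]
  rcases k with ⟨⟩ | k <;> rcases i with ⟨⟩ | i <;> rcases j with ⟨⟩ | j <;>
    simp [cylGram, cylChristoffel, weingarten, christoffelOf, Fintype.sum_sum_type]

/-- The explicit Christoffel symbols may be substituted under the derivatives because they agree
with the true ones on the whole open set, not only at `u`. -/
lemma ricciOf_cylGram (hu : u ∈ U) (d₀ : W) (d : ι → W) (i j : Unit ⊕ ι) :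
    ricciOf (cylDir d₀ d) (cylGram G) i j u
      = ∑ k, (dirDeriv (cylDir d₀ d k) (cylChristoffel d₀ d G k i j) u
          - dirDeriv (cylDir d₀ d j) (cylChristoffel d₀ d G k i k) u)
        + ∑ k, ∑ l, (cylChristoffel d₀ d G k k l u * cylChristoffel d₀ d G l i j u
          - cylChristoffel d₀ d G k j l u * cylChristoffel d₀ d G l i k u) := by
  unfold ricciOf
  have h := fun k i j v => dirDeriv_congr hG.isOpen hu
    (fun w hw => hG.christoffelOf_cylGram hw d₀ d k i j) v
  simp only [h, hG.christoffelOf_cylGram hu]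

lemma dirDeriv_dirDeriv_symm (hu : u ∈ U) (v w : W) (i j : ι) :
    dirDeriv v (dirDeriv w (fun w => G w i j)) u = dirDeriv v (dirDeriv w (fun w => G w j i)) u :=
  dirDeriv_congr hG.isOpen hu (fun _ hz => hG.dirDeriv_symm hz w i j) v

/-- Beyond the Ricci tensor of `G` there remain `∂₀Γ⁰ᵢⱼ`, the product of the trace of the Weingarten
map with `Γ⁰ᵢⱼ`, and two products of the Weingarten map with `Γ⁰`. -/
lemma ricciOf_cylGram_inr_inr (hu : u ∈ U) (d₀ : W) (d : ι → W) (i j : ι) :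
    ricciOf (cylDir d₀ d) (cylGram G) (.inr i) (.inr j) u
      = ricciOf d G i j u - 1 / 2 * dirDeriv d₀ (dirDeriv d₀ (fun w => G w i j)) u
        - 1 / 2 * (∑ k, weingarten d₀ G k k u) * dirDeriv d₀ (fun w => G w i j) u
        + 1 / 2 * ∑ k, weingarten d₀ G k i u * dirDeriv d₀ (fun w => G w j k) u
        + 1 / 2 * ∑ k, weingarten d₀ G k j u * dirDeriv d₀ (fun w => G w i k) u := by
  rw [hG.ricciOf_cylGram hu]
  simp only [Fintype.sum_sum_type, cylChristoffel, cylDir_inl, cylDir_inr, dirDeriv_const,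
    Finset.univ_unique, Finset.sum_singleton]
  rw [dirDeriv_const_mul hG.isOpen hu
    (contDiffOn_dirDeriv hG.isOpen (hG.smooth i j) d₀)]
  simp only [ricciOf, Finset.sum_add_distrib, Finset.mul_sum, Finset.sum_mul,
    Finset.sum_sub_distrib]
  have h1 : ∀ k, 1 / 2 * (weingarten d₀ G k i u * dirDeriv d₀ (fun w => G w j k) u)
    = - (-(1 / 2) * dirDeriv d₀ (fun w => G w j k) u * weingarten d₀ G k i u) := fun _ => by ring
  have h2 : ∀ k, 1 / 2 * (weingarten d₀ G k j u * dirDeriv d₀ (fun w => G w i k) u)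
    = - (weingarten d₀ G k j u * (-(1 / 2) * dirDeriv d₀ (fun w => G w i k) u)) := fun _ => by ring
  have h3 : ∀ k, 1 / 2 * weingarten d₀ G k k u * dirDeriv d₀ (fun w => G w i j) u
    = - (weingarten d₀ G k k u * (-(1 / 2) * dirDeriv d₀ (fun w => G w i j) u)) := fun _ => by ring
  simp only [h1, h2, h3, Finset.sum_neg_distrib, zero_mul, mul_zero, Finset.sum_const_zero]
  ring

/-- The traced Riccati equation `Ric₀₀ = -Tr(∂₀W) - Tr(W²)` for the Weingarten map `W`. -/
lemma ricciOf_cylGram_inl_inl (hu : u ∈ U) (d₀ : W) (d : ι → W) :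
    ricciOf (cylDir d₀ d) (cylGram G) (.inl ()) (.inl ()) u
      = - ∑ k, dirDeriv d₀ (weingarten d₀ G k k) u
        - ∑ k, ∑ l, weingarten d₀ G k l u * weingarten d₀ G l k u := by
  rw [hG.ricciOf_cylGram hu]
  simp [Fintype.sum_sum_type, cylChristoffel]
  ring

/-- The Codazzi equation: divergence of the Weingarten map minus the differential of its trace. -/
lemma ricciOf_cylGram_inl_inr (hu : u ∈ U) (d₀ : W) (d : ι → W) (i : ι) :
    ricciOf (cylDir d₀ d) (cylGram G) (.inl ()) (.inr i) u
      = ∑ k, dirDeriv (d k) (weingarten d₀ G k i) u - ∑ k, dirDeriv (d i) (weingarten d₀ G k k) u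
        + ∑ k, ∑ l, (christoffelOf d G k k l u * weingarten d₀ G l i u
          - christoffelOf d G k i l u * weingarten d₀ G l k u) := by
  rw [hG.ricciOf_cylGram hu]
  simp [Fintype.sum_sum_type, cylChristoffel]

/-- The mixed second derivatives of the logarithm of the determinant agree. -/
lemma dirDeriv_trace_comm (hu : u ∈ U) (v w : W) :
    dirDeriv v (fun z => ∑ k, ∑ l, (G z)⁻¹ k l * dirDeriv w (fun w => G w k l) z) u
      = dirDeriv w (fun z => ∑ k, ∑ l, (G z)⁻¹ k l * dirDeriv v (fun w => G w k l) z) u := by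
  have hU := hG.isOpen
  have hs := fun k l w => contDiffOn_dirDeriv hU (hG.smooth k l) w
  have expand : ∀ v w : W,
      dirDeriv v (fun z => ∑ k, ∑ l, (G z)⁻¹ k l * dirDeriv w (fun w => G w k l) z) u
      = ∑ k, ∑ l, (- ∑ a, ∑ b, (G u)⁻¹ k a * dirDeriv v (fun w => G w a b) u * (G u)⁻¹ b l)
            * dirDeriv w (fun w => G w k l) u
        + ∑ k, ∑ l, (G u)⁻¹ k l * dirDeriv v (dirDeriv w (fun w => G w k l)) u := by
    intro v w
    rw [dirDeriv_sum hU hu (fun k _ => ContDiffOn.sum fun l _ => (hG.inv_smooth k l).mul (hs k l w)),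
      ← Finset.sum_add_distrib]
    refine Finset.sum_congr rfl fun k _ => ?_
    rw [dirDeriv_sum hU hu (fun l _ => (hG.inv_smooth k l).mul (hs k l w)),
      ← Finset.sum_add_distrib]
    refine Finset.sum_congr rfl fun l _ => ?_
    rw [dirDeriv_mul hU hu (hG.inv_smooth k l) (hs k l w), hG.dirDeriv_inv hu]
  rw [expand, expand]
  congr 1
  · simp only [neg_mul, Finset.sum_neg_distrib, Finset.sum_mul]
    congr 1
    -- The quadratic term is `Tr(G⁻¹ ∂ᵥG G⁻¹ ∂_wG)`; exchanging the index pairs `(k, l)` and `(a,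
    -- b)` exchanges `v` and `w`.
    have e1 : ∀ f : ι → ι → ι → ι → ℝ,
        ∑ k, ∑ l, ∑ a, ∑ b, f k l a b = ∑ a, ∑ b, ∑ k, ∑ l, f k l a b := by
      intro f
      calc _ = ∑ k, ∑ a, ∑ l, ∑ b, f k l a b :=
            Finset.sum_congr rfl fun k _ => Finset.sum_comm
        _ = ∑ a, ∑ k, ∑ l, ∑ b, f k l a b := Finset.sum_comm
        _ = ∑ a, ∑ k, ∑ b, ∑ l, f k l a b :=
            Finset.sum_congr rfl fun a _ => Finset.sum_congr rfl fun k _ => Finset.sum_comm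
        _ = _ := Finset.sum_congr rfl fun a _ => Finset.sum_comm
    rw [e1]
    refine Finset.sum_congr rfl fun a _ => Finset.sum_congr rfl fun b _ =>
      Finset.sum_congr rfl fun k _ => Finset.sum_congr rfl fun l _ => ?_
    rw [hG.inv_symm hu k a, hG.inv_symm hu b l]
    ring
  · exact Finset.sum_congr rfl fun k _ => Finset.sum_congr rfl fun l _ => by
      rw [dirDeriv_comm hU hu (hG.smooth k l)]

/-- The coordinate formula for the Ricci tensor is not visibly symmetric, because of the term `∂ⱼ
Γᵏᵢₖ`. Here the symmetry reduces to that of the mixed derivatives of `log √|det G|`. -/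
lemma ricciOf_cylGram_inr_inl (hu : u ∈ U) (d₀ : W) (d : ι → W) (i : ι) :
    ricciOf (cylDir d₀ d) (cylGram G) (.inr i) (.inl ()) u
      = ricciOf (cylDir d₀ d) (cylGram G) (.inl ()) (.inr i) u := by
  have hU := hG.isOpen
  rw [hG.ricciOf_cylGram_inl_inr hu, hG.ricciOf_cylGram hu]
  simp only [Fintype.sum_sum_type, cylChristoffel, cylDir_inl, cylDir_inr, dirDeriv_const,
    Finset.univ_unique, Finset.sum_singleton, Finset.sum_sub_distrib]
  have h1 : ∑ k, dirDeriv d₀ (christoffelOf d G k i k) u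
      = ∑ k, dirDeriv (d i) (weingarten d₀ G k k) u := by
    rw [← dirDeriv_sum hU hu (fun k _ => hG.contDiffOn_christoffelOf d k i k),
      ← dirDeriv_sum hU hu (fun k _ => hG.contDiffOn_weingarten d₀ k k),
      dirDeriv_congr hU hu (fun w hw => hG.christoffelOf_trace hw d i),
      dirDeriv_congr hU hu (fun w _ => weingarten_trace d₀ G w)]
    have hs := fun v => ContDiffOn.sum (s := Finset.univ) fun k _ => ContDiffOn.sum
      (s := Finset.univ) fun l _ => (hG.inv_smooth k l).mul (contDiffOn_dirDeriv hU (hG.smooth k l) v)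
    rw [dirDeriv_const_mul hU hu (hs (d i)), dirDeriv_const_mul hU hu (hs d₀),
      hG.dirDeriv_trace_comm hu]
  have h2 : ∑ k, ∑ l, weingarten d₀ G k l u * christoffelOf d G l i k u
      = ∑ k, ∑ l, christoffelOf d G k i l u * weingarten d₀ G l k u := by
    rw [Finset.sum_comm]
    exact Finset.sum_congr rfl fun k _ => Finset.sum_congr rfl fun l _ => mul_comm _ _
  simp only [zero_mul, mul_zero, zero_add, Finset.sum_const_zero, h1, h2]

end IsMetricOn

end CylindricalMetric

/-! ### Codifferentials of tensors of low degree in components. -/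

section Components

variable {W : Type*} [NormedAddCommGroup W] [NormedSpace ℝ W]
  {κ : Type*} [Fintype κ] [DecidableEq κ]

lemma update_vec_one {α : Type*} (a b : α) : Function.update ![a] 0 b = ![b] := by
  ext s; fin_cases s; rfl

lemma update_vec_two {α : Type*} (a b c : α) :
    Function.update ![a, b] 0 c = ![c, b] ∧ Function.update ![a, b] 1 c = ![a, c] := by
  constructor <;> · ext s; fin_cases s <;> rfl

lemma update_vec_three {α : Type*} (a b c x : α) :
    Function.update ![a, b, c] 0 x = ![x, b, c] ∧ Function.update ![a, b, c] 1 x = ![a, x, c] ∧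
      Function.update ![a, b, c] 2 x = ![a, b, x] := by
  refine ⟨?_, ?_, ?_⟩ <;> · ext s; fin_cases s <;> rfl

lemma codiffOf_one (d : κ → W) (G : W → Matrix κ κ ℝ) (T : W → (Fin 1 → κ) → ℝ) (u : W) :
    codiffOf d G T ![] u = - ∑ l, ∑ m, (G u)⁻¹ l m * (dirDeriv (d l) (fun w => T w ![m]) u
      - ∑ r, christoffelOf d G r l m u * T u ![r]) := by
  simp [codiffOf, update_vec_one]

lemma codiffOf_two (d : κ → W) (G : W → Matrix κ κ ℝ) (T : W → (Fin 2 → κ) → ℝ) (i : κ) (u : W) :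
    codiffOf d G T ![i] u = - ∑ l, ∑ m, (G u)⁻¹ l m * (dirDeriv (d l) (fun w => T w ![m, i]) u
      - ∑ r, christoffelOf d G r l m u * T u ![r, i]
      - ∑ r, christoffelOf d G r l i u * T u ![m, r]) := by
  simp [codiffOf, update_vec_two, Fin.sum_univ_two, sub_sub]

lemma codiffOf_three (d : κ → W) (G : W → Matrix κ κ ℝ) (T : W → (Fin 3 → κ) → ℝ) (i j : κ)
    (u : W) :
    codiffOf d G T ![i, j] u
      = - ∑ l, ∑ m, (G u)⁻¹ l m * (dirDeriv (d l) (fun w => T w ![m, i, j]) u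
        - ∑ r, christoffelOf d G r l m u * T u ![r, i, j]
        - ∑ r, christoffelOf d G r l i u * T u ![m, r, j]
        - ∑ r, christoffelOf d G r l j u * T u ![m, i, r]) := by
  simp [codiffOf, update_vec_three, Fin.sum_univ_three, sub_sub, add_assoc]

/-- Antisymmetry of the codifferential in its free slots reduces the Maxwell equation to the
time-space and space-space components. -/
lemma codiffOf_three_swap {d : κ → W} {G : W → Matrix κ κ ℝ} {T : W → (Fin 3 → κ) → ℝ} {u : W}
    (hT : ∀ w i j k, T w ![i, j, k] = - T w ![i, k, j]) (i j : κ) :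
    codiffOf d G T ![i, j] u = - codiffOf d G T ![j, i] u := by
  rw [codiffOf_three, codiffOf_three, neg_inj, ← Finset.sum_neg_distrib]
  refine Finset.sum_congr rfl fun l _ => ?_
  rw [← Finset.sum_neg_distrib]
  refine Finset.sum_congr rfl fun m _ => ?_
  have h1 : dirDeriv (d l) (fun w => T w ![m, i, j]) u
      = - dirDeriv (d l) (fun w => T w ![m, j, i]) u := by
    rw [← dirDeriv_neg]; congr 1; ext w; exact hT w m i j
  have h2 : ∀ r, T u ![r, i, j] = - T u ![r, j, i] := fun r => hT u r i j
  have h3 : ∀ r, T u ![m, r, j] = - T u ![m, j, r] := fun r => hT u m r j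
  have h4 : ∀ r, T u ![m, i, r] = - T u ![m, r, i] := fun r => hT u m i r
  simp only [h1, h2, h3, h4, mul_neg, Finset.sum_neg_distrib]
  ring

end Components

/-! ### Three-forms `dτ ∧ ψ + F` and their codifferentials. -/

section SplitForms

variable {W ι : Type*}

/-- `H = dτ ∧ ψ + F`, in components. -/
structure IsSplit (H : W → (Fin 3 → Unit ⊕ ι) → ℝ) (ψ : W → (Fin 2 → ι) → ℝ)
    (F : W → (Fin 3 → ι) → ℝ) : Prop where
  swap₁ : ∀ u i j k, H u ![i, j, k] = - H u ![j, i, k]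
  swap₂ : ∀ u i j k, H u ![i, j, k] = - H u ![i, k, j]
  time : ∀ u i j, ψ u ![i, j] = H u ![.inl (), .inr i, .inr j]
  space : ∀ u i j k, F u ![i, j, k] = H u ![.inr i, .inr j, .inr k]

namespace IsSplit

variable {H : W → (Fin 3 → Unit ⊕ ι) → ℝ} {ψ : W → (Fin 2 → ι) → ℝ}
  {F : W → (Fin 3 → ι) → ℝ} (hH : IsSplit H ψ F)
include hH

lemma inl_inl (u : W) (i : Unit ⊕ ι) : H u ![.inl (), .inl (), i] = 0 := by
  have := hH.swap₁ u (.inl ()) (.inl ()) i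
  linarith

lemma inl_inr_inl (u : W) (i : ι) : H u ![.inl (), .inr i, .inl ()] = 0 := by
  rw [hH.swap₂, hH.inl_inl, neg_zero]

lemma inr_inl_inl (u : W) (i : ι) : H u ![.inr i, .inl (), .inl ()] = 0 := by
  rw [hH.swap₁, hH.inl_inr_inl, neg_zero]

lemma inr_inl_inr (u : W) (i j : ι) : H u ![.inr i, .inl (), .inr j] = - ψ u ![i, j] := by
  rw [hH.swap₁, hH.time]

lemma inr_inr_inl (u : W) (i j : ι) : H u ![.inr i, .inr j, .inl ()] = ψ u ![i, j] := by
  rw [hH.swap₂, hH.inr_inl_inr, neg_neg]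

lemma time_swap (u : W) (i j : ι) : ψ u ![i, j] = - ψ u ![j, i] := by
  rw [hH.time, hH.time, hH.swap₂]

lemma space_swap₁ (u : W) (i j k : ι) : F u ![i, j, k] = - F u ![j, i, k] := by
  rw [hH.space, hH.space, hH.swap₁]

end IsSplit

end SplitForms

section CylindricalCodiff

variable {W : Type*} [NormedAddCommGroup W] [NormedSpace ℝ W]
  {ι : Type*} [Fintype ι] [DecidableEq ι]

namespace IsMetricOn

variable {U : Set W} {G : W → Matrix ι ι ℝ} {u : W} (hG : IsMetricOn G U)
include hG

/-- The index pair `(0, 0)` gives `-∂₀T₀`, and `Γ⁰ₗₘ` traced over space gives the mean curvature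
term. There is no correction from `Γʳ₀₀ = 0`. -/
lemma codiffOf_cylGram_one (hu : u ∈ U) (d₀ : W) (d : ι → W) (T : W → (Fin 1 → Unit ⊕ ι) → ℝ) :
    codiffOf (cylDir d₀ d) (cylGram G) T ![] u
      = - dirDeriv d₀ (fun w => T w ![.inl ()]) u
        - 1 / 2 * T u ![.inl ()] * ∑ k, ∑ l, (G u)⁻¹ k l * dirDeriv d₀ (fun w => G w k l) u
        + codiffOf d G (fun w a => T w (Sum.inr ∘ a)) ![] u := by
  have hv : ∀ r : ι, (Sum.inr ∘ ![r] : Fin 1 → Unit ⊕ ι) = ![.inr r] := by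
    intro r; ext s; fin_cases s; rfl
  rw [codiffOf_one, codiffOf_one]
  simp only [hG.christoffelOf_cylGram hu, hG.cylGram_inv hu, Fintype.sum_sum_type, hv,
    cylChristoffel, cylDir_inl, cylDir_inr, Finset.univ_unique, Finset.sum_singleton]
  simp [mul_sub, mul_add, Finset.sum_add_distrib, Finset.mul_sum, Finset.sum_sub_distrib]
  have : ∀ k l, (G u)⁻¹ k l * (2⁻¹ * dirDeriv d₀ (fun w => G w k l) u * T u ![Sum.inl ()])
    = 2⁻¹ * T u ![Sum.inl ()] * ((G u)⁻¹ k l * dirDeriv d₀ (fun w => G w k l) u) := by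
    intros; ring
  simp only [this]
  ring

/-- No time derivative appears, since a repeated time index kills `H`. The sign comes from moving
the time index of `H` past a space index. -/
lemma codiffOf_cylGram_inl_inr (hu : u ∈ U) (d₀ : W) (d : ι → W)
    {H : W → (Fin 3 → Unit ⊕ ι) → ℝ} {ψ : W → (Fin 2 → ι) → ℝ} {F : W → (Fin 3 → ι) → ℝ}
    (hH : IsSplit H ψ F) (j : ι) :
    codiffOf (cylDir d₀ d) (cylGram G) H ![.inl (), .inr j] u = - codiffOf d G ψ ![j] u := by
  rw [codiffOf_three, codiffOf_two]
  simp only [hG.christoffelOf_cylGram hu, hG.cylGram_inv hu, Fintype.sum_sum_type,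
    cylChristoffel, cylDir_inl, cylDir_inr, Finset.univ_unique, Finset.sum_singleton,
    PUnit.default_eq_unit, hH.inl_inl, hH.inr_inl_inr, hH.inr_inl_inl,
    ← hH.space, dirDeriv_neg, Matrix.fromBlocks_apply₁₁, Matrix.fromBlocks_apply₁₂,
    Matrix.fromBlocks_apply₂₁, Matrix.fromBlocks_apply₂₂, Matrix.zero_apply, zero_mul, mul_zero,
    dirDeriv_const, Finset.sum_const_zero, sub_zero, add_zero, zero_add, mul_neg,
    Finset.sum_neg_distrib, sub_neg_eq_add]
  -- With both indices raised the Weingarten map is symmetric, while `F` is antisymmetric in `m` and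
  -- `r`, so their contraction vanishes. The sum is shown to equal its own negative.
  have hz : ∑ l, ∑ m, ∑ r, (G u)⁻¹ l m * (weingarten d₀ G r l u * F u ![m, r, j]) = 0 := by
    have h1 : ∑ l, ∑ m, ∑ r, (G u)⁻¹ l m * (weingarten d₀ G r l u * F u ![m, r, j])
        = ∑ l, ∑ m, ∑ r, ∑ a, 1 / 2 * (((G u)⁻¹ l m * (G u)⁻¹ r a)
          * dirDeriv d₀ (fun w => G w l a) u * F u ![m, r, j]) := by
      refine Finset.sum_congr rfl fun l _ => Finset.sum_congr rfl fun m _ =>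
        Finset.sum_congr rfl fun r _ => ?_
      rw [weingarten, Finset.mul_sum, Finset.sum_mul, Finset.mul_sum]
      exact Finset.sum_congr rfl fun a _ => by ring
    have h2 : ∑ l, ∑ m, ∑ r, ∑ a, 1 / 2 * (((G u)⁻¹ l m * (G u)⁻¹ r a)
          * dirDeriv d₀ (fun w => G w l a) u * F u ![m, r, j])
        = - ∑ l, ∑ m, ∑ r, ∑ a, 1 / 2 * (((G u)⁻¹ l m * (G u)⁻¹ r a)
          * dirDeriv d₀ (fun w => G w l a) u * F u ![m, r, j]) := by
      -- Reversing the order of the four indices exchanges `l` with `a` and `m` with `r`, which is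
      -- the required relabelling.
      have e1 : ∀ f : ι → ι → ι → ι → ℝ,
          ∑ l, ∑ m, ∑ r, ∑ a, f l m r a = ∑ a, ∑ r, ∑ m, ∑ l, f l m r a := by
        intro f
        calc _ = ∑ l, ∑ m, ∑ a, ∑ r, f l m r a :=
              Finset.sum_congr rfl fun _ _ => Finset.sum_congr rfl fun _ _ => Finset.sum_comm
          _ = ∑ l, ∑ a, ∑ m, ∑ r, f l m r a :=
              Finset.sum_congr rfl fun _ _ => Finset.sum_comm
          _ = ∑ a, ∑ l, ∑ m, ∑ r, f l m r a := Finset.sum_comm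
          _ = ∑ a, ∑ l, ∑ r, ∑ m, f l m r a :=
              Finset.sum_congr rfl fun _ _ => Finset.sum_congr rfl fun _ _ => Finset.sum_comm
          _ = ∑ a, ∑ r, ∑ l, ∑ m, f l m r a :=
              Finset.sum_congr rfl fun _ _ => Finset.sum_comm
          _ = _ := Finset.sum_congr rfl fun _ _ => Finset.sum_congr rfl fun _ _ => Finset.sum_comm
      conv_lhs => rw [e1]
      simp only [← Finset.sum_neg_distrib]
      refine Finset.sum_congr rfl fun l _ => Finset.sum_congr rfl fun m _ =>
        Finset.sum_congr rfl fun r _ => Finset.sum_congr rfl fun a _ => ?_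
      rw [hG.dirDeriv_symm hu d₀ a l, hH.space_swap₁ u r m j, hG.inv_symm hu a r,
        hG.inv_symm hu m l]
      ring
    linarith
  simp only [mul_sub, mul_add, mul_neg, Finset.sum_add_distrib, Finset.sum_sub_distrib,
    Finset.sum_neg_distrib, Finset.mul_sum] at hz ⊢
  rw [hz]
  simp only [mul_zero, Finset.sum_const_zero]
  ring

/-- Each `∂₀G` contraction with `ψ` arises in two equal halves: one from `Γʳ₀ᵢ` in the time
derivative of `H₀ᵢⱼ`, the other from `Γ⁰ₗᵢ` in the spatial divergence. Together they form `∂_τ h Δ₁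
ψ`. -/
lemma codiffOf_cylGram_inr_inr (hu : u ∈ U) (d₀ : W) (d : ι → W)
    {H : W → (Fin 3 → Unit ⊕ ι) → ℝ} {ψ : W → (Fin 2 → ι) → ℝ} {F : W → (Fin 3 → ι) → ℝ}
    (hH : IsSplit H ψ F) (i j : ι) :
    codiffOf (cylDir d₀ d) (cylGram G) H ![.inr i, .inr j] u
      = - dirDeriv d₀ (fun w => ψ w ![i, j]) u + codiffOf d G F ![i, j] u
        + ∑ k, ∑ l, (G u)⁻¹ k l * (dirDeriv d₀ (fun w => G w k i) u * ψ u ![l, j]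
          - dirDeriv d₀ (fun w => G w k j) u * ψ u ![l, i])
        - 1 / 2 * (∑ k, ∑ l, (G u)⁻¹ k l * dirDeriv d₀ (fun w => G w k l) u) * ψ u ![i, j] := by
  rw [codiffOf_three, codiffOf_three]
  simp only [hG.christoffelOf_cylGram hu, hG.cylGram_inv hu, Fintype.sum_sum_type,
    cylChristoffel, cylDir_inl, cylDir_inr, Finset.univ_unique, Finset.sum_singleton,
    PUnit.default_eq_unit, hH.inl_inl, hH.inr_inl_inr, hH.inr_inr_inl, hH.inl_inr_inl,
    ← hH.time, ← hH.space, Matrix.fromBlocks_apply₁₁, Matrix.fromBlocks_apply₁₂,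
    Matrix.fromBlocks_apply₂₁, Matrix.fromBlocks_apply₂₂, Matrix.zero_apply, zero_mul, mul_zero,
    Finset.sum_const_zero, sub_zero, add_zero, zero_add, Matrix.one_apply_eq,
    one_mul, neg_mul, mul_neg]
  have hw : ∀ i j, ∑ r, weingarten d₀ G r i u * ψ u ![r, j]
      = 1 / 2 * ∑ k, ∑ l, (G u)⁻¹ k l * (dirDeriv d₀ (fun w => G w k i) u * ψ u ![l, j]) := by
    intro i j
    rw [Finset.sum_comm]
    simp only [weingarten, Finset.mul_sum, Finset.sum_mul]
    refine Finset.sum_congr rfl fun r _ => Finset.sum_congr rfl fun a _ => ?_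
    rw [hG.inv_symm hu r a, hG.dirDeriv_symm hu d₀ i a]
    ring
  have hw' : ∑ r, weingarten d₀ G r j u * ψ u ![i, r]
      = - (1 / 2 * ∑ k, ∑ l, (G u)⁻¹ k l * (dirDeriv d₀ (fun w => G w k j) u * ψ u ![l, i])) := by
    rw [← hw, ← Finset.sum_neg_distrib]
    exact Finset.sum_congr rfl fun r _ => by rw [hH.time_swap u i r]; ring
  have hq : ∀ k l, dirDeriv d₀ (fun w => G w k j) u * ψ u ![l, i] = 
      - (dirDeriv d₀ (fun w => G w k j) u * ψ u ![i, l]) := by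
    intro k l
    rw [hH.time_swap u l i]; ring
  rw [hw, hw']
  simp only [mul_sub, mul_add, mul_neg, Finset.sum_add_distrib, Finset.sum_sub_distrib,
    Finset.sum_neg_distrib, Finset.mul_sum, Finset.sum_mul]
  have r1 : ∀ k l, (G u)⁻¹ k l * (1 / 2 * dirDeriv d₀ (fun w => G w k l) u * ψ u ![i, j])
      = 1 / 2 * ((G u)⁻¹ k l * dirDeriv d₀ (fun w => G w k l) u) * ψ u ![i, j] := by
    intros; ring
  have r2 : ∀ k l, (G u)⁻¹ k l * (1 / 2 * dirDeriv d₀ (fun w => G w k i) u * ψ u ![l, j])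
      = 1 / 2 * ((G u)⁻¹ k l * (dirDeriv d₀ (fun w => G w k i) u * ψ u ![l, j])) := by
    intros; ring
  have r3 : ∀ k l, (G u)⁻¹ k l * (1 / 2 * dirDeriv d₀ (fun w => G w k j) u * ψ u ![l, i])
      = 1 / 2 * ((G u)⁻¹ k l * (dirDeriv d₀ (fun w => G w k j) u * ψ u ![l, i])) := by
    intros; ring
  simp only [r1, r2, r3, ← Finset.mul_sum, ← Finset.sum_mul]
  ring

end IsMetricOn

end CylindricalCodiff

/-! ### Contractions of tensors and their splitting on the cylinder. -/

section Contractions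

variable {κ : Type*} [Fintype κ]

/-- The full contraction of two tensors, given by their components, with the matrix `A`. -/
def tensorInnerOf (A : Matrix κ κ ℝ) {k : ℕ} (S T : (Fin k → κ) → ℝ) : ℝ :=
  ∑ a : Fin k → κ, ∑ b : Fin k → κ, (∏ s, A (a s) (b s)) * S a * T b

lemma sum_fin_succ_pi {k : ℕ} (f : (Fin (k + 1) → κ) → ℝ) :
    ∑ a, f a = ∑ i, ∑ a : Fin k → κ, f (Matrix.vecCons i a) := by
  rw [← (Fin.consEquiv fun _ : Fin (k + 1) => κ).sum_comp, Fintype.sum_prod_type]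
  rfl

/-- Peeling off one slot turns the sum over multi-indices into iterated sums, on which the split
into time and space can be made one index at a time. -/
lemma tensorInnerOf_succ (A : Matrix κ κ ℝ) {k : ℕ} (S T : (Fin (k + 1) → κ) → ℝ) :
    tensorInnerOf A S T = ∑ i, ∑ j, A i j *
      tensorInnerOf A (fun a => S (Matrix.vecCons i a)) (fun a => T (Matrix.vecCons j a)) := by
  unfold tensorInnerOf
  rw [sum_fin_succ_pi]
  refine Finset.sum_congr rfl fun i _ => ?_
  simp only [sum_fin_succ_pi (κ := κ), Finset.mul_sum]
  rw [Finset.sum_comm]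
  refine Finset.sum_congr rfl fun j _ => Finset.sum_congr rfl fun a _ =>
    Finset.sum_congr rfl fun b _ => ?_
  simp [Fin.prod_univ_succ, mul_assoc]

lemma tensorInnerOf_zero (A : Matrix κ κ ℝ) (S T : (Fin 0 → κ) → ℝ) :
    tensorInnerOf A S T = S ![] * T ![] := by
  simp [tensorInnerOf, Matrix.empty_eq]

lemma tensorInnerOf_one (A : Matrix κ κ ℝ) (S T : (Fin 1 → κ) → ℝ) :
    tensorInnerOf A S T = ∑ i, ∑ j, A i j * (S ![i] * T ![j]) := by
  simp [tensorInnerOf_succ, tensorInnerOf_zero]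

lemma tensorInnerOf_two (A : Matrix κ κ ℝ) (S T : (Fin 2 → κ) → ℝ) :
    tensorInnerOf A S T = ∑ i, ∑ j, A i j * ∑ k, ∑ l, A k l * (S ![i, k] * T ![j, l]) := by
  rw [tensorInnerOf_succ]
  simp only [tensorInnerOf_one]

end Contractions

section SplitContractions

variable {W ι : Type*} [Fintype ι] {H : W → (Fin 3 → Unit ⊕ ι) → ℝ}
  {ψ : W → (Fin 2 → ι) → ℝ} {F : W → (Fin 3 → ι) → ℝ} (hH : IsSplit H ψ F)
include hH

namespace IsSplit

lemma tensorInnerOf_inl_inl (A : Matrix ι ι ℝ) (u : W) :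
    tensorInnerOf (Matrix.fromBlocks 1 0 0 A) (fun a => H u (Matrix.vecCons (.inl ()) a))
      (fun a => H u (Matrix.vecCons (.inl ()) a)) = tensorInnerOf A (ψ u) (ψ u) := by
  simp [tensorInnerOf_two, Fintype.sum_sum_type, hH.inl_inl, hH.inl_inr_inl, ← hH.time]

lemma tensorInnerOf_inl_inr (A : Matrix ι ι ℝ) (u : W) (i : ι) :
    tensorInnerOf (Matrix.fromBlocks 1 0 0 A) (fun a => H u (Matrix.vecCons (.inl ()) a))
      (fun a => H u (Matrix.vecCons (.inr i) a))
      = tensorInnerOf A (ψ u) (fun a => F u (Matrix.vecCons i a)) := by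
  simp [tensorInnerOf_two, Fintype.sum_sum_type, hH.inl_inl, hH.inl_inr_inl, ← hH.time,
    ← hH.space]

/-- The time index may sit in either of the two remaining slots; the factor `2` is absorbed by the
`2!` of the determinant product. -/
lemma tensorInnerOf_inr_inr (A : Matrix ι ι ℝ) (u : W) (i j : ι) :
    tensorInnerOf (Matrix.fromBlocks 1 0 0 A) (fun a => H u (Matrix.vecCons (.inr i) a))
      (fun a => H u (Matrix.vecCons (.inr j) a))
      = 2 * tensorInnerOf A (fun a => ψ u (Matrix.vecCons i a)) (fun a => ψ u (Matrix.vecCons j a))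
        + tensorInnerOf A (fun a => F u (Matrix.vecCons i a))
          (fun a => F u (Matrix.vecCons j a)) := by
  simp [tensorInnerOf_two, tensorInnerOf_one, Fintype.sum_sum_type, hH.inr_inl_inl,
    hH.inr_inl_inr, hH.inr_inr_inl, ← hH.space, Finset.sum_add_distrib, mul_add]
  ring

/-- The factor `3` counts the slots that can carry the time index. Division by `3!` turns it into
the `1 / 2!` of the determinant norm of `ψ`. -/
lemma tensorInnerOf_self (A : Matrix ι ι ℝ) (u : W) :
    tensorInnerOf (Matrix.fromBlocks 1 0 0 A) (H u) (H u)
      = 3 * tensorInnerOf A (ψ u) (ψ u) + tensorInnerOf A (F u) (F u) := by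
  rw [tensorInnerOf_succ, tensorInnerOf_succ A (F u), tensorInnerOf_succ A (ψ u)]
  simp only [Fintype.sum_sum_type, Finset.univ_unique, Finset.sum_singleton,
    PUnit.default_eq_unit, hH.tensorInnerOf_inl_inl, hH.tensorInnerOf_inr_inr,
    Matrix.fromBlocks_apply₁₁, Matrix.fromBlocks_apply₁₂, Matrix.fromBlocks_apply₂₁,
    Matrix.fromBlocks_apply₂₂, Matrix.zero_apply, zero_mul, Finset.sum_const_zero, add_zero,
    zero_add, Matrix.one_apply_eq, one_mul, mul_add, Finset.sum_add_distrib]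
  rw [tensorInnerOf_succ A (ψ u)]
  simp only [Finset.mul_sum, ← Finset.sum_add_distrib]
  refine Finset.sum_congr rfl fun i _ => Finset.sum_congr rfl fun j _ => ?_
  ring

end IsSplit

end SplitContractions

/-! ### The Ricci tensor of `dτ² + G` in terms of time derivatives of `G`. -/

section CylindricalRicci

variable {W : Type*} [NormedAddCommGroup W] [NormedSpace ℝ W]
  {ι : Type*} [Fintype ι] [DecidableEq ι]

namespace IsMetricOn

variable {U : Set W} {G : W → Matrix ι ι ℝ} {u : W} (hG : IsMetricOn G U)
include hG

/-- The two quadratic Weingarten terms are equal, each being a quarter of `∂₀G ∘ ∂₀G`. -/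
lemma ricciOf_cylGram_space (hu : u ∈ U) (d₀ : W) (d : ι → W) (i j : ι) :
    ricciOf (cylDir d₀ d) (cylGram G) (.inr i) (.inr j) u
      = ricciOf d G i j u - 1 / 2 * dirDeriv d₀ (dirDeriv d₀ (fun w => G w i j)) u
        - 1 / 4 * (∑ k, ∑ l, (G u)⁻¹ k l * dirDeriv d₀ (fun w => G w k l) u)
          * dirDeriv d₀ (fun w => G w i j) u
        + 1 / 2 * ∑ k, ∑ l, (G u)⁻¹ k l
          * (dirDeriv d₀ (fun w => G w i k) u * dirDeriv d₀ (fun w => G w j l) u) := by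
  have h1 : ∑ k, weingarten d₀ G k i u * dirDeriv d₀ (fun w => G w j k) u
      = 1 / 2 * ∑ k, ∑ l, (G u)⁻¹ k l
          * (dirDeriv d₀ (fun w => G w i k) u * dirDeriv d₀ (fun w => G w j l) u) := by
    rw [Finset.sum_comm]
    simp only [weingarten, Finset.mul_sum, Finset.sum_mul]
    refine Finset.sum_congr rfl fun k _ => Finset.sum_congr rfl fun l _ => ?_
    rw [hG.inv_symm hu]
    ring
  have h2 : ∑ k, weingarten d₀ G k j u * dirDeriv d₀ (fun w => G w i k) u
      = 1 / 2 * ∑ k, ∑ l, (G u)⁻¹ k l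
          * (dirDeriv d₀ (fun w => G w i k) u * dirDeriv d₀ (fun w => G w j l) u) := by
    simp only [weingarten, Finset.mul_sum, Finset.sum_mul]
    refine Finset.sum_congr rfl fun k _ => Finset.sum_congr rfl fun l _ => ?_
    ring
  rw [hG.ricciOf_cylGram_inr_inr hu, h1, h2, weingarten_trace]
  ring

lemma dirDeriv_weingarten (hu : u ∈ U) (v d₀ : W) (k i : ι) :
    dirDeriv v (weingarten d₀ G k i) u
      = 1 / 2 * ∑ l, (dirDeriv v (fun w => (G w)⁻¹ k l) u * dirDeriv d₀ (fun w => G w i l) u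
        + (G u)⁻¹ k l * dirDeriv v (dirDeriv d₀ (fun w => G w i l)) u) := by
  have hU := hG.isOpen
  have hs := fun l => contDiffOn_dirDeriv hU (hG.smooth i l) d₀
  have hm := fun l => (hG.inv_smooth k l).mul (hs l)
  have : weingarten d₀ G k i
      = fun u => (1 / 2) * ∑ l, (G u)⁻¹ k l * dirDeriv d₀ (fun w => G w i l) u := rfl
  rw [this, dirDeriv_const_mul hU hu (ContDiffOn.sum fun l _ => hm l),
    dirDeriv_sum hU hu (fun l _ => hm l)]
  congr 1
  exact Finset.sum_congr rfl fun l _ => dirDeriv_mul hU hu (hG.inv_smooth k l) (hs l) v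

/-- Differentiating `G⁻¹` in `-Tr(∂₀W)` contributes `½ |∂₀G|²`, and `-Tr(W²)` contributes `-¼
|∂₀G|²`; hence the coefficient `¼`. -/
lemma ricciOf_cylGram_time (hu : u ∈ U) (d₀ : W) (d : ι → W) :
    ricciOf (cylDir d₀ d) (cylGram G) (.inl ()) (.inl ()) u
      = 1 / 4 * tensorInnerOf (G u)⁻¹ (fun a : Fin 2 → ι => dirDeriv d₀ (fun w => G w (a 0) (a 1)) u)
          (fun a => dirDeriv d₀ (fun w => G w (a 0) (a 1)) u)
        - 1 / 2 * ∑ k, ∑ l, (G u)⁻¹ k l * dirDeriv d₀ (dirDeriv d₀ (fun w => G w k l)) u := by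
  rw [hG.ricciOf_cylGram_inl_inl hu, tensorInnerOf_two]
  have h1 : ∑ k, ∑ l, weingarten d₀ G k l u * weingarten d₀ G l k u
      = 1 / 4 * ∑ i, ∑ j, (G u)⁻¹ i j * ∑ k, ∑ l, (G u)⁻¹ k l
        * (dirDeriv d₀ (fun w => G w i k) u * dirDeriv d₀ (fun w => G w j l) u) := by
    simp only [weingarten, Finset.mul_sum, Finset.sum_mul]
    refine Finset.sum_congr rfl fun i _ => ?_
    have e : ∀ f : ι → ι → ι → ℝ, ∑ a, ∑ b, ∑ c, f a b c = ∑ c, ∑ b, ∑ a, f a b c := by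
      intro f
      calc _ = ∑ b, ∑ a, ∑ c, f a b c := Finset.sum_comm
        _ = ∑ b, ∑ c, ∑ a, f a b c := Finset.sum_congr rfl fun _ _ => Finset.sum_comm
        _ = _ := Finset.sum_comm
    rw [e]
    refine Finset.sum_congr rfl fun j _ => ?_
    refine Finset.sum_congr rfl fun k _ => Finset.sum_congr rfl fun l _ => ?_
    rw [hG.inv_symm hu l k, hG.dirDeriv_symm hu d₀ l j]
    ring
  have h2 : ∑ k, dirDeriv d₀ (weingarten d₀ G k k) u
      = 1 / 2 * ∑ k, ∑ l, (G u)⁻¹ k l * dirDeriv d₀ (dirDeriv d₀ (fun w => G w k l)) u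
        - 1 / 2 * ∑ i, ∑ j, (G u)⁻¹ i j * ∑ k, ∑ l, (G u)⁻¹ k l
        * (dirDeriv d₀ (fun w => G w i k) u * dirDeriv d₀ (fun w => G w j l) u) := by
    simp only [hG.dirDeriv_weingarten hu, hG.dirDeriv_inv hu, ← Finset.mul_sum]
    rw [← mul_sub]
    congr 1
    rw [sub_eq_add_neg, add_comm]
    simp only [Finset.sum_add_distrib]
    congr 1
    simp only [neg_mul, Finset.sum_neg_distrib, Finset.sum_mul, Finset.mul_sum]
    congr 1
    refine Finset.sum_congr rfl fun i _ => ?_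
    rw [Finset.sum_comm]
    refine Finset.sum_congr rfl fun a _ => ?_
    refine Finset.sum_congr rfl fun l _ => Finset.sum_congr rfl fun b _ => ?_
    rw [hG.inv_symm hu b l]
    ring
  rw [h1, h2]
  simp only [Matrix.cons_val_zero, Matrix.cons_val_one]
  ring

/-- Since `∇g⁻¹ = 0`, the divergence of the Weingarten map is half that of `∂₀G`: the derivative of
`G⁻¹` supplies Christoffel corrections. -/
lemma ricciOf_cylGram_mixed (hu : u ∈ U) (d₀ : W) (d : ι → W) (i : ι) :
    ricciOf (cylDir d₀ d) (cylGram G) (.inl ()) (.inr i) u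
      = - (1 / 2) * codiffOf d G (fun z (a : Fin 2 → ι) => dirDeriv d₀ (fun w => G w (a 0) (a 1)) z) ![i] u
        - 1 / 2 * dirDeriv (d i)
          (fun z => ∑ k, ∑ l, (G z)⁻¹ k l * dirDeriv d₀ (fun w => G w k l) z) u := by
  have hU := hG.isOpen
  have hs := fun k l v => contDiffOn_dirDeriv hU (hG.smooth k l) v
  rw [hG.ricciOf_cylGram_inl_inr hu, codiffOf_two]
  have h1 : ∑ k, dirDeriv (d i) (weingarten d₀ G k k) u = 1 / 2 * dirDeriv (d i)
          (fun z => ∑ k, ∑ l, (G z)⁻¹ k l * dirDeriv d₀ (fun w => G w k l) z) u := by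
    rw [← dirDeriv_const_mul hU hu (ContDiffOn.sum fun k _ => ContDiffOn.sum fun l _ =>
      (hG.inv_smooth k l).mul (hs k l d₀)),
      ← dirDeriv_sum hU hu (fun k _ => hG.contDiffOn_weingarten d₀ k k)]
    exact dirDeriv_congr hU hu (fun w _ => weingarten_trace d₀ G w) _
  rw [h1]
  simp only [hG.dirDeriv_weingarten hu, hG.dirDeriv_inv_eq_christoffelOf hu, Matrix.cons_val_zero,
    Matrix.cons_val_one]
  have h2 : ∀ k m, (dirDeriv (d k) (dirDeriv d₀ fun w => G w i m)) u
      = (dirDeriv (d k) (dirDeriv d₀ fun w => G w m i)) u := fun k m =>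
    hG.dirDeriv_dirDeriv_symm hu _ _ _ _
  have h3 : ∀ m, dirDeriv d₀ (fun w => G w i m) u = dirDeriv d₀ (fun w => G w m i) u := fun m =>
    hG.dirDeriv_symm hu _ _ _
  -- Of the two Christoffel terms in the derivative of `G⁻¹`, one cancels `t1`. The other is `t3`,
  -- the correction of the contracted slot in the divergence, while `t2` is the correction of the
  -- free slot.
  have t1 : ∑ k, ∑ l, christoffelOf d G k k l u * weingarten d₀ G l i u
      = 1 / 2 * ∑ k, ∑ l, ∑ r, christoffelOf d G k k r u * (G u)⁻¹ r l
        * dirDeriv d₀ (fun w => G w l i) u := by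
    simp only [weingarten, Finset.mul_sum]
    refine Finset.sum_congr rfl fun k _ => ?_
    rw [Finset.sum_comm]
    refine Finset.sum_congr rfl fun l _ => Finset.sum_congr rfl fun r _ => ?_
    rw [h3]; ring
  have t2 : ∑ k, ∑ l, christoffelOf d G k i l u * weingarten d₀ G l k u
      = 1 / 2 * ∑ l, ∑ m, ∑ r, (G u)⁻¹ l m * (christoffelOf d G r l i u
        * dirDeriv d₀ (fun w => G w m r) u) := by
    simp only [weingarten, Finset.mul_sum]
    rw [Finset.sum_comm]
    refine Finset.sum_congr rfl fun l _ => ?_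
    rw [Finset.sum_comm]
    refine Finset.sum_congr rfl fun m _ => Finset.sum_congr rfl fun r _ => ?_
    rw [hG.dirDeriv_symm hu d₀ r m, hG.christoffelOf_symm hu d r i l]; ring
  have t3 : ∑ k, ∑ l, ∑ r, christoffelOf d G l k r u * (G u)⁻¹ k r
        * dirDeriv d₀ (fun w => G w l i) u
      = ∑ l, ∑ m, ∑ r, (G u)⁻¹ l m * (christoffelOf d G r l m u
        * dirDeriv d₀ (fun w => G w r i) u) := by
    refine Finset.sum_congr rfl fun k _ => ?_
    rw [Finset.sum_comm]
    refine Finset.sum_congr rfl fun m _ => Finset.sum_congr rfl fun r _ => ?_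
    ring
  simp only [Finset.sum_sub_distrib, t1, t2]
  simp only [h2, h3, mul_sub, mul_add, neg_mul, add_mul, Finset.sum_mul, Finset.sum_add_distrib,
    Finset.sum_sub_distrib, Finset.mul_sum, Finset.sum_neg_distrib, neg_add, neg_sub, mul_neg]
    at t3 ⊢
  simp only [← Finset.mul_sum] at t3 ⊢
  rw [t3]
  ring

end IsMetricOn

end CylindricalRicci

/-! ### Preferred charts and components in them. -/

section ChartDerivatives

variable {E : Type*} [NormedAddCommGroup E] [NormedSpace ℝ E]
  {H : Type*} [TopologicalSpace H] (I : ModelWithCorners ℝ E H) [I.Boundaryless]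
  {M : Type*} [TopologicalSpace M] [ChartedSpace H M]

omit [I.Boundaryless] in
/-- The differential of the inverse of the preferred chart at `x`. The tangent spaces of `M` are
identified with the model space. -/
def chartDeriv (x : M) (u : E) : E →L[ℝ] E :=
  (mfderiv 𝓘(ℝ, E) I (extChartAt I x).symm u : _)

variable [IsManifold I ∞ M]

omit [I.Boundaryless] in
lemma isManifold_one : IsManifold I 1 M := IsManifold.of_le (n := ∞) (by
  exact WithTop.coe_le_coe.2 le_top)

/-- The tangent space at `x` is identified with the model space by the preferred chart at `x`
itself, so at the centre of that chart coordinate components are values on the basis. -/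
lemma chartDeriv_self (x : M) : chartDeriv I x (extChartAt I x x) = ContinuousLinearMap.id ℝ E := by
  have := isManifold_one I (M := M)
  have h := mfderivWithin_range_extChartAt_symm (I := I) (x := x)
  rw [I.range_eq_univ, mfderivWithin_univ] at h
  exact h

lemma chartDeriv_bijective (x : M) {u : E} (hu : u ∈ (extChartAt I x).target) :
    Function.Bijective (chartDeriv I x u) := by
  have := isManifold_one I (M := M)
  have h := isInvertible_mfderivWithin_extChartAt_symm (I := I) hu
  rw [I.range_eq_univ, mfderivWithin_univ] at h
  obtain ⟨f, hf⟩ := h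
  have : ⇑(chartDeriv I x u) = f := congrArg DFunLike.coe hf.symm
  rw [this]
  exact f.bijective

lemma mdifferentiableAt_extChartAt_symm (x : M) {u : E} (hu : u ∈ (extChartAt I x).target) :
    MDifferentiableAt 𝓘(ℝ, E) I (extChartAt I x).symm u := by
  have := isManifold_one I (M := M)
  have h := mdifferentiableWithinAt_extChartAt_symm (I := I) hu
  rwa [I.range_eq_univ, mdifferentiableWithinAt_univ] at h

end ChartDerivatives

section ChartComponents

variable {E : Type*} [NormedAddCommGroup E] [NormedSpace ℝ E]
  {H : Type*} [TopologicalSpace H] {I : ModelWithCorners ℝ E H} [I.Boundaryless]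
  {M : Type*} [TopologicalSpace M] [ChartedSpace H M] [IsManifold I ∞ M]
  {κ : Type*} [Fintype κ] [DecidableEq κ] (e : Module.Basis κ ℝ E)

omit [Fintype κ] [DecidableEq κ] [I.Boundaryless] [IsManifold I ∞ M] in
lemma chartComp_eq {k : ℕ} (T : CovTensor I M k) (x : M) (u : E) (a : Fin k → κ) :
    chartComp e T x u a = T ((extChartAt I x).symm u) (fun s => chartDeriv I x u (e (a s))) := rfl

omit [Fintype κ] [DecidableEq κ] in
lemma chartComp_self {k : ℕ} (T : CovTensor I M k) (x : M) (a : Fin k → κ) :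
    chartComp e T x (extChartAt I x x) a = T x (fun s => (e (a s) : E)) := by
  rw [chartComp_eq, chartDeriv_self]
  -- The base point of the left side equals `x` only propositionally. As every tangent space is the
  -- same model space, the equality can be substituted.
  have h : ∀ z : M, z = x → ∀ v : Fin k → E,
      T z (fun s => (v s : E)) = T x (fun s => (v s : E)) := by
    rintro z rfl v; rfl
  exact h _ (extChartAt_to_inv x) _

omit [I.Boundaryless] [IsManifold I ∞ M] in
lemma ricci_eq_ricciOf (g : CovTensor I M 2) (x : M) (i j : κ) :
    ricci e g x i j = ricciOf e (chartGram e g x) i j (extChartAt I x x) := rfl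

omit [Fintype κ] [DecidableEq κ] in
lemma chartGram_self (g : CovTensor I M 2) (x : M) :
    chartGram e g x (extChartAt I x x) = Matrix.of fun i j : κ => g x ![e i, e j] := by
  ext i j
  refine (chartComp_self e g x ![i, j]).trans ?_
  have : (fun s => e (![i, j] s)) = ![e i, e j] := by ext1 s; fin_cases s <;> rfl
  exact congrArg (g x) this

lemma gramInv_eq (g : CovTensor I M 2) (x : M) :
    gramInv e g x = (chartGram e g x (extChartAt I x x))⁻¹ := by
  rw [chartGram_self]; rfl

lemma codiff_eq_codiffOf (g : CovTensor I M 2) {k : ℕ} (T : CovTensor I M (k + 1)) (x : M)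
    (a : Fin k → κ) :
    codiff e g T x a
      = codiffOf e (chartGram e g x) (fun u => chartComp e T x u) a (extChartAt I x x) := by
  unfold codiff codiffOf covDeriv
  rw [gramInv_eq]
  simp only [chartComp_self]
  rfl

omit [Fintype κ] [DecidableEq κ] in
lemma chartComp_differential {f : M → ℝ} {x : M} {u : E} (hu : u ∈ (extChartAt I x).target)
    (hf : MDifferentiableAt I 𝓘(ℝ, ℝ) f ((extChartAt I x).symm u)) (i : κ) :
    chartComp e (differential I f) x u ![i]
      = dirDeriv (e i) (fun w => f ((extChartAt I x).symm w)) u := by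
  have h := mfderiv_comp u hf (mdifferentiableAt_extChartAt_symm I x hu)
  rw [mfderiv_eq_fderiv] at h
  exact (congrArg (fun L : E →L[ℝ] ℝ => L (e i)) h).symm

end ChartComponents

/-! ### The metric matrix of a smooth Riemannian metric. -/

section SmoothMetric

variable {E : Type*} [NormedAddCommGroup E] [NormedSpace ℝ E]
  {H : Type*} [TopologicalSpace H] {I : ModelWithCorners ℝ E H} [I.Boundaryless]
  {M : Type*} [TopologicalSpace M] [ChartedSpace H M] [IsManifold I ∞ M]
  {κ : Type*} [Fintype κ] [DecidableEq κ] (e : Module.Basis κ ℝ E)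
  (g : Bundle.ContMDiffRiemannianMetric I ∞ E (fun x : M => TangentSpace I x))

omit [Fintype κ] [DecidableEq κ] in
-- Smoothness of the metric is a statement about bundles. It yields smooth products of the local
-- frame of the trivialization at `x`, and this frame is the coordinate frame of the chart.
lemma contDiffOn_chartGram (x : M) (i j : κ) :
    ContDiffOn ℝ ∞ (fun u => chartGram e (metricTensor g) x u i j) (extChartAt I x).target := by
  have := isManifold_one I (M := M)
  set t := trivializationAt E (TangentSpace I) x with ht
  have hsec := fun i => t.contMDiffOn_localFrame_baseSet (I := I) ∞ e i
  have h1 : ContMDiffOn I (I.prod 𝓘(ℝ, ℝ)) ∞ (fun m => Bundle.TotalSpace.mk' ℝ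
      (E := Bundle.Trivial M ℝ) m (g.inner m (t.localFrame e i m) (t.localFrame e j m)))
      t.baseSet :=
    ContMDiffOn.clm_bundle_apply₂ (E₃ := Bundle.Trivial M ℝ) g.contMDiff.contMDiffOn
      (hsec i) (hsec j)
  have h2 : ContMDiffOn I 𝓘(ℝ, ℝ) ∞
      (fun m => g.inner m (t.localFrame e i m) (t.localFrame e j m)) t.baseSet := by
    intro m hm
    have := h1 m hm
    rw [Bundle.contMDiffWithinAt_totalSpace] at this
    exact this.2
  have hbase : ∀ u ∈ (extChartAt I x).target, (extChartAt I x).symm u ∈ t.baseSet := by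
    intro u hu
    have := (extChartAt I x).map_target hu
    rwa [extChartAt_source] at this
  have h3 := (h2.comp (contMDiffOn_extChartAt_symm x) hbase).contDiffOn
  refine h3.congr fun u hu => ?_
  have hsrc := (extChartAt I x).map_target hu
  rw [extChartAt_source] at hsrc
  have hL := TangentBundle.symmL_trivializationAt (I := I) hsrc
  rw [I.range_eq_univ, mfderivWithin_univ, (extChartAt I x).right_inv hu] at hL
  have hframe : ∀ i, t.localFrame e i ((extChartAt I x).symm u) = chartDeriv I x u (e i) := by
    intro i
    rw [Bundle.Trivialization.localFrame_apply_of_mem_baseSet t e (hbase u hu)]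
    refine Eq.trans ?_ (congrArg (fun L => L (e i)) hL)
    rw [Bundle.Trivialization.symmL_apply t (hbase u hu), Bundle.Trivialization.basisAt,
      Module.Basis.map_apply]
    rfl
  change _ = g.inner _ _ _
  rw [hframe, hframe]
  rfl

lemma isMetricOn_chartGram (x : M) :
    IsMetricOn (chartGram e (metricTensor g) x) (extChartAt I x).target where
  isOpen := isOpen_extChartAt_target x
  smooth := contDiffOn_chartGram e g x
  symm u hu i j := g.symm _ _ _
  isUnit_det u hu := by
    rw [isUnit_iff_ne_zero]
    intro h0
    -- A kernel vector of the matrix would be a nonzero tangent vector of length zero, against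
    -- positivity.
    obtain ⟨v, hv, hv0⟩ := Matrix.exists_mulVec_eq_zero_iff.2 h0
    set w : E := ∑ i, v i • e i with hw
    have hw0 : w ≠ 0 := by
      intro h
      exact hv (funext (Fintype.linearIndependent_iff.1 e.linearIndependent v (hw ▸ h)))
    set B : E →L[ℝ] E →L[ℝ] ℝ := g.inner ((extChartAt I x).symm u)
    have hpos : 0 < B (chartDeriv I x u w) (chartDeriv I x u w) := by
      apply g.pos
      intro h
      exact hw0 ((chartDeriv_bijective I x hu).1 (h.trans (map_zero (chartDeriv I x u)).symm))
    have hB : ∀ i j, B (chartDeriv I x u (e i)) (chartDeriv I x u (e j))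
      = chartGram e (metricTensor g) x u i j := fun i j => rfl
    have hexp : B (chartDeriv I x u w) (chartDeriv I x u w)
        = ∑ i, v i * (chartGram e (metricTensor g) x u).mulVec v i := by
      rw [hw]
      simp only [map_sum, map_smul, sum_apply, smul_apply,
        smul_eq_mul, hB, Matrix.mulVec, dotProduct, Finset.mul_sum]
      rw [Finset.sum_comm]
      exact Finset.sum_congr rfl fun i _ => Finset.sum_congr rfl fun j _ => by ring
    rw [hexp, hv0] at hpos
    simp at hpos

end SmoothMetric

open TopologicalSpace

/-! ### The charts of `J` and of `J × S`. -/

section OpensChart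

variable {J : Opens ℝ}

lemma extChartAt_opens_apply (τ s : J) : extChartAt 𝓘(ℝ, ℝ) τ s = (s : ℝ) := by
  simp [mfld_simps]
  rfl

lemma extChartAt_opens_target (τ : J) : (extChartAt 𝓘(ℝ, ℝ) τ).target = J := by
  have h : (extChartAt 𝓘(ℝ, ℝ) τ).source = Set.univ := by
    simp [Opens.chartAt_eq, chartAt_self_eq]
  rw [← PartialEquiv.image_source_eq_target, h]
  ext t
  simp only [Set.image_univ, Set.mem_range, extChartAt_opens_apply]
  exact ⟨fun ⟨s, hs⟩ => hs ▸ s.2, fun ht => ⟨⟨t, ht⟩, rfl⟩⟩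

lemma extChartAt_opens_symm (τ : J) {t : ℝ} (ht : t ∈ J) :
    (extChartAt 𝓘(ℝ, ℝ) τ).symm t = ⟨t, ht⟩ := by
  apply Subtype.ext
  rw [← extChartAt_opens_apply τ, (extChartAt 𝓘(ℝ, ℝ) τ).right_inv]
  rw [extChartAt_opens_target]; exact ht

/-- All preferred charts of `J` are the same inclusion, so every time is the centre of the chart. -/
lemma chartDeriv_opens (τ : J) {t : ℝ} (ht : t ∈ J) :
    chartDeriv 𝓘(ℝ, ℝ) τ t = ContinuousLinearMap.id ℝ ℝ := by
  have h : extChartAt 𝓘(ℝ, ℝ) τ = extChartAt 𝓘(ℝ, ℝ) (⟨t, ht⟩ : J) := rfl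
  have h2 := chartDeriv_self 𝓘(ℝ, ℝ) (⟨t, ht⟩ : J)
  rw [extChartAt_opens_apply] at h2
  rw [← h2]
  rfl

/-- A function on `J` is differentiated through any function on `ℝ` that agrees with it on `J`. -/
lemma timeDeriv_eq_deriv {f : J → ℝ} {F : ℝ → ℝ} {τ : J} (hF : DifferentiableAt ℝ F τ)
    (h : ∀ s : J, f s = F s) : timeDeriv f τ = deriv F τ := by
  have : f = F ∘ extChartAt 𝓘(ℝ, ℝ) τ := by
    ext s; rw [Function.comp_apply, extChartAt_opens_apply, h]
  have hτ : extChartAt 𝓘(ℝ, ℝ) τ τ = (τ : ℝ) := extChartAt_opens_apply τ τ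
  have h1 := mfderiv_comp (I := 𝓘(ℝ, ℝ)) (I' := 𝓘(ℝ, ℝ)) (I'' := 𝓘(ℝ, ℝ)) τ (g := F)
    (by rw [hτ]; exact hF.mdifferentiableAt)
    (mdifferentiableAt_extChartAt (I := 𝓘(ℝ, ℝ)) (mem_chart_source ℝ τ))
  rw [mfderiv_extChartAt_self, mfderiv_eq_fderiv, hτ, ← this] at h1
  unfold timeDeriv
  rw [h1, ← fderiv_apply_one_eq_deriv]
  rfl

end OpensChart

section CylinderChart

variable {J : Opens ℝ}
  {E : Type*} [NormedAddCommGroup E] [NormedSpace ℝ E]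
  {H : Type*} [TopologicalSpace H] {I : ModelWithCorners ℝ E H}
  {S : Type*} [TopologicalSpace S] [ChartedSpace H S]

/-- The coordinate domain of the preferred chart of `J × S`. -/
def cylTarget (J : Opens ℝ) (I : ModelWithCorners ℝ E H) (x : S) : Set (ℝ × E) :=
  (J : Set ℝ) ×ˢ (extChartAt I x).target

lemma extChartAt_cyl_target (τ : J) (x : S) :
    (extChartAt (𝓘(ℝ, ℝ).prod I) (τ, x)).target = cylTarget J I x := by
  rw [extChartAt_prod, PartialEquiv.prod_target, extChartAt_opens_target]
  rfl

lemma extChartAt_cyl_apply (τ : J) (x : S) (s : J) (z : S) :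
    extChartAt (𝓘(ℝ, ℝ).prod I) (τ, x) (s, z) = ((s : ℝ), extChartAt I x z) := by
  rw [extChartAt_prod]
  exact Prod.ext (extChartAt_opens_apply τ s) rfl

lemma extChartAt_cyl_symm (τ : J) (x : S) (t : J) (y : E) :
    (extChartAt (𝓘(ℝ, ℝ).prod I) (τ, x)).symm ((t : ℝ), y) = (t, (extChartAt I x).symm y) := by
  rw [extChartAt_prod]
  exact Prod.ext (extChartAt_opens_symm τ t.2) rfl

lemma dTau_eq (p : J × S) : dTau I p = ((1, 0) : ℝ × E) := by
  unfold dTau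
  rw [mfderiv_prod_left]
  rfl

lemma sliceMap_eq (τ : J) (x : S) : sliceMap I τ x = ContinuousLinearMap.inr ℝ ℝ E := by
  unfold sliceMap
  rw [mfderiv_prod_right]
  rfl

variable [I.Boundaryless] [IsManifold I ∞ S]

lemma chartDeriv_cyl (τ : J) (x : S) (t : J) {y : E} (hy : y ∈ (extChartAt I x).target) :
    chartDeriv (𝓘(ℝ, ℝ).prod I) (τ, x) ((t : ℝ), y)
      = (ContinuousLinearMap.id ℝ ℝ).prodMap (chartDeriv I x y) := by
  have hsymm : ⇑(extChartAt (𝓘(ℝ, ℝ).prod I) (τ, x)).symm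
      = Prod.map (extChartAt 𝓘(ℝ, ℝ) τ).symm (extChartAt I x).symm := by
    rw [extChartAt_prod]; rfl
  have ht : (t : ℝ) ∈ (extChartAt 𝓘(ℝ, ℝ) τ).target := by
    rw [extChartAt_opens_target]; exact t.2
  have h := mfderiv_prodMap (p := ((t : ℝ), y)) (mdifferentiableAt_extChartAt_symm 𝓘(ℝ, ℝ) τ ht)
    (mdifferentiableAt_extChartAt_symm I x hy)
  -- The product of the models of `ℝ` and `E` is replaced by the model of the vector space `ℝ × E`,
  -- in which the components on the cylinder are expressed.
  rw [← hsymm, ← modelWithCornersSelf_prod, chartedSpaceSelf_prod] at h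
  rw [← chartDeriv_opens τ t.2]
  exact h

end CylinderChart

/-! ### Locality of the curvature expressions, and restriction to a slice. -/

section Congruence

variable {W : Type*} [NormedAddCommGroup W] [NormedSpace ℝ W]
  {κ : Type*} [Fintype κ] [DecidableEq κ] {U : Set W} {G G' : W → Matrix κ κ ℝ} {u : W}

lemma christoffelOf_congr (hU : IsOpen U) (hu : u ∈ U) (h : ∀ w ∈ U, G w = G' w) (d : κ → W)
    (k i j : κ) : christoffelOf d G k i j u = christoffelOf d G' k i j u := by
  have h' := fun v i j => dirDeriv_congr (F := fun w => G w i j) (F' := fun w => G' w i j) hU hu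
    (fun w hw => by rw [h w hw]) v
  simp only [christoffelOf, h', h u hu]

lemma ricciOf_congr (hU : IsOpen U) (hu : u ∈ U) (h : ∀ w ∈ U, G w = G' w) (d : κ → W)
    (i j : κ) : ricciOf d G i j u = ricciOf d G' i j u := by
  have h' := fun v k i j => dirDeriv_congr hU hu
    (fun w hw => christoffelOf_congr hU hw h d k i j) v
  simp only [ricciOf, h', christoffelOf_congr hU hu h]

lemma codiffOf_congr (hU : IsOpen U) (hu : u ∈ U) (h : ∀ w ∈ U, G w = G' w) (d : κ → W) {k : ℕ}
    {T T' : W → (Fin (k + 1) → κ) → ℝ} (hT : ∀ w ∈ U, T w = T' w) (a : Fin k → κ) :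
    codiffOf d G T a u = codiffOf d G' T' a u := by
  have h' := fun v a => dirDeriv_congr (F := fun w => T w a) (F' := fun w => T' w a) hU hu
    (fun w hw => by rw [hT w hw]) v
  simp only [codiffOf, h', christoffelOf_congr hU hu h, h u hu, hT u hu]

end Congruence

section Slices

variable {E : Type*} [NormedAddCommGroup E] [NormedSpace ℝ E]
  {ι : Type*} [Fintype ι] [DecidableEq ι] {U : Set (ℝ × E)} {G : ℝ × E → Matrix ι ι ℝ}
  {t : ℝ} {y : E} (hG : IsMetricOn G U) (hy : (t, y) ∈ U) (d : ι → E)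
include hG hy

/-- The geometry of the slice at time `t` is that of the matrix function on `ℝ × E` along the
directions `(0, d i)`. No inverse or derivative in the time direction is involved. -/
lemma christoffelOf_slice (k i j : ι) :
    christoffelOf d (fun z => G (t, z)) k i j y
      = christoffelOf (fun i => ((0, d i) : ℝ × E)) G k i j (t, y) := by
  have h := fun v i j => dirDeriv_prodMk_left
    ((hG.smooth i j).differentiableAt_of_isOpen hG.isOpen hy) v
  simp only [christoffelOf, h]

lemma dirDeriv_christoffelOf_slice (v : E) (k i j : ι) :
    dirDeriv v (christoffelOf d (fun z => G (t, z)) k i j) y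
      = dirDeriv (0, v) (christoffelOf (fun i => ((0, d i) : ℝ × E)) G k i j) (t, y) := by
  have hV : IsOpen {z : E | (t, z) ∈ U} := hG.isOpen.preimage (by fun_prop)
  rw [dirDeriv_congr hV hy (fun z hz => christoffelOf_slice hG hz d k i j)]
  exact dirDeriv_prodMk_left
    ((hG.contDiffOn_christoffelOf _ k i j).differentiableAt_of_isOpen hG.isOpen hy) v

lemma ricciOf_slice (i j : ι) :
    ricciOf d (fun z => G (t, z)) i j y
      = ricciOf (fun i => ((0, d i) : ℝ × E)) G i j (t, y) := by
  simp only [ricciOf, christoffelOf_slice hG hy, dirDeriv_christoffelOf_slice hG hy]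

lemma codiffOf_slice {k : ℕ} {T : ℝ × E → (Fin (k + 1) → ι) → ℝ}
    (hT : ∀ a, ContDiffOn ℝ ∞ (fun u => T u a) U) (a : Fin k → ι) :
    codiffOf d (fun z => G (t, z)) (fun z => T (t, z)) a y
      = codiffOf (fun i => ((0, d i) : ℝ × E)) G T a (t, y) := by
  have h := fun v a => dirDeriv_prodMk_left
    ((hT a).differentiableAt_of_isOpen hG.isOpen hy) v
  simp only [codiffOf, christoffelOf_slice hG hy, h]

end Slices

/-! ### Time-dependent tensor fields in one chart of `S`. -/

section Families

variable {J : Opens ℝ}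
  {E : Type*} [NormedAddCommGroup E] [NormedSpace ℝ E]
  {H : Type*} [TopologicalSpace H] {I : ModelWithCorners ℝ E H} [I.Boundaryless]
  {S : Type*} [TopologicalSpace S] [ChartedSpace H S] [IsManifold I ∞ S]
  {ι : Type*} [Fintype ι] [DecidableEq ι] (e : Module.Basis ι ℝ E)

omit [IsManifold I ∞ S] in
lemma isOpen_cylTarget (x : S) : IsOpen (cylTarget J I x) :=
  J.isOpen.prod (isOpen_extChartAt_target x)

/-- The functions `f` are the components of the family of tensor fields `T` in the preferred chart
at `x`. -/
structure IsRepresentedBy {k : ℕ} (T : J → CovTensor I S k) (x : S)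
    (f : ℝ × E → (Fin k → ι) → ℝ) : Prop where
  smooth : ∀ a, ContDiffOn ℝ ∞ (fun u => f u a) (cylTarget J I x)
  eq : ∀ t : J, ∀ y ∈ (extChartAt I x).target, ∀ a, chartComp e (T t) x y a = f ((t : ℝ), y) a

/-- The matrix function `G` represents the family of metrics `h` in the preferred chart at `x`. -/
structure IsMetricRepresentedBy (h : J → CovTensor I S 2) (x : S)
    (G : ℝ × E → Matrix ι ι ℝ) : Prop where
  isMetricOn : IsMetricOn G (cylTarget J I x)
  eq : ∀ t : J, ∀ y ∈ (extChartAt I x).target, chartGram e (h t) x y = G ((t : ℝ), y)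

variable {e}

omit [I.Boundaryless] [IsManifold I ∞ S] in
lemma mem_cylTarget (t : J) {x : S} {y : E} (hy : y ∈ (extChartAt I x).target) :
    ((t : ℝ), y) ∈ cylTarget J I x := ⟨t.2, hy⟩

omit [I.Boundaryless] [IsManifold I ∞ S] in
lemma mem_cylTarget_self (t : J) (x : S) : ((t : ℝ), extChartAt I x x) ∈ cylTarget J I x :=
  mem_cylTarget t (mem_extChartAt_target x)

namespace IsRepresentedBy

variable {k : ℕ} {T : J → CovTensor I S k} {x : S} {f : ℝ × E → (Fin k → ι) → ℝ}

omit [Fintype ι] [DecidableEq ι] in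
lemma apply_self (hT : IsRepresentedBy e T x f) (t : J) (a : Fin k → ι) :
    T t x (fun s => (e (a s) : E)) = f ((t : ℝ), extChartAt I x x) a := by
  exact (chartComp_self e (T t) x a).symm.trans (hT.eq t _ (mem_extChartAt_target x) a)

omit [Fintype ι] [DecidableEq ι] [IsManifold I ∞ S] in
-- The coordinate frame of `S` does not depend on time, so the time derivative acts on components,
-- and by iteration this also covers second time derivatives.
lemma dotTensor (hT : IsRepresentedBy e T x f) :
    IsRepresentedBy e (dotTensor T) x (fun u a => dirDeriv (1, 0) (fun w => f w a) u) where
  smooth a := contDiffOn_dirDeriv (isOpen_cylTarget x) (hT.smooth a) _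
  eq t y hy a := by
    have hd := (hT.smooth a).differentiableAt_of_isOpen (isOpen_cylTarget x) (mem_cylTarget t hy)
    rw [← deriv_prodMk_right hd]
    refine timeDeriv_eq_deriv (F := fun s => f (s, y) a) ?_ (fun s => hT.eq s y hy a)
    exact hd.comp (t : ℝ) (f := fun s : ℝ => (s, y))
      (differentiableAt_id.prodMk (differentiableAt_const y))

end IsRepresentedBy

namespace IsMetricRepresentedBy

variable {h : J → CovTensor I S 2} {x : S} {G : ℝ × E → Matrix ι ι ℝ}
  (hh : IsMetricRepresentedBy e h x G)
include hh

omit [I.Boundaryless] [IsManifold I ∞ S] in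
lemma isRepresentedBy : IsRepresentedBy e h x (fun u a => G u (a 0) (a 1)) where
  smooth a := hh.isMetricOn.smooth _ _
  eq t y hy a := by
    rw [← hh.eq t y hy]
    have : a = ![a 0, a 1] := by ext s; fin_cases s <;> rfl
    conv_lhs => rw [this]
    rfl

lemma gramInv (t : J) : gramInv e (h t) x = (G ((t : ℝ), extChartAt I x x))⁻¹ := by
  rw [gramInv_eq, hh.eq t _ (mem_extChartAt_target x)]

omit [IsManifold I ∞ S] in
lemma ricci (t : J) (i j : ι) :
    ricci e (h t) x i j
      = ricciOf (fun i => ((0, e i) : ℝ × E)) G i j ((t : ℝ), extChartAt I x x) := by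
  rw [ricci_eq_ricciOf, ricciOf_congr (isOpen_extChartAt_target x) (mem_extChartAt_target x)
    (fun y hy => hh.eq t y hy), ricciOf_slice hh.isMetricOn (mem_cylTarget_self t x)]

lemma codiff {k : ℕ} {T : J → CovTensor I S (k + 1)} {f : ℝ × E → (Fin (k + 1) → ι) → ℝ}
    (hT : IsRepresentedBy e T x f) (t : J) (a : Fin k → ι) :
    codiff e (h t) (T t) x a
      = codiffOf (fun i => ((0, e i) : ℝ × E)) G f a ((t : ℝ), extChartAt I x x) := by
  rw [codiff_eq_codiffOf, codiffOf_congr (isOpen_extChartAt_target x) (mem_extChartAt_target x)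
    (fun y hy => hh.eq t y hy) e (T' := fun y => f ((t : ℝ), y))
    (fun y hy => funext fun a => hT.eq t y hy a),
    codiffOf_slice hh.isMetricOn (mem_cylTarget_self t x) e hT.smooth]

end IsMetricRepresentedBy

end Families

/-! ### Components of tensors on `J × S` and of the families they induce on the slices. -/

section CylinderBasis

variable {E : Type*} [NormedAddCommGroup E] [NormedSpace ℝ E] {ι : Type*}
  (e : Module.Basis ι ℝ E)

/-- The basis of `ℝ × E` induced by a basis of `E`. -/
def cylBasisOf : Module.Basis (Unit ⊕ ι) ℝ (ℝ × E) := (Module.Basis.singleton Unit ℝ).prod e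

lemma coe_cylBasisOf : ⇑(cylBasisOf e) = cylDir (1, 0) (fun i => ((0, e i) : ℝ × E)) := by
  ext1 i
  rcases i with i | i
  · simp only [cylBasisOf, Module.Basis.prod_apply, Sum.elim_inl, Function.comp_apply,
      LinearMap.inl_apply, cylDir_inl]
    rw [Module.Basis.singleton_apply]
  · simp [cylBasisOf, Module.Basis.prod_apply]

end CylinderBasis

section SliceComponents

variable {J : Opens ℝ}
  {E : Type*} [NormedAddCommGroup E] [NormedSpace ℝ E]
  {H : Type*} [TopologicalSpace H] {I : ModelWithCorners ℝ E H} [I.Boundaryless]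
  {S : Type*} [TopologicalSpace S] [ChartedSpace H S] [IsManifold I ∞ S]
  {ι : Type*} [Fintype ι] [DecidableEq ι] (e : Module.Basis ι ℝ E)

omit [Fintype ι] [DecidableEq ι] in
lemma chartComp_cyl {k : ℕ} (T : CovTensor (𝓘(ℝ, ℝ).prod I) (J × S) k) (τ : J) (x : S) (t : J)
    {y : E} (hy : y ∈ (extChartAt I x).target) (a : Fin k → Unit ⊕ ι) :
    chartComp (cylBasisOf e) T (τ, x) ((t : ℝ), y) a
      = T (t, (extChartAt I x).symm y) (fun s =>
        (cylDir ((1, 0) : ℝ × E) (fun i => (0, chartDeriv I x y (e i))) (a s) : ℝ × E)) := by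
  rw [chartComp_eq, chartDeriv_cyl τ x t hy]
  have h : ∀ p q : J × S, p = q → ∀ v : Fin k → ℝ × E,
      T p (fun s => (v s : ℝ × E)) = T q (fun s => (v s : ℝ × E)) := by
    rintro p q rfl v; rfl
  refine (h _ _ (extChartAt_cyl_symm τ x t y) _).trans ?_
  congr 1
  ext1 s
  rw [coe_cylBasisOf]
  rcases a s with i | i
  · exact Prod.ext rfl (map_zero (chartDeriv I x y))
  · exact Prod.ext rfl rfl

omit [Fintype ι] [DecidableEq ι] in
-- The time `τ` at which the chart of the cylinder is centred is unrelated to the time `t` of the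
-- slice, so one chart describes the whole family.
lemma chartComp_sliceTensor {k : ℕ} (T : CovTensor (𝓘(ℝ, ℝ).prod I) (J × S) k) (τ : J) (x : S)
    (t : J) {y : E} (hy : y ∈ (extChartAt I x).target) (a : Fin k → ι) :
    chartComp e (sliceTensor T t) x y a
      = chartComp (cylBasisOf e) T (τ, x) ((t : ℝ), y) (Sum.inr ∘ a) := by
  rw [chartComp_cyl e T τ x t hy, chartComp_eq]
  unfold sliceTensor
  rw [sliceMap_eq]
  rfl

omit [I.Boundaryless] [IsManifold I ∞ S] in
lemma sliceContraction_apply {k : ℕ} (α : FormField (𝓘(ℝ, ℝ).prod I) (J × S) (k + 1)) (t : J)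
    (x : S) (v : Fin k → E) :
    sliceContraction α t x (fun s => (v s : E))
      = α (t, x) (fun s => (Matrix.vecCons ((1, 0) : ℝ × E) (fun s => (0, v s)) s : ℝ × E)) := by
  change ContinuousAlternatingMap.compContinuousLinearMap
    (ContinuousAlternatingMap.curryLeft (𝕜 := ℝ) (E := ℝ × E) (F := ℝ) (α (t, x)) (dTau I (t, x)))
    (sliceMap I t x : E →L[ℝ] ℝ × E) v = _
  rw [dTau_eq, sliceMap_eq]
  rfl

omit [Fintype ι] [DecidableEq ι] in
lemma chartComp_sliceContraction {k : ℕ} (α : FormField (𝓘(ℝ, ℝ).prod I) (J × S) (k + 1)) (τ : J)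
    (x : S) (t : J) {y : E} (hy : y ∈ (extChartAt I x).target) (a : Fin k → ι) :
    chartComp e (sliceContraction α t).toTensor x y a
      = chartComp (cylBasisOf e) α.toTensor (τ, x) ((t : ℝ), y)
        (Matrix.vecCons (.inl ()) (Sum.inr ∘ a)) := by
  rw [chartComp_cyl e α.toTensor τ x t hy, chartComp_eq]
  have h : (fun s => (cylDir ((1, 0) : ℝ × E) (fun i => (0, chartDeriv I x y (e i)))
      ((Matrix.vecCons (.inl ()) (Sum.inr ∘ a) : Fin (k + 1) → Unit ⊕ ι) s) : ℝ × E))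
      = Matrix.vecCons ((1, 0) : ℝ × E) (fun s => (0, chartDeriv I x y (e (a s)))) := by
    ext1 s
    refine Fin.cases rfl (fun s => rfl) s
  rw [h]
  exact sliceContraction_apply α t _ _

omit [I.Boundaryless] [IsManifold I ∞ S] [Fintype ι] [DecidableEq ι] in
lemma DiffForm.contDiffOn_chartComp {k : ℕ} (α : DiffForm I S k) (x : S) (a : Fin k → ι) :
    ContDiffOn ℝ ∞ (fun u => chartComp e α.toField.toTensor x u a) (extChartAt I x).target :=
  (ContinuousAlternatingMap.apply ℝ E ℝ (fun s => e (a s))).contDiff.comp_contDiffOn (α.smooth x)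

omit [Fintype ι] [DecidableEq ι] in
lemma isRepresentedBy_sliceTensor {k : ℕ} {T : CovTensor (𝓘(ℝ, ℝ).prod I) (J × S) k} {τ : J} {x : S}
    (hT : ∀ a : Fin k → Unit ⊕ ι, ContDiffOn ℝ ∞ (fun u => chartComp (cylBasisOf e) T (τ, x) u a)
      (cylTarget J I x)) :
    IsRepresentedBy e (sliceTensor T) x
      (fun u a => chartComp (cylBasisOf e) T (τ, x) u (Sum.inr ∘ a)) :=
  ⟨fun _ => hT _, fun t _ hy a => chartComp_sliceTensor e T τ x t hy a⟩

omit [Fintype ι] [DecidableEq ι] in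
lemma isRepresentedBy_sliceForm {k : ℕ} (α : DiffForm (𝓘(ℝ, ℝ).prod I) (J × S) k) (τ : J) (x : S) :
    IsRepresentedBy e (fun t => (sliceForm α.toField t).toTensor) x
      (fun u a => chartComp (cylBasisOf e) α.toField.toTensor (τ, x) u (Sum.inr ∘ a)) := by
  refine isRepresentedBy_sliceTensor (T := α.toField.toTensor) (τ := τ) e fun a => ?_
  rw [← extChartAt_cyl_target τ x]
  exact α.contDiffOn_chartComp _ _ a

omit [Fintype ι] [DecidableEq ι] in
lemma isRepresentedBy_sliceContraction {k : ℕ} (α : DiffForm (𝓘(ℝ, ℝ).prod I) (J × S) (k + 1))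
    (τ : J) (x : S) :
    IsRepresentedBy e (fun t => (sliceContraction α.toField t).toTensor) x
      (fun u a => chartComp (cylBasisOf e) α.toField.toTensor (τ, x) u
        (Matrix.vecCons (.inl ()) (Sum.inr ∘ a))) := by
  refine ⟨fun _ => ?_, fun t _ hy a => chartComp_sliceContraction e _ τ x t hy a⟩
  rw [← extChartAt_cyl_target τ x]
  exact α.contDiffOn_chartComp _ _ _

omit [I.Boundaryless] [IsManifold I ∞ S] [Fintype ι] [DecidableEq ι] in
lemma chartComp_toTensor {k : ℕ} (α : FormField I S k) (x : S) (u : E) (a : Fin k → ι) :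
    chartComp e α.toTensor x u a = α.inChart x u (e ∘ a) := rfl

omit [Fintype ι] [DecidableEq ι] in
lemma _root_.ContinuousAlternatingMap.comp_vec_three_swap {κ : Type*} (f : E [⋀^Fin 3]→L[ℝ] ℝ)
    (v : κ → E) (i j k : κ) :
    f (v ∘ ![i, j, k]) = - f (v ∘ ![j, i, k]) ∧ f (v ∘ ![i, j, k]) = - f (v ∘ ![i, k, j]) := by
  constructor
  · have h := f.map_swap (v ∘ ![j, i, k]) (show (0 : Fin 3) ≠ 1 by decide)
    exact (congrArg f (funext fun s => by fin_cases s <;> rfl)).trans h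
  · have h := f.map_swap (v ∘ ![i, k, j]) (show (1 : Fin 3) ≠ 2 by decide)
    exact (congrArg f (funext fun s => by fin_cases s <;> rfl)).trans h

omit [I.Boundaryless] [IsManifold I ∞ S] [Fintype ι] [DecidableEq ι] in
-- The link from forms to the component calculus: alternation supplies the sign rules, and `ψ` and
-- `F` are the components with and without a leading time index.
lemma isSplit_chartComp (α : FormField (𝓘(ℝ, ℝ).prod I) (J × S) 3) (p : J × S) :
    IsSplit (fun u a => chartComp (cylBasisOf e) α.toTensor p u a)
      (fun u a => chartComp (cylBasisOf e) α.toTensor p u (Matrix.vecCons (.inl ()) (Sum.inr ∘ a)))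
      (fun u a => chartComp (cylBasisOf e) α.toTensor p u (Sum.inr ∘ a)) := by
  simp only [chartComp_toTensor]
  refine ⟨fun u i j k => ?_, fun u i j k => ?_, fun u i j => ?_, fun u i j k => ?_⟩
  · exact ((α.inChart p u).comp_vec_three_swap _ i j k).1
  · exact ((α.inChart p u).comp_vec_three_swap _ i j k).2
  · exact congrArg (fun a => α.inChart p u (cylBasisOf e ∘ a))
      (funext fun s => by fin_cases s <;> rfl)
  · exact congrArg (fun a => α.inChart p u (cylBasisOf e ∘ a))
      (funext fun s => by fin_cases s <;> rfl)

end SliceComponents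

/-! ### The matrix of a cylindrical metric. -/

section CylindricalMetrics

variable {J : Opens ℝ}
  {E : Type*} [NormedAddCommGroup E] [NormedSpace ℝ E]
  {H : Type*} [TopologicalSpace H] {I : ModelWithCorners ℝ E H} [I.Boundaryless]
  {S : Type*} [TopologicalSpace S] [ChartedSpace H S] [IsManifold I ∞ S]
  {ι : Type*} [Fintype ι] [DecidableEq ι] (e : Module.Basis ι ℝ E)
  (g : Bundle.ContMDiffRiemannianMetric (𝓘(ℝ, ℝ).prod I) ∞ (ℝ × E)
    (fun p : J × S => TangentSpace (𝓘(ℝ, ℝ).prod I) p))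

/-- The matrix of the metrics on the slices, in the preferred chart at `p`. -/
def sliceGram (p : J × S) (u : ℝ × E) : Matrix ι ι ℝ :=
  Matrix.of fun i j => chartGram (cylBasisOf e) (metricTensor g) p u (.inr i) (.inr j)

variable {g} in
-- At every point of the chart domain the coordinate frame is `∂_τ` followed by vectors tangent to
-- the slice, so the pointwise orthogonality conditions give the block form throughout.
lemma chartGram_cyl (hg : IsCylindrical (metricTensor g)) (τ : J) (x : S) {u : ℝ × E}
    (hu : u ∈ cylTarget J I x) :
    chartGram (cylBasisOf e) (metricTensor g) (τ, x) u = cylGram (sliceGram e g (τ, x)) u := by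
  obtain ⟨t, y⟩ := u
  obtain ⟨ht, hy⟩ := hu
  lift t to J using ht
  have h0 := hg.1 (t, (extChartAt I x).symm y)
  have h1 := hg.2 t ((extChartAt I x).symm y)
  rw [dTau_eq] at h0 h1
  rw [sliceMap_eq] at h1
  have hc : ∀ i j, chartGram (cylBasisOf e) (metricTensor g) (τ, x) ((t : ℝ), y) i j = _ :=
    fun i j => chartComp_cyl e (metricTensor g) τ x t hy ![i, j]
  have hs : ∀ i j, chartGram (cylBasisOf e) (metricTensor g) (τ, x) ((t : ℝ), y) i j
      = chartGram (cylBasisOf e) (metricTensor g) (τ, x) ((t : ℝ), y) j i :=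
    (isMetricOn_chartGram (cylBasisOf e) g (τ, x)).symm _
      (by rw [extChartAt_cyl_target]; exact ⟨t.2, hy⟩)
  have h10 : ∀ i, chartGram (cylBasisOf e) (metricTensor g) (τ, x) ((t : ℝ), y) (.inl ()) (.inr i)
      = 0 := fun i => (hc _ _).trans (h1 (chartDeriv I x y (e i)))
  ext i j
  rcases i with ⟨⟩ | i <;> rcases j with ⟨⟩ | j
  · exact (hc _ _).trans h0
  · exact h10 j
  · exact (hs _ _).trans (h10 i)
  · rfl

variable {g} in
lemma isMetricRepresentedBy_slice (hg : IsCylindrical (metricTensor g)) (τ : J) (x : S) :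
    IsMetricRepresentedBy e (sliceTensor (metricTensor g)) x (sliceGram e g (τ, x)) where
  isMetricOn := by
    have h := isMetricOn_chartGram (cylBasisOf e) g (τ, x)
    rw [extChartAt_cyl_target] at h
    refine ⟨isOpen_cylTarget x, fun i j => h.smooth _ _, fun u hu i j => h.symm u hu _ _,
      fun u hu => ?_⟩
    -- The determinant of the block matrix is that of its spatial block, so nondegeneracy passes to
    -- the slices.
    have := h.isUnit_det u hu
    rw [chartGram_cyl e hg τ x hu, cylGram, Matrix.det_fromBlocks_zero₂₁, Matrix.det_one,
      one_mul] at this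
    exact this
  eq t y hy := by
    ext i j
    refine (chartComp_sliceTensor e (metricTensor g) τ x t hy ![i, j]).trans ?_
    have : (Sum.inr ∘ ![i, j] : Fin 2 → Unit ⊕ ι) = ![.inr i, .inr j] := by
      ext1 s; fin_cases s <;> rfl
    rw [this]
    rfl

end CylindricalMetrics

/-! ### Functions on `J × S` and their derivatives in a chart. -/

section CylinderFunctions

variable {J : Opens ℝ}
  {E : Type*} [NormedAddCommGroup E] [NormedSpace ℝ E]
  {H : Type*} [TopologicalSpace H] {I : ModelWithCorners ℝ E H} [I.Boundaryless]
  {S : Type*} [TopologicalSpace S] [ChartedSpace H S] [IsManifold I ∞ S]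
  {ι : Type*} [Fintype ι] [DecidableEq ι] (e : Module.Basis ι ℝ E)
  {φ : J × S → ℝ} (hφ : ContMDiff (𝓘(ℝ, ℝ).prod I) 𝓘(ℝ, ℝ) ∞ φ)

/-- A function on `J × S` in the preferred chart at `p`. -/
def chartFun (I : ModelWithCorners ℝ E H) (φ : J × S → ℝ) (p : J × S) (u : ℝ × E) : ℝ :=
  φ ((extChartAt (𝓘(ℝ, ℝ).prod I) p).symm u)

omit [I.Boundaryless] [IsManifold I ∞ S] in
lemma chartFun_apply (τ : J) (x : S) (t : J) (y : E) :
    chartFun I φ (τ, x) ((t : ℝ), y) = φ (t, (extChartAt I x).symm y) := by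
  rw [chartFun, extChartAt_cyl_symm]

include hφ

omit [I.Boundaryless] in
lemma contDiffOn_chartFun (τ : J) (x : S) :
    ContDiffOn ℝ ∞ (chartFun I φ (τ, x)) (cylTarget J I x) := by
  rw [← extChartAt_cyl_target τ x]
  exact (hφ.comp_contMDiffOn (contMDiffOn_extChartAt_symm (τ, x))).contDiffOn

omit [Fintype ι] [DecidableEq ι] in
lemma chartComp_differential_cyl (τ : J) (x : S) {u : ℝ × E} (hu : u ∈ cylTarget J I x)
    (i : Unit ⊕ ι) :
    chartComp (cylBasisOf e) (differential (𝓘(ℝ, ℝ).prod I) φ) (τ, x) u ![i]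
      = dirDeriv (cylBasisOf e i) (chartFun I φ (τ, x)) u := by
  rw [← extChartAt_cyl_target τ x] at hu
  exact chartComp_differential _ hu (hφ.mdifferentiableAt (by simp)) i

omit [I.Boundaryless] [IsManifold I ∞ S] in
lemma contMDiff_slice (t : J) : ContMDiff I 𝓘(ℝ, ℝ) ∞ (fun z => φ (t, z)) :=
  hφ.comp (contMDiff_const.prodMk contMDiff_id)

omit [Fintype ι] [DecidableEq ι] in
lemma isRepresentedBy_differential (τ : J) (x : S) :
    IsRepresentedBy e (fun t => differential I (fun z => φ (t, z))) x
      (fun u a => dirDeriv (0, e (a 0)) (chartFun I φ (τ, x)) u) where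
  smooth a := contDiffOn_dirDeriv (isOpen_cylTarget x) (contDiffOn_chartFun hφ τ x) _
  eq t y hy a := by
    have ha : a = ![a 0] := by ext s; fin_cases s; rfl
    rw [ha, chartComp_differential e hy ((contMDiff_slice hφ t).mdifferentiableAt (by simp))]
    rw [← dirDeriv_prodMk_left ((contDiffOn_chartFun hφ τ x).differentiableAt_of_isOpen
      (isOpen_cylTarget x) (mem_cylTarget t hy))]
    simp only [chartFun_apply]
    rfl

lemma timeDeriv_chartFun (τ : J) (x : S) (t : J) :
    timeDeriv (fun s => φ (s, x)) t
      = dirDeriv (1, 0) (chartFun I φ (τ, x)) ((t : ℝ), extChartAt I x x) := by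
  have hd := (contDiffOn_chartFun hφ τ x).differentiableAt_of_isOpen (isOpen_cylTarget x)
    (mem_cylTarget_self t x)
  rw [← deriv_prodMk_right hd]
  refine timeDeriv_eq_deriv (F := fun s => chartFun I φ (τ, x) (s, extChartAt I x x)) ?_
    (fun s => ?_)
  · exact hd.comp (t : ℝ) (f := fun s : ℝ => (s, extChartAt I x x))
      (differentiableAt_id.prodMk (differentiableAt_const _))
  · simp only [chartFun_apply, extChartAt_to_inv]

lemma timeDeriv_timeDeriv_chartFun (τ : J) (x : S) (t : J) :
    timeDeriv (timeDeriv (fun s => φ (s, x))) t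
      = dirDeriv (1, 0) (dirDeriv (1, 0) (chartFun I φ (τ, x))) ((t : ℝ), extChartAt I x x) := by
  have hd := (contDiffOn_dirDeriv (isOpen_cylTarget x) (contDiffOn_chartFun hφ τ x)
    (1, 0)).differentiableAt_of_isOpen (isOpen_cylTarget x) (mem_cylTarget_self t x)
  rw [← deriv_prodMk_right hd]
  refine timeDeriv_eq_deriv
    (F := fun s => dirDeriv (1, 0) (chartFun I φ (τ, x)) (s, extChartAt I x x)) ?_
    (fun s => timeDeriv_chartFun hφ τ x s)
  exact hd.comp (t : ℝ) (f := fun s : ℝ => (s, extChartAt I x x))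
      (differentiableAt_id.prodMk (differentiableAt_const _))

end CylinderFunctions

/-! ### The trace of `∂_τ h` as a function on a slice. -/

section TraceDerivative

/-- The trace of one bilinear form with respect to another is independent of the basis.
Invertibility of the change of basis `P` follows from that of the transformed matrix. -/
lemma trace_inv_congruence {ι : Type*} [Fintype ι] [DecidableEq ι] (P A D : Matrix ι ι ℝ)
    (h : IsUnit (P.transpose * A * P).det) :
    ((P.transpose * A * P)⁻¹ * (P.transpose * D * P).transpose).trace
      = (A⁻¹ * D.transpose).trace := by
  have hP : IsUnit P.det := by
    rw [Matrix.det_mul] at h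
    exact isUnit_of_mul_isUnit_right h
  have hP' : IsUnit P.transpose.det := by rwa [Matrix.det_transpose]
  rw [Matrix.mul_inv_rev, Matrix.mul_inv_rev, Matrix.transpose_mul, Matrix.transpose_mul,
    Matrix.transpose_transpose, Matrix.trace_mul_comm]
  have : P.transpose * (D.transpose * P) * (P⁻¹ * (A⁻¹ * P.transpose⁻¹))
      = P.transpose * (D.transpose * A⁻¹ * P.transpose⁻¹) := by
    simp only [Matrix.mul_assoc]
    rw [Matrix.mul_nonsing_inv_cancel_left _ _ hP]
  rw [this, Matrix.trace_mul_comm, Matrix.mul_assoc, Matrix.nonsing_inv_mul _ hP', Matrix.mul_one,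
    Matrix.trace_mul_comm]

variable {J : Opens ℝ}
  {E : Type*} [NormedAddCommGroup E] [NormedSpace ℝ E]
  {H : Type*} [TopologicalSpace H] {I : ModelWithCorners ℝ E H} [I.Boundaryless]
  {S : Type*} [TopologicalSpace S] [ChartedSpace H S] [IsManifold I ∞ S]
  {ι : Type*} [Fintype ι] [DecidableEq ι] (e : Module.Basis ι ℝ E)

section Representatives
variable {e} {h : J → CovTensor I S 2} {x : S} {G : ℝ × E → Matrix ι ι ℝ}

lemma IsMetricRepresentedBy.apply_self (hh : IsMetricRepresentedBy e h x G) (t : J) (i j : ι) :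
    h t x ![e i, e j] = G ((t : ℝ), extChartAt I x x) i j := by
  rw [← hh.eq t _ (mem_extChartAt_target x), chartGram_self]
  rfl

lemma vec_two_comp {α β : Type*} (f : α → β) (i j : α) :
    (fun s => f (![i, j] s)) = ![f i, f j] := by
  ext1 s; fin_cases s <;> rfl

omit [Fintype ι] [DecidableEq ι] in
lemma IsRepresentedBy.apply_two {T : J → CovTensor I S 2} {f : ℝ × E → (Fin 2 → ι) → ℝ}
    (hT : IsRepresentedBy e T x f) (t : J) (i j : ι) :
    T t x ![e i, e j] = f ((t : ℝ), extChartAt I x x) ![i, j] := by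
  rw [← hT.apply_self t ![i, j]]
  exact congrArg (T t x) (vec_two_comp e i j).symm

lemma IsMetricRepresentedBy.dotTensor_apply (hh : IsMetricRepresentedBy e h x G) (t : J)
    (i j : ι) :
    dotTensor h t x ![e i, e j]
      = dirDeriv (1, 0) (fun w => G w i j) ((t : ℝ), extChartAt I x x) :=
  hh.isRepresentedBy.dotTensor.apply_two t i j

lemma IsMetricRepresentedBy.traceG_dotTensor (hh : IsMetricRepresentedBy e h x G) (t : J) :
    traceG e (h t) (dotTensor h t) x
      = ∑ k, ∑ l, (G ((t : ℝ), extChartAt I x x))⁻¹ k l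
        * dirDeriv (1, 0) (fun w => G w k l) ((t : ℝ), extChartAt I x x) := by
  unfold traceG
  rw [hh.gramInv]
  simp only [hh.dotTensor_apply]

end Representatives

variable {g : Bundle.ContMDiffRiemannianMetric (𝓘(ℝ, ℝ).prod I) ∞ (ℝ × E)
    (fun p : J × S => TangentSpace (𝓘(ℝ, ℝ).prod I) p)}
  (hg : IsCylindrical (metricTensor g))
include hg

/-- The matrices of the metric in two charts at a point are congruent, by a matrix that does not
depend on time. -/
lemma exists_sliceGram_eq (τ : J) (x : S) {y : E} (hy : y ∈ (extChartAt I x).target) :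
    ∃ P : Matrix ι ι ℝ, ∀ t : J, sliceGram e g (τ, x) ((t : ℝ), y)
      = P.transpose * sliceGram e g (τ, (extChartAt I x).symm y)
        ((t : ℝ), extChartAt I ((extChartAt I x).symm y) ((extChartAt I x).symm y)) * P := by
  set z := (extChartAt I x).symm y with hz
  -- The columns of `P` express the coordinate frame of the chart at `x` in that of the chart at
  -- `z`.
  refine ⟨Matrix.of fun k i => e.repr (chartDeriv I x y (e i)) k, fun t => ?_⟩
  set B : ℝ × E →L[ℝ] ℝ × E →L[ℝ] ℝ := g.inner (t, z) with hB
  have h1 : ∀ i j, sliceGram e g (τ, x) ((t : ℝ), y) i j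
      = B (0, chartDeriv I x y (e i)) (0, chartDeriv I x y (e j)) := fun i j =>
    chartComp_cyl e (metricTensor g) τ x t hy ![.inr i, .inr j]
  have h2 : ∀ i j, sliceGram e g (τ, z) ((t : ℝ), extChartAt I z z) i j
      = B (0, e i) (0, e j) := by
    intro i j
    rw [← (isMetricRepresentedBy_slice e hg τ z).apply_self t i j]
    change metricTensor g (t, z) _ = _
    rw [sliceMap_eq]
    rfl
  have h3 : ∀ i, ((0, chartDeriv I x y (e i)) : ℝ × E)
      = ∑ k, e.repr (chartDeriv I x y (e i)) k • ((0, e k) : ℝ × E) := by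
    intro i
    have : ((0, chartDeriv I x y (e i)) : ℝ × E)
      = ContinuousLinearMap.inr ℝ ℝ E (∑ k, e.repr (chartDeriv I x y (e i)) k • e k) := by
      rw [e.sum_repr]; rfl
    rw [this, map_sum]
    exact Finset.sum_congr rfl fun k _ => map_smul (ContinuousLinearMap.inr ℝ ℝ E) _ _
  ext i j
  rw [h1, h3 i, h3 j]
  simp only [map_sum, map_smul, sum_apply, smul_apply, smul_eq_mul, Matrix.mul_apply,
    Matrix.transpose_apply, Matrix.of_apply, h2]
  refine Finset.sum_congr rfl fun k _ => ?_
  rw [Finset.mul_sum, Finset.sum_mul]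
  exact Finset.sum_congr rfl fun l _ => by ring

/-- The trace at a point uses that point's own chart, but differentiating it at `x` requires its
values near `x` in the chart at `x`. The two agree because the transition matrix is constant in time
and so transforms `h` and `∂_τ h` alike. -/
lemma traceG_dotTensor_chart (τ : J) (x : S) {y : E} (hy : y ∈ (extChartAt I x).target) :
    traceG e (sliceTensor (metricTensor g) τ) (dotTensor (sliceTensor (metricTensor g)) τ)
        ((extChartAt I x).symm y)
      = ∑ k, ∑ l, (sliceGram e g (τ, x) ((τ : ℝ), y))⁻¹ k l
        * dirDeriv (1, 0) (fun w => sliceGram e g (τ, x) w k l) ((τ : ℝ), y) := by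
  obtain ⟨P, hP⟩ := exists_sliceGram_eq e hg τ x hy
  have hx := isMetricRepresentedBy_slice e hg τ x
  have hz := isMetricRepresentedBy_slice e hg τ ((extChartAt I x).symm y)
  rw [hz.traceG_dotTensor]
  set z := (extChartAt I x).symm y with hzdef
  set z' := extChartAt I z z with hz'
  have hD : (Matrix.of fun k l => dirDeriv (1, 0) (fun w => sliceGram e g (τ, x) w k l)
        ((τ : ℝ), y))
      = P.transpose * (Matrix.of fun k l => dirDeriv (1, 0) (fun w => sliceGram e g (τ, z) w k l)
        ((τ : ℝ), z')) * P := by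
    ext i j
    have d1 := (hx.isMetricOn.smooth i j).differentiableAt_of_isOpen hx.isMetricOn.isOpen
      (mem_cylTarget τ hy)
    have d2 := fun k l => (hz.isMetricOn.smooth k l).differentiableAt_of_isOpen
      hz.isMetricOn.isOpen (mem_cylTarget_self τ z)
    have d3 : ∀ k l, HasDerivAt (fun s => sliceGram e g (τ, z) (s, z') k l)
        (dirDeriv (1, 0) (fun w => sliceGram e g (τ, z) w k l) ((τ : ℝ), z')) τ := by
      intro k l
      rw [← deriv_prodMk_right (d2 k l)]
      exact ((d2 k l).comp (τ : ℝ) (f := fun s : ℝ => (s, z'))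
        (differentiableAt_id.prodMk (differentiableAt_const _))).hasDerivAt
    -- The congruence is known only for times in `J`, which is a neighbourhood of `τ`.
    have h4 : (fun s : ℝ => sliceGram e g (τ, x) (s, y) i j) =ᶠ[𝓝 (τ : ℝ)]
        fun s => ∑ l, (∑ k, P k i * sliceGram e g (τ, z) (s, z') k l) * P l j := by
      filter_upwards [J.isOpen.mem_nhds τ.2] with s hs
      have := congrFun (congrFun (hP ⟨s, hs⟩) i) j
      simpa [Matrix.mul_apply] using this
    have h5 : HasDerivAt (fun s => ∑ l, (∑ k, P k i * sliceGram e g (τ, z) (s, z') k l) * P l j)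
        (∑ l, (∑ k, P k i * dirDeriv (1, 0) (fun w => sliceGram e g (τ, z) w k l)
          ((τ : ℝ), z')) * P l j) (τ : ℝ) :=
      HasDerivAt.fun_sum fun l _ => (HasDerivAt.fun_sum fun k _ => (d3 k l).const_mul _).mul_const _
    rw [Matrix.of_apply, ← deriv_prodMk_right d1, h4.deriv_eq, h5.deriv]
    simp [Matrix.mul_apply]
  have key : ∀ A D : Matrix ι ι ℝ, ∑ k, ∑ l, A k l * D k l = (A * D.transpose).trace := by
    intro A D
    simp [Matrix.trace, Matrix.mul_apply]
  have k1 := key (sliceGram e g (τ, x) ((τ : ℝ), y))⁻¹ (Matrix.of fun k l =>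
    dirDeriv (1, 0) (fun w => sliceGram e g (τ, x) w k l) ((τ : ℝ), y))
  have k2 := key (sliceGram e g (τ, z) ((τ : ℝ), z'))⁻¹ (Matrix.of fun k l =>
    dirDeriv (1, 0) (fun w => sliceGram e g (τ, z) w k l) ((τ : ℝ), z'))
  have hdet := hx.isMetricOn.isUnit_det _ (mem_cylTarget τ hy)
  rw [hP τ] at hdet k1
  rw [hD, trace_inv_congruence _ _ _ hdet, ← k2, ← hD, ← hP τ] at k1
  exact k1.symm

lemma differential_traceG (τ : J) (x : S) (i : ι) :
    differential I (traceG e (sliceTensor (metricTensor g) τ)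
        (dotTensor (sliceTensor (metricTensor g)) τ)) x ![e i]
      = dirDeriv (0, e i) (fun u => ∑ k, ∑ l, (sliceGram e g (τ, x) u)⁻¹ k l
        * dirDeriv (1, 0) (fun w => sliceGram e g (τ, x) w k l) u) ((τ : ℝ), extChartAt I x x) := by
  have hx := (isMetricRepresentedBy_slice e hg τ x).isMetricOn
  set L : ℝ × E → ℝ := fun u => ∑ k, ∑ l, (sliceGram e g (τ, x) u)⁻¹ k l
        * dirDeriv (1, 0) (fun w => sliceGram e g (τ, x) w k l) u with hL
  set f := traceG e (sliceTensor (metricTensor g) τ)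
        (dotTensor (sliceTensor (metricTensor g)) τ) with hf
  have hLs : ContDiffOn ℝ ∞ L (cylTarget J I x) := ContDiffOn.sum fun k _ => ContDiffOn.sum
    fun l _ => (hx.inv_smooth k l).mul (contDiffOn_dirDeriv hx.isOpen (hx.smooth k l) _)
  have hd := hLs.differentiableAt_of_isOpen hx.isOpen (mem_cylTarget_self τ x)
  have hd' : DifferentiableAt ℝ (fun y => L ((τ : ℝ), y)) (extChartAt I x x) :=
    hd.comp (extChartAt I x x) ((differentiableAt_const _).prodMk differentiableAt_id)
  have hfL : ∀ y ∈ (extChartAt I x).target, f ((extChartAt I x).symm y) = L ((τ : ℝ), y) :=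
    fun y hy => traceG_dotTensor_chart e hg τ x hy
  have hmd : MDifferentiableAt I 𝓘(ℝ, ℝ) f x := by
    have := isManifold_one I (M := S)
    have h1 : MDifferentiableAt I 𝓘(ℝ, ℝ) ((fun y => L ((τ : ℝ), y)) ∘ extChartAt I x) x :=
      MDifferentiableAt.comp x hd'.mdifferentiableAt
        (mdifferentiableAt_extChartAt (mem_chart_source H x))
    refine h1.congr_of_eventuallyEq ?_
    filter_upwards [extChartAt_source_mem_nhds (I := I) x] with z hz
    rw [Function.comp_apply, ← hfL _ ((extChartAt I x).map_source hz),
      (extChartAt I x).left_inv hz]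
  have h1 := chartComp_self e (differential I f) x ![i]
  rw [chartComp_differential e (mem_extChartAt_target x) (by rwa [extChartAt_to_inv])] at h1
  rw [dirDeriv_congr (isOpen_extChartAt_target x) (mem_extChartAt_target x) hfL,
    dirDeriv_prodMk_left hd] at h1
  rw [h1]
  exact congrArg (differential I f x) (funext fun s => by fin_cases s; rfl)

end TraceDerivative

/-! ### Gradients and inner products in the frame at a point. -/

section Gradient

variable {E : Type*} [NormedAddCommGroup E] [NormedSpace ℝ E]
  {H : Type*} [TopologicalSpace H] {I : ModelWithCorners ℝ E H}
  {M : Type*} [TopologicalSpace M] [ChartedSpace H M]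
  {κ : Type*} [Fintype κ] [DecidableEq κ] (e : Module.Basis κ ℝ E)

omit [DecidableEq κ] in
lemma _root_.ContinuousAlternatingMap.apply_vecCons_sum {k : ℕ} (β : E [⋀^Fin (k + 1)]→L[ℝ] ℝ)
    (c : κ → κ → ℝ) (b : κ → E) (v : Fin k → E) :
    β (Matrix.vecCons (∑ i, ∑ j, c i j • b i) v)
      = ∑ i, ∑ j, c i j * β (Matrix.vecCons (b i) v) := by
  simp only [← ContinuousAlternatingMap.curryLeft_apply_apply, map_sum, map_smul,
    ContinuousAlternatingMap.sum_apply, ContinuousAlternatingMap.smul_apply, smul_eq_mul]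

lemma toTensor_gradient (g : CovTensor I M 2) (f : M → ℝ) (x : M) {k : ℕ}
    (α : FormField I M (k + 1)) (v : Fin k → TangentSpace I x) :
    α.toTensor x (Matrix.vecCons (gradient e g f x) v)
      = ∑ i, ∑ j, gramInv e g x i j * differential I f x ![e j]
        * α.toTensor x (Matrix.vecCons (e i) v) := by
  exact ContinuousAlternatingMap.apply_vecCons_sum (E := E) (α x) _ e v

end Gradient

section Products

variable {E : Type*} [NormedAddCommGroup E] [NormedSpace ℝ E]
  {H : Type*} [TopologicalSpace H] {I : ModelWithCorners ℝ E H}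
  {M : Type*} [TopologicalSpace M] [ChartedSpace H M]
  {κ : Type*} [Fintype κ] [DecidableEq κ] (e : Module.Basis κ ℝ E) (g : CovTensor I M 2) (x : M)

lemma tensorInner_eq {k : ℕ} (S T : (Fin k → TangentSpace I x) → ℝ) :
    tensorInner e g x S T = tensorInnerOf (gramInv e g x) (fun a => S (fun s => (e (a s) : E)))
      (fun a => T (fun s => (e (a s) : E))) := rfl

omit [Fintype κ] [DecidableEq κ] in
lemma insert_basis {k : ℕ} (T : CovTensor I M (k + 1)) (i : κ) (a : Fin k → κ) :
    insert T x (e i) (fun s => (e (a s) : E))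
      = T x (fun s => (e ((Matrix.vecCons i a : Fin (k + 1) → κ) s) : E)) := by
  refine congrArg (T x) (funext fun s => ?_)
  refine Fin.cases rfl (fun s => rfl) s

lemma circ_basis {k : ℕ} (S T : CovTensor I M (k + 1)) (i j : κ) :
    circ e g S T x (e i) (e j)
      = tensorInnerOf (gramInv e g x)
        (fun a => S x (fun s => (e ((Matrix.vecCons i a : Fin (k + 1) → κ) s) : E)))
        (fun a => T x (fun s => (e ((Matrix.vecCons j a : Fin (k + 1) → κ) s) : E)))
        / (k.factorial : ℝ) := by
  unfold circ formInner
  rw [tensorInner_eq]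
  simp only [insert_basis]

/-- Contracting the first slot gives the full contraction divided by `k!`, whereas the determinant
norm divides it by `(k + 1)!`; hence the factor `k + 1`. -/
lemma sum_circ_basis {k : ℕ} (S : CovTensor I M (k + 1)) :
    ∑ i, ∑ j, gramInv e g x i j * circ e g S S x (e i) (e j)
      = (k + 1) * formInner e g x (S x) (S x) := by
  simp only [circ_basis]
  unfold formInner
  rw [tensorInner_eq, tensorInnerOf_succ, Nat.factorial_succ]
  simp only [mul_div_assoc', ← Finset.sum_div]
  push_cast
  field_simp

end Products

/-! ### Time and space components of each geometric term on the cylinder. -/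

section Reduction

variable {J : Opens ℝ}
  {E : Type*} [NormedAddCommGroup E] [NormedSpace ℝ E]
  {H : Type*} [TopologicalSpace H] {I : ModelWithCorners ℝ E H} [I.Boundaryless]
  {S : Type*} [TopologicalSpace S] [ChartedSpace H S] [IsManifold I ∞ S]
  {ι : Type*} [Fintype ι] [DecidableEq ι] (e : Module.Basis ι ℝ E)
  {g : Bundle.ContMDiffRiemannianMetric (𝓘(ℝ, ℝ).prod I) ∞ (ℝ × E)
    (fun p : J × S => TangentSpace (𝓘(ℝ, ℝ).prod I) p)}
  (hg : IsCylindrical (metricTensor g))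
  {φ : J × S → ℝ} (hφ : ContMDiff (𝓘(ℝ, ℝ).prod I) 𝓘(ℝ, ℝ) ∞ φ)
  (F : DiffForm (𝓘(ℝ, ℝ).prod I) (J × S) 3) (τ : J) (x : S)

section Metric

include hg

lemma gramInv_cyl : gramInv (cylBasisOf e) (metricTensor g) (τ, x)
    = Matrix.fromBlocks 1 0 0 (gramInv e (sliceTensor (metricTensor g) τ) x) := by
  have hx := isMetricRepresentedBy_slice e hg τ x
  rw [gramInv_eq, extChartAt_cyl_apply, chartGram_cyl e hg τ x (mem_cylTarget_self τ x),
    hx.isMetricOn.cylGram_inv (mem_cylTarget_self τ x), hx.gramInv]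

lemma metricTensor_cyl (i j : Unit ⊕ ι) :
    metricTensor g (τ, x) ![cylBasisOf e i, cylBasisOf e j]
      = Matrix.fromBlocks 1 0 0
        (Matrix.of fun i j => sliceTensor (metricTensor g) τ x ![e i, e j]) i j := by
  have h := chartGram_self (cylBasisOf e) (metricTensor g) (τ, x)
  rw [extChartAt_cyl_apply, chartGram_cyl e hg τ x (mem_cylTarget_self τ x)] at h
  have hx := (isMetricRepresentedBy_slice e hg τ x).apply_self τ
  simp only [hx]
  exact (congrFun (congrFun h i) j).symm

lemma ricci_cyl (i j : Unit ⊕ ι) :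
    ricci (cylBasisOf e) (metricTensor g) (τ, x) i j
      = ricciOf (cylDir (1, 0) (fun i => ((0, e i) : ℝ × E))) (cylGram (sliceGram e g (τ, x))) i j
        ((τ : ℝ), extChartAt I x x) := by
  rw [ricci_eq_ricciOf, extChartAt_cyl_apply, coe_cylBasisOf]
  exact ricciOf_congr (isOpen_cylTarget x) (mem_cylTarget_self τ x)
    (fun u hu => chartGram_cyl e hg τ x hu) _ i j

lemma ricci_cyl_space (i j : ι) :
    ricci (cylBasisOf e) (metricTensor g) (τ, x) (.inr i) (.inr j)
      = ricci e (sliceTensor (metricTensor g) τ) x i j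
        - 1 / 2 * dotTensor (dotTensor (sliceTensor (metricTensor g))) τ x ![e i, e j]
        - 1 / 4 * traceG e (sliceTensor (metricTensor g) τ)
          (dotTensor (sliceTensor (metricTensor g)) τ) x
          * dotTensor (sliceTensor (metricTensor g)) τ x ![e i, e j]
        + 1 / 2 * circ e (sliceTensor (metricTensor g) τ)
          (dotTensor (sliceTensor (metricTensor g)) τ)
          (dotTensor (sliceTensor (metricTensor g)) τ) x (e i) (e j) := by
  have hx := isMetricRepresentedBy_slice e hg τ x
  rw [ricci_cyl e hg, hx.isMetricOn.ricciOf_cylGram_space (mem_cylTarget_self τ x), hx.ricci,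
    hx.traceG_dotTensor, hx.dotTensor_apply, hx.isRepresentedBy.dotTensor.dotTensor.apply_two,
    circ_basis, tensorInnerOf_one, hx.gramInv]
  simp only [hx.isRepresentedBy.dotTensor.apply_self]
  simp

lemma ricci_cyl_time :
    ricci (cylBasisOf e) (metricTensor g) (τ, x) (.inl ()) (.inl ())
      = 1 / 4 * tensorInner e (sliceTensor (metricTensor g) τ) x
          (dotTensor (sliceTensor (metricTensor g)) τ x)
          (dotTensor (sliceTensor (metricTensor g)) τ x)
        - 1 / 2 * ∑ i, ∑ j, gramInv e (sliceTensor (metricTensor g) τ) x i j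
          * dotTensor (dotTensor (sliceTensor (metricTensor g))) τ x ![e i, e j] := by
  have hx := isMetricRepresentedBy_slice e hg τ x
  rw [ricci_cyl e hg, hx.isMetricOn.ricciOf_cylGram_time (mem_cylTarget_self τ x),
    tensorInner_eq, hx.gramInv]
  simp only [hx.isRepresentedBy.dotTensor.apply_self,
    hx.isRepresentedBy.dotTensor.dotTensor.apply_two]
  rfl

lemma ricci_cyl_mixed (i : ι) :
    ricci (cylBasisOf e) (metricTensor g) (τ, x) (.inl ()) (.inr i)
      = - (1 / 2) * codiff e (sliceTensor (metricTensor g) τ)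
          (dotTensor (sliceTensor (metricTensor g)) τ) x ![i]
        - 1 / 2 * differential I (traceG e (sliceTensor (metricTensor g) τ)
          (dotTensor (sliceTensor (metricTensor g)) τ)) x ![e i] := by
  have hx := isMetricRepresentedBy_slice e hg τ x
  rw [ricci_cyl e hg, hx.isMetricOn.ricciOf_cylGram_mixed (mem_cylTarget_self τ x),
    differential_traceG e hg, hx.codiff hx.isRepresentedBy.dotTensor]

lemma ricci_cyl_mixed_symm (i : ι) :
    ricci (cylBasisOf e) (metricTensor g) (τ, x) (.inr i) (.inl ())
      = ricci (cylBasisOf e) (metricTensor g) (τ, x) (.inl ()) (.inr i) := by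
  have hx := isMetricRepresentedBy_slice e hg τ x
  rw [ricci_cyl e hg, ricci_cyl e hg,
    hx.isMetricOn.ricciOf_cylGram_inr_inl (mem_cylTarget_self τ x)]

/-- `Tr h = n`: this is how the dimension enters the Hamiltonian constraint. -/
lemma sum_gramInv_slice :
    ∑ i, ∑ j, gramInv e (sliceTensor (metricTensor g) τ) x i j
      * sliceTensor (metricTensor g) τ x ![e i, e j] = Fintype.card ι := by
  have hx := isMetricRepresentedBy_slice e hg τ x
  have hu := mem_cylTarget_self (I := I) τ x
  rw [hx.gramInv]
  simp only [hx.apply_self]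
  have : ∀ i, ∑ j, (sliceGram e g (τ, x) ((τ : ℝ), extChartAt I x x))⁻¹ i j
      * sliceGram e g (τ, x) ((τ : ℝ), extChartAt I x x) i j = 1 := by
    intro i
    have h := hx.isMetricOn.inv_mul_sum hu i i
    rw [if_pos rfl] at h
    rw [← h]
    exact Finset.sum_congr rfl fun j _ => by rw [hx.isMetricOn.symm _ hu i j]
  simp only [this]
  simp

end Metric

section Function

include hφ

omit [Fintype ι] [DecidableEq ι] in
lemma differential_cyl_time :
    differential (𝓘(ℝ, ℝ).prod I) φ (τ, x) ![cylBasisOf e (.inl ())]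
      = timeDeriv (fun t => φ (t, x)) τ := by
  have h := chartComp_self (cylBasisOf e) (differential (𝓘(ℝ, ℝ).prod I) φ) (τ, x) ![.inl ()]
  rw [extChartAt_cyl_apply, chartComp_differential_cyl e hφ τ x (mem_cylTarget_self τ x),
    coe_cylBasisOf, cylDir_inl, ← timeDeriv_chartFun hφ] at h
  rw [h]
  exact congrArg (differential (𝓘(ℝ, ℝ).prod I) φ (τ, x)) (funext fun s => by
    fin_cases s; exact congrFun (coe_cylBasisOf e) _)

omit [Fintype ι] [DecidableEq ι] in
lemma differential_cyl_space (i : ι) :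
    differential (𝓘(ℝ, ℝ).prod I) φ (τ, x) ![cylBasisOf e (.inr i)]
      = differential I (fun z => φ (τ, z)) x ![e i] := by
  have h := chartComp_self (cylBasisOf e) (differential (𝓘(ℝ, ℝ).prod I) φ) (τ, x) ![.inr i]
  rw [extChartAt_cyl_apply, chartComp_differential_cyl e hφ τ x (mem_cylTarget_self τ x),
    coe_cylBasisOf, cylDir_inr] at h
  have h2 := (isRepresentedBy_differential e hφ τ x).apply_self τ ![i]
  refine Eq.trans ?_ (h.symm.trans (h2.symm.trans ?_))
  · exact congrArg (differential (𝓘(ℝ, ℝ).prod I) φ (τ, x)) (funext fun s => by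
      fin_cases s; exact congrFun (coe_cylBasisOf e) _)
  · exact congrArg (differential I (fun z => φ (τ, z)) x) (funext fun s => by fin_cases s; rfl)

include hg

lemma codiff_differential_cyl :
    codiff (cylBasisOf e) (metricTensor g) (differential (𝓘(ℝ, ℝ).prod I) φ) (τ, x) ![]
      = - timeDeriv (timeDeriv (fun t => φ (t, x))) τ
        - 1 / 2 * timeDeriv (fun t => φ (t, x)) τ * traceG e (sliceTensor (metricTensor g) τ)
          (dotTensor (sliceTensor (metricTensor g)) τ) x
        + codiff e (sliceTensor (metricTensor g) τ)
          (differential I (fun z => φ (τ, z))) x ![] := by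
  have hx := isMetricRepresentedBy_slice e hg τ x
  have hu := mem_cylTarget_self (I := I) τ x
  have hd := isRepresentedBy_differential e hφ τ x
  rw [codiff_eq_codiffOf, extChartAt_cyl_apply, coe_cylBasisOf,
    codiffOf_congr (isOpen_cylTarget x) hu (fun u hu => chartGram_cyl e hg τ x hu) _
      (T' := fun u a => dirDeriv (cylBasisOf e (a 0)) (chartFun I φ (τ, x)) u),
    hx.isMetricOn.codiffOf_cylGram_one hu, hx.codiff hd, hx.traceG_dotTensor,
    timeDeriv_timeDeriv_chartFun hφ τ, timeDeriv_chartFun hφ τ, coe_cylBasisOf]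
  · rfl
  · intro u hu
    ext a
    have ha : a = ![a 0] := by ext s; fin_cases s; rfl
    rw [← chartComp_differential_cyl e hφ τ x hu, ← ha]

end Function

section Form

omit [Fintype ι] [DecidableEq ι] in
lemma form_self (a : Fin 3 → Unit ⊕ ι) :
    F.toField.toTensor (τ, x) (fun s => (cylBasisOf e (a s) : ℝ × E))
      = chartComp (cylBasisOf e) F.toField.toTensor (τ, x) ((τ : ℝ), extChartAt I x x) a := by
  rw [← extChartAt_cyl_apply]
  exact (chartComp_self (cylBasisOf e) F.toField.toTensor (τ, x) a).symm

include hg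

/-- The numerical weights of the full contractions become `|H|² = |ψ|² + |F|²` in the determinant
norms. -/
lemma formInner_cyl :
    formInner (cylBasisOf e) (metricTensor g) (τ, x) (F.toField.toTensor (τ, x))
        (F.toField.toTensor (τ, x))
      = formInner e (sliceTensor (metricTensor g) τ) x
          ((sliceContraction F.toField τ).toTensor x) ((sliceContraction F.toField τ).toTensor x)
        + formInner e (sliceTensor (metricTensor g) τ) x
          ((sliceForm F.toField τ).toTensor x) ((sliceForm F.toField τ).toTensor x) := by
  unfold formInner
  rw [tensorInner_eq, tensorInner_eq, tensorInner_eq, gramInv_cyl e hg]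
  simp only [form_self, (isRepresentedBy_sliceForm e F τ x).apply_self τ,
    (isRepresentedBy_sliceContraction e F τ x).apply_self τ]
  rw [(isSplit_chartComp e F.toField (τ, x)).tensorInnerOf_self]
  simp [Nat.factorial]
  ring

lemma circ_cyl_time :
    circ (cylBasisOf e) (metricTensor g) F.toField.toTensor F.toField.toTensor (τ, x)
        (cylBasisOf e (.inl ())) (cylBasisOf e (.inl ()))
      = formInner e (sliceTensor (metricTensor g) τ) x
          ((sliceContraction F.toField τ).toTensor x)
          ((sliceContraction F.toField τ).toTensor x) := by
  rw [circ_basis, gramInv_cyl e hg]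
  unfold formInner
  rw [tensorInner_eq]
  simp only [form_self, (isRepresentedBy_sliceContraction e F τ x).apply_self τ]
  rw [(isSplit_chartComp e F.toField (τ, x)).tensorInnerOf_inl_inl]

lemma circ_cyl_mixed (i : ι) :
    circ (cylBasisOf e) (metricTensor g) F.toField.toTensor F.toField.toTensor (τ, x)
        (cylBasisOf e (.inl ())) (cylBasisOf e (.inr i))
      = formInner e (sliceTensor (metricTensor g) τ) x
          ((sliceContraction F.toField τ).toTensor x)
          (insert (sliceForm F.toField τ).toTensor x (e i)) := by
  rw [circ_basis, gramInv_cyl e hg]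
  unfold formInner
  rw [tensorInner_eq]
  simp only [insert_basis, form_self, (isRepresentedBy_sliceForm e F τ x).apply_self τ,
    (isRepresentedBy_sliceContraction e F τ x).apply_self τ]
  rw [(isSplit_chartComp e F.toField (τ, x)).tensorInnerOf_inl_inr]

lemma circ_cyl_space (i j : ι) :
    circ (cylBasisOf e) (metricTensor g) F.toField.toTensor F.toField.toTensor (τ, x)
        (cylBasisOf e (.inr i)) (cylBasisOf e (.inr j))
      = circ e (sliceTensor (metricTensor g) τ) (sliceContraction F.toField τ).toTensor
          (sliceContraction F.toField τ).toTensor x (e i) (e j)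
        + circ e (sliceTensor (metricTensor g) τ) (sliceForm F.toField τ).toTensor
          (sliceForm F.toField τ).toTensor x (e i) (e j) := by
  rw [circ_basis, circ_basis, circ_basis, gramInv_cyl e hg]
  simp only [form_self, (isRepresentedBy_sliceForm e F τ x).apply_self τ,
    (isRepresentedBy_sliceContraction e F τ x).apply_self τ]
  rw [(isSplit_chartComp e F.toField (τ, x)).tensorInnerOf_inr_inr]
  simp [Nat.factorial]
  ring

lemma codiff_cyl (i j : Unit ⊕ ι) :
    codiff (cylBasisOf e) (metricTensor g) F.toField.toTensor (τ, x) ![i, j]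
      = codiffOf (cylDir (1, 0) (fun i => ((0, e i) : ℝ × E))) (cylGram (sliceGram e g (τ, x)))
        (fun u a => chartComp (cylBasisOf e) F.toField.toTensor (τ, x) u a) ![i, j]
        ((τ : ℝ), extChartAt I x x) := by
  rw [codiff_eq_codiffOf, extChartAt_cyl_apply, coe_cylBasisOf]
  exact codiffOf_congr (isOpen_cylTarget x) (mem_cylTarget_self τ x)
    (fun u hu => chartGram_cyl e hg τ x hu) _ (fun _ _ => rfl) _

lemma codiff_cyl_space (i j : ι) :
    codiff (cylBasisOf e) (metricTensor g) F.toField.toTensor (τ, x) ![.inr i, .inr j]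
      = - dotTensor (fun t => (sliceContraction F.toField t).toTensor) τ x ![e i, e j]
        + codiff e (sliceTensor (metricTensor g) τ) (sliceForm F.toField τ).toTensor x ![i, j]
        + delta1 e (sliceTensor (metricTensor g) τ) (dotTensor (sliceTensor (metricTensor g)) τ)
          (sliceContraction F.toField τ).toTensor x (e i) (e j)
        - 1 / 2 * traceG e (sliceTensor (metricTensor g) τ)
          (dotTensor (sliceTensor (metricTensor g)) τ) x
          * (sliceContraction F.toField τ).toTensor x ![e i, e j] := by
  have hx := isMetricRepresentedBy_slice e hg τ x
  have hF := isRepresentedBy_sliceForm e F τ x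
  have hψ := isRepresentedBy_sliceContraction e F τ x
  rw [codiff_cyl e hg, hx.isMetricOn.codiffOf_cylGram_inr_inr (mem_cylTarget_self τ x) _ _
    (isSplit_chartComp e F.toField (τ, x)), hψ.dotTensor.apply_two, hx.codiff hF,
    hx.traceG_dotTensor, hψ.apply_two]
  unfold delta1
  rw [hx.gramInv]
  simp only [hx.dotTensor_apply, hψ.apply_two]

lemma codiff_cyl_mixed (j : ι) :
    codiff (cylBasisOf e) (metricTensor g) F.toField.toTensor (τ, x) ![.inl (), .inr j]
      = - codiff e (sliceTensor (metricTensor g) τ) (sliceContraction F.toField τ).toTensor x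
        ![j] := by
  have hx := isMetricRepresentedBy_slice e hg τ x
  rw [codiff_cyl e hg, hx.isMetricOn.codiffOf_cylGram_inl_inr (mem_cylTarget_self τ x) _ _
    (isSplit_chartComp e F.toField (τ, x)), hx.codiff (isRepresentedBy_sliceContraction e F τ x)]

lemma codiff_cyl_swap (i j : Unit ⊕ ι) :
    codiff (cylBasisOf e) (metricTensor g) F.toField.toTensor (τ, x) ![i, j]
      = - codiff (cylBasisOf e) (metricTensor g) F.toField.toTensor (τ, x) ![j, i] := by
  rw [codiff_cyl e hg, codiff_cyl e hg]
  exact codiffOf_three_swap (isSplit_chartComp e F.toField (τ, x)).swap₂ i j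

end Form

end Reduction

section Products

variable {E : Type*} [NormedAddCommGroup E] [NormedSpace ℝ E]
  {H : Type*} [TopologicalSpace H] {I : ModelWithCorners ℝ E H}
  {M : Type*} [TopologicalSpace M] [ChartedSpace H M]
  {κ : Type*} [Fintype κ] [DecidableEq κ] (e : Module.Basis κ ℝ E) (g : CovTensor I M 2) (x : M)

lemma formInner_one (S T : (Fin 1 → TangentSpace I x) → ℝ) :
    formInner e g x S T = ∑ i, ∑ j, gramInv e g x i j * (S ![e i] * T ![e j]) := by
  have h : ∀ (S : (Fin 1 → TangentSpace I x) → ℝ) (i : κ),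
      S (fun s => (e ((![i] : Fin 1 → κ) s) : E)) = S ![e i] := fun S i =>
    congrArg S (funext fun s => by fin_cases s; rfl)
  unfold formInner
  rw [tensorInner_eq, tensorInnerOf_one]
  simp only [h, Nat.factorial_one, Nat.cast_one, div_one]

omit [DecidableEq κ] in
lemma tensorInnerOf_comm {A : Matrix κ κ ℝ} (hA : ∀ i j, A i j = A j i) {k : ℕ}
    (S T : (Fin k → κ) → ℝ) : tensorInnerOf A S T = tensorInnerOf A T S := by
  unfold tensorInnerOf
  rw [Finset.sum_comm]
  refine Finset.sum_congr rfl fun a _ => Finset.sum_congr rfl fun b _ => ?_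
  rw [Finset.prod_congr rfl fun s _ => hA (b s) (a s)]
  ring

end Products

section Reduction

variable {J : Opens ℝ}
  {E : Type*} [NormedAddCommGroup E] [NormedSpace ℝ E]
  {H : Type*} [TopologicalSpace H] {I : ModelWithCorners ℝ E H} [I.Boundaryless]
  {S : Type*} [TopologicalSpace S] [ChartedSpace H S] [IsManifold I ∞ S]
  {ι : Type*} [Fintype ι] [DecidableEq ι] (e : Module.Basis ι ℝ E)
  {g : Bundle.ContMDiffRiemannianMetric (𝓘(ℝ, ℝ).prod I) ∞ (ℝ × E)
    (fun p : J × S => TangentSpace (𝓘(ℝ, ℝ).prod I) p)}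
  (hg : IsCylindrical (metricTensor g))
  {φ : J × S → ℝ} (hφ : ContMDiff (𝓘(ℝ, ℝ).prod I) 𝓘(ℝ, ℝ) ∞ φ)
  (F : DiffForm (𝓘(ℝ, ℝ).prod I) (J × S) 3) (τ : J) (x : S)

omit [Fintype ι] [DecidableEq ι] in
lemma form_self_three (i j k : Unit ⊕ ι) :
    F.toField.toTensor (τ, x) ![cylBasisOf e i, cylBasisOf e j, cylBasisOf e k]
      = chartComp (cylBasisOf e) F.toField.toTensor (τ, x) ((τ : ℝ), extChartAt I x x)
        ![i, j, k] := by
  rw [← form_self]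
  exact congrArg (F.toField.toTensor (τ, x)) (funext fun s => by fin_cases s <;> rfl)

omit [Fintype ι] [DecidableEq ι] in
lemma sliceForm_self_three (i j k : ι) :
    (sliceForm F.toField τ).toTensor x ![e i, e j, e k]
      = chartComp (cylBasisOf e) F.toField.toTensor (τ, x) ((τ : ℝ), extChartAt I x x)
        ![.inr i, .inr j, .inr k] := by
  rw [← (isSplit_chartComp e F.toField (τ, x)).space,
    ← (isRepresentedBy_sliceForm e F τ x).apply_self τ]
  exact congrArg ((sliceForm F.toField τ).toTensor x) (funext fun s => by fin_cases s <;> rfl)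

omit [Fintype ι] [DecidableEq ι] in
lemma sliceContraction_self_two (i j : ι) :
    (sliceContraction F.toField τ).toTensor x ![e i, e j]
      = chartComp (cylBasisOf e) F.toField.toTensor (τ, x) ((τ : ℝ), extChartAt I x x)
        ![.inl (), .inr i, .inr j] := by
  rw [← (isSplit_chartComp e F.toField (τ, x)).time,
    ← (isRepresentedBy_sliceContraction e F τ x).apply_self τ]
  exact congrArg ((sliceContraction F.toField τ).toTensor x)
    (funext fun s => by fin_cases s <;> rfl)

lemma form_gradient_swap (i j : Unit ⊕ ι) (G : CovTensor (𝓘(ℝ, ℝ).prod I) (J × S) 2) :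
    F.toField.toTensor (τ, x)
        ![gradient (cylBasisOf e) G φ (τ, x), cylBasisOf e i, cylBasisOf e j]
      = - F.toField.toTensor (τ, x)
        ![gradient (cylBasisOf e) G φ (τ, x), cylBasisOf e j, cylBasisOf e i] := by
  rw [toTensor_gradient, toTensor_gradient, ← Finset.sum_neg_distrib]
  refine Finset.sum_congr rfl fun k _ => ?_
  rw [← Finset.sum_neg_distrib]
  refine Finset.sum_congr rfl fun l _ => ?_
  rw [form_self_three, form_self_three, (isSplit_chartComp e F.toField (τ, x)).swap₂, mul_neg]

section Metric

include hg

lemma circ_cyl_mixed_symm (i : ι) :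
    circ (cylBasisOf e) (metricTensor g) F.toField.toTensor F.toField.toTensor (τ, x)
        (cylBasisOf e (.inr i)) (cylBasisOf e (.inl ()))
      = circ (cylBasisOf e) (metricTensor g) F.toField.toTensor F.toField.toTensor (τ, x)
        (cylBasisOf e (.inl ())) (cylBasisOf e (.inr i)) := by
  have hx := isMetricRepresentedBy_slice e hg τ x
  have hA : ∀ i j, gramInv (cylBasisOf e) (metricTensor g) (τ, x) i j
      = gramInv (cylBasisOf e) (metricTensor g) (τ, x) j i := by
    rw [gramInv_cyl e hg, hx.gramInv]
    rintro (i | i) (j | j)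
    · rfl
    · rfl
    · rfl
    · exact hx.isMetricOn.inv_symm (mem_cylTarget_self τ x) i j
  rw [circ_basis, circ_basis, tensorInnerOf_comm hA]

include hφ

lemma form_gradient_space (i j : ι) :
    F.toField.toTensor (τ, x) ![gradient (cylBasisOf e) (metricTensor g) φ (τ, x),
        cylBasisOf e (.inr i), cylBasisOf e (.inr j)]
      = timeDeriv (fun t => φ (t, x)) τ * (sliceContraction F.toField τ).toTensor x ![e i, e j]
        + (sliceForm F.toField τ).toTensor x
          ![gradient e (sliceTensor (metricTensor g) τ) (fun z => φ (τ, z)) x, e i, e j] := by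
  rw [toTensor_gradient, toTensor_gradient]
  simp [Fintype.sum_sum_type, gramInv_cyl e hg, differential_cyl_time e hφ, sliceForm_self_three,
    differential_cyl_space e hφ, form_self_three, sliceContraction_self_two]

/-- The time part of the gradient meets a repeated time index and drops out, so `∂_τ φ` is absent
from the Gauss constraint. The sign is that of exchanging the first two slots. -/
lemma form_gradient_mixed (j : ι) :
    F.toField.toTensor (τ, x) ![gradient (cylBasisOf e) (metricTensor g) φ (τ, x),
        cylBasisOf e (.inl ()), cylBasisOf e (.inr j)]
      = - (sliceContraction F.toField τ).toTensor x
          ![gradient e (sliceTensor (metricTensor g) τ) (fun z => φ (τ, z)) x, e j] := by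
  have hs := isSplit_chartComp e F.toField (τ, x)
  rw [toTensor_gradient, toTensor_gradient]
  simp [Fintype.sum_sum_type, gramInv_cyl e hg, differential_cyl_time e hφ, hs.inl_inl,
    differential_cyl_space e hφ, form_self_three, sliceContraction_self_two, hs.inr_inl_inr,
    ← hs.time]

end Metric

end Reduction

/-! ### Equivalence of the field equations with the reduced system. -/

section Reduction

variable {J : Opens ℝ}
  {E : Type*} [NormedAddCommGroup E] [NormedSpace ℝ E]
  {H : Type*} [TopologicalSpace H] {I : ModelWithCorners ℝ E H} [I.Boundaryless]
  {S : Type*} [TopologicalSpace S] [ChartedSpace H S] [IsManifold I ∞ S]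
  {ι : Type*} [Fintype ι] [DecidableEq ι] (e : Module.Basis ι ℝ E)
  {g : Bundle.ContMDiffRiemannianMetric (𝓘(ℝ, ℝ).prod I) ∞ (ℝ × E)
    (fun p : J × S => TangentSpace (𝓘(ℝ, ℝ).prod I) p)}
  (hg : IsCylindrical (metricTensor g))
  {φ : J × S → ℝ} (hφ : ContMDiff (𝓘(ℝ, ℝ).prod I) 𝓘(ℝ, ℝ) ∞ φ)
  (F : DiffForm (𝓘(ℝ, ℝ).prod I) (J × S) 3) {lam : ℝ}

include hg in
/-- The trace of the evolution equation of the metric. -/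
lemma EvolutionEquations.trace_metric {n : ℕ} {ψ : J → CovTensor I S 2} {F : J → CovTensor I S 3}
    {φ : J → S → ℝ}
    (hev : EvolutionEquations e n lam (sliceTensor (metricTensor g)) ψ F φ) (τ : J) (x : S) :
    ∑ i, ∑ j, gramInv e (sliceTensor (metricTensor g) τ) x i j
        * dotTensor (dotTensor (sliceTensor (metricTensor g))) τ x ![e i, e j]
      = 2 * scalarCurvature e (sliceTensor (metricTensor g) τ) x
        + tensorInner e (sliceTensor (metricTensor g) τ) x
          (dotTensor (sliceTensor (metricTensor g)) τ x)
          (dotTensor (sliceTensor (metricTensor g)) τ x)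
        - 1 / 2 * traceG e (sliceTensor (metricTensor g) τ)
          (dotTensor (sliceTensor (metricTensor g)) τ) x ^ 2
        - 2 / (n - 1 : ℝ) * formInner e (sliceTensor (metricTensor g) τ) x
          (differential I (φ τ) x) (differential I (φ τ) x)
        + 2 / (n - 1 : ℝ) * (Real.exp (-(4 * φ τ x) / (n - 1)) *
          (formInner e (sliceTensor (metricTensor g) τ) x (ψ τ x) (ψ τ x)
            + formInner e (sliceTensor (metricTensor g) τ) x (F τ x) (F τ x))
          + lam * Real.exp (2 * φ τ x / (n - 1))) * Fintype.card ι
        - Real.exp (-(4 * φ τ x) / (n - 1)) *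
          (2 * formInner e (sliceTensor (metricTensor g) τ) x (ψ τ x) (ψ τ x)
            + 3 * formInner e (sliceTensor (metricTensor g) τ) x (F τ x) (F τ x)) := by
  have hh := sum_circ_basis e (sliceTensor (metricTensor g) τ) x
    (dotTensor (sliceTensor (metricTensor g)) τ)
  have hψ := sum_circ_basis e (sliceTensor (metricTensor g) τ) x (ψ τ)
  have hF := sum_circ_basis e (sliceTensor (metricTensor g) τ) x (F τ)
  have hh' : tensorInner e (sliceTensor (metricTensor g) τ) x
      (dotTensor (sliceTensor (metricTensor g)) τ x) (dotTensor (sliceTensor (metricTensor g)) τ x)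
      = 2 * formInner e (sliceTensor (metricTensor g) τ) x
        (dotTensor (sliceTensor (metricTensor g)) τ x)
        (dotTensor (sliceTensor (metricTensor g)) τ x) := by
    simp only [formInner, Nat.factorial_two, Nat.cast_ofNat]
    ring
  rw [← sum_gramInv_slice e hg τ x, formInner_one, hh', sq]
  push_cast at hh hψ hF
  norm_num at hh hψ hF
  rw [← hh, ← hψ, ← hF]
  rw [scalarCurvature, traceG]
  simp only [hev.metric, Finset.mul_sum, ← Finset.sum_add_distrib, ← Finset.sum_sub_distrib]
  refine Finset.sum_congr rfl fun i _ => Finset.sum_congr rfl fun j _ => ?_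
  simp only [traceG]
  ring

include hg hφ

/-- All components but one match their reduced equation up to a factor `-1` or `-2`. The time-time
Einstein equation becomes the Hamiltonian constraint only after `∂_τ²h` is eliminated, so the
evolution equations must be available first in both directions. -/
theorem nsnsEquations_cyl_iff (hn : 2 ≤ Fintype.card ι) :
    NSNSEquations (cylBasisOf e) (Fintype.card ι) lam (metricTensor g) F.toField.toTensor φ ↔
      EvolutionEquations e (Fintype.card ι) lam (sliceTensor (metricTensor g))
        (fun τ => (sliceContraction F.toField τ).toTensor)
        (fun τ => (sliceForm F.toField τ).toTensor) (fun τ x => φ (τ, x)) ∧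
      ConstraintEquations e (Fintype.card ι) lam (sliceTensor (metricTensor g))
        (fun τ => (sliceContraction F.toField τ).toTensor)
        (fun τ => (sliceForm F.toField τ).toTensor) (fun τ x => φ (τ, x)) := by
  have hn1 : (Fintype.card ι : ℝ) - 1 ≠ 0 := by
    have : (2 : ℝ) ≤ Fintype.card ι := by exact_mod_cast hn
    linarith
  -- The traced evolution equation carries `n / (n - 1)` and the Einstein equation `1 / (n - 1)`;
  -- their difference is `1`, the coefficient left in the Hamiltonian constraint.
  have hc : 1 / ((Fintype.card ι : ℝ) - 1) * Fintype.card ι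
      = 1 + 1 / ((Fintype.card ι : ℝ) - 1) := by
    field_simp
    ring
  constructor
  · rintro ⟨hE, hM, hD⟩
    have hev : EvolutionEquations e (Fintype.card ι) lam (sliceTensor (metricTensor g))
        (fun τ => (sliceContraction F.toField τ).toTensor)
        (fun τ => (sliceForm F.toField τ).toTensor) (fun τ x => φ (τ, x)) := by
      refine ⟨fun τ x i j => ?_, fun τ x i j => ?_, fun τ x => ?_⟩
      · have h := hE (τ, x) (.inr i) (.inr j)
        simp only [ricci_cyl_space e hg, differential_cyl_space e hφ, formInner_cyl e hg,
          circ_cyl_space e hg, metricTensor_cyl e hg, Matrix.fromBlocks_apply₂₂,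
          Matrix.of_apply] at h
        linear_combination (-2) * h
      · have h := hM (τ, x) (.inr i) (.inr j)
        simp only [codiff_cyl_space e hg, form_gradient_space e hg hφ] at h
        linear_combination (-1) * h
      · have h := hD (τ, x)
        simp only [codiff_differential_cyl e hg hφ, formInner_cyl e hg] at h
        linear_combination (-1) * h
    refine ⟨hev, fun τ x => ?_, fun τ x i => ?_, fun τ x i => ?_⟩
    · have h := hE (τ, x) (.inl ()) (.inl ())
      simp only [ricci_cyl_time e hg, differential_cyl_time e hφ, formInner_cyl e hg,
        circ_cyl_time e hg, metricTensor_cyl e hg, Matrix.fromBlocks_apply₁₁, Matrix.one_apply_eq,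
        hev.trace_metric e hg] at h
      linear_combination (-1) * h - (Real.exp (-(4 * φ (τ, x)) / (Fintype.card ι - 1)) *
          (formInner e (sliceTensor (metricTensor g) τ) x
            ((sliceContraction F.toField τ).toTensor x) ((sliceContraction F.toField τ).toTensor x)
            + formInner e (sliceTensor (metricTensor g) τ) x
            ((sliceForm F.toField τ).toTensor x) ((sliceForm F.toField τ).toTensor x))
          + lam * Real.exp (2 * φ (τ, x) / (Fintype.card ι - 1))) * hc
    · have h := hE (τ, x) (.inl ()) (.inr i)
      simp only [ricci_cyl_mixed e hg, differential_cyl_time e hφ, differential_cyl_space e hφ,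
        circ_cyl_mixed e hg, metricTensor_cyl e hg, Matrix.fromBlocks_apply₁₂,
        Matrix.zero_apply] at h
      linear_combination (-2) * h
    · have h := hM (τ, x) (.inl ()) (.inr i)
      simp only [codiff_cyl_mixed e hg, form_gradient_mixed e hg hφ] at h
      linear_combination (-1) * h
  · rintro ⟨hev, hH, hP, hG⟩
    have hmix : ∀ τ x i,
        ricci (cylBasisOf e) (metricTensor g) (τ, x) (.inl ()) (.inr i)
          - 1 / ((Fintype.card ι : ℝ) - 1) * (timeDeriv (fun t => φ (t, x)) τ
            * differential I (fun z => φ (τ, z)) x ![e i])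
          - 1 / 2 * Real.exp (-(4 * φ (τ, x)) / (Fintype.card ι - 1))
            * circ (cylBasisOf e) (metricTensor g) F.toField.toTensor F.toField.toTensor (τ, x)
              (cylBasisOf e (.inl ())) (cylBasisOf e (.inr i)) = 0 := by
      intro τ x i
      have h := hP τ x i
      rw [ricci_cyl_mixed e hg, circ_cyl_mixed e hg]
      linear_combination (-1 / 2) * h
    refine ⟨?_, ?_, ?_⟩
    · rintro ⟨τ, x⟩ (⟨⟩ | i) (⟨⟩ | j)
      · have h := hH τ x
        simp only [ricci_cyl_time e hg, differential_cyl_time e hφ, formInner_cyl e hg,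
          circ_cyl_time e hg, metricTensor_cyl e hg, Matrix.fromBlocks_apply₁₁,
          Matrix.one_apply_eq, hev.trace_metric e hg]
        linear_combination (-1) * h - (Real.exp (-(4 * φ (τ, x)) / (Fintype.card ι - 1)) *
          (formInner e (sliceTensor (metricTensor g) τ) x
            ((sliceContraction F.toField τ).toTensor x) ((sliceContraction F.toField τ).toTensor x)
            + formInner e (sliceTensor (metricTensor g) τ) x
            ((sliceForm F.toField τ).toTensor x) ((sliceForm F.toField τ).toTensor x))
          + lam * Real.exp (2 * φ (τ, x) / (Fintype.card ι - 1))) * hc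
      · have h := hmix τ x j
        simp only [differential_cyl_time e hφ, differential_cyl_space e hφ,
          metricTensor_cyl e hg, Matrix.fromBlocks_apply₁₂, Matrix.zero_apply]
        linear_combination h
      · have h := hmix τ x i
        simp only [ricci_cyl_mixed_symm e hg, differential_cyl_time e hφ,
          differential_cyl_space e hφ, circ_cyl_mixed_symm e hg,
          metricTensor_cyl e hg, Matrix.fromBlocks_apply₂₁, Matrix.zero_apply]
        linear_combination h
      · have h := hev.metric τ x i j
        simp only [ricci_cyl_space e hg, differential_cyl_space e hφ, formInner_cyl e hg,
          circ_cyl_space e hg, metricTensor_cyl e hg, Matrix.fromBlocks_apply₂₂,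
          Matrix.of_apply]
        linear_combination (-1 / 2) * h
    · have hswap : ∀ p i j, codiff (cylBasisOf e) (metricTensor g) F.toField.toTensor p ![i, j]
            + 4 / ((Fintype.card ι : ℝ) - 1) * F.toField.toTensor p
              ![gradient (cylBasisOf e) (metricTensor g) φ p, cylBasisOf e i, cylBasisOf e j]
          = - (codiff (cylBasisOf e) (metricTensor g) F.toField.toTensor p ![j, i]
            + 4 / ((Fintype.card ι : ℝ) - 1) * F.toField.toTensor p
              ![gradient (cylBasisOf e) (metricTensor g) φ p, cylBasisOf e j, cylBasisOf e i]) := by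
        rintro ⟨τ, x⟩ i j
        rw [codiff_cyl_swap e hg, form_gradient_swap]
        ring
      have hmixed : ∀ τ x i, codiff (cylBasisOf e) (metricTensor g) F.toField.toTensor (τ, x)
              ![.inl (), .inr i]
            + 4 / ((Fintype.card ι : ℝ) - 1) * F.toField.toTensor (τ, x)
              ![gradient (cylBasisOf e) (metricTensor g) φ (τ, x), cylBasisOf e (.inl ()),
                cylBasisOf e (.inr i)] = 0 := by
        intro τ x i
        have h := hG τ x i
        rw [codiff_cyl_mixed e hg, form_gradient_mixed e hg hφ]
        linear_combination (-1) * h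
      rintro ⟨τ, x⟩ (⟨⟩ | i) (⟨⟩ | j)
      -- The time-time Maxwell component equals its own negative.
      · linarith [hswap (τ, x) (.inl ()) (.inl ())]
      · exact hmixed τ x j
      · rw [hswap, hmixed, neg_zero]
      · have h := hev.twoForm τ x i j
        rw [codiff_cyl_space e hg, form_gradient_space e hg hφ]
        linear_combination (-1) * h
    · rintro ⟨τ, x⟩
      have h := hev.dilaton τ x
      simp only [codiff_differential_cyl e hg hφ, formInner_cyl e hg]
      linear_combination (-1) * h

end Reduction

/-! ### Alternating forms on `ℝ × E` -/

section ProductForms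

variable {E : Type*} [NormedAddCommGroup E] [NormedSpace ℝ E]
  {E' : Type*} [NormedAddCommGroup E'] [NormedSpace ℝ E']

/-- The restriction of a form on `ℝ × E` to `E`. -/
def spacePart (E : Type*) [NormedAddCommGroup E] [NormedSpace ℝ E] (k : ℕ) :
    ((ℝ × E) [⋀^Fin k]→L[ℝ] ℝ) →L[ℝ] E [⋀^Fin k]→L[ℝ] ℝ :=
  ContinuousAlternatingMap.compContinuousLinearMapCLM (ContinuousLinearMap.inr ℝ ℝ E)

/-- The restriction to `E` of the contraction of a form on `ℝ × E` with `(1, 0)`. -/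
def timePart (E : Type*) [NormedAddCommGroup E] [NormedSpace ℝ E] (k : ℕ) :
    ((ℝ × E) [⋀^Fin (k + 1)]→L[ℝ] ℝ) →L[ℝ] E [⋀^Fin k]→L[ℝ] ℝ :=
  spacePart E k ∘L ContinuousLinearMap.apply ℝ _ ((1, 0) : ℝ × E) ∘L
    (ContinuousAlternatingMap.curryLeftLI (𝕜 := ℝ) (E := ℝ × E) (F := ℝ)
      (n := k)).toContinuousLinearMap

lemma spacePart_apply {k : ℕ} (α : (ℝ × E) [⋀^Fin k]→L[ℝ] ℝ) (v : Fin k → E) :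
    spacePart E k α v = α (fun s => (0, v s)) := rfl

lemma timePart_apply {k : ℕ} (α : (ℝ × E) [⋀^Fin (k + 1)]→L[ℝ] ℝ) (v : Fin k → E) :
    timePart E k α v = α (Matrix.vecCons (1, 0) (fun s => (0, v s))) := rfl

/-- Split the first argument into its time and space parts. The time part is killed by `h₀`, and
inserting the space part leaves a form of lower degree with the same two properties. -/
lemma form_eq_zero_of_forall {k : ℕ} (η : (ℝ × E) [⋀^Fin k]→L[ℝ] ℝ)
    (h₀ : ∀ v, (∃ s, v s = (1, 0)) → η v = 0) (h₁ : spacePart E k η = 0) : η = 0 := by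
  induction k with
  | zero =>
    ext v
    have h := DFunLike.congr_fun h₁ (fun s => (v s).2)
    rw [spacePart_apply] at h
    rw [Subsingleton.elim v (fun s => (0, (v s).2)), h]
    rfl
  | succ k ih =>
    have hw : ∀ w : E, η.curryLeft (0, w) = 0 := by
      intro w
      refine ih _ (fun v ⟨s, hs⟩ => h₀ _ ⟨s.succ, hs⟩) ?_
      ext v
      have h := DFunLike.congr_fun h₁ (Matrix.vecCons w v)
      rw [spacePart_apply] at h
      refine Eq.trans ?_ h
      exact congrArg η (funext fun s => Fin.cases rfl (fun s => rfl) s)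
    ext v
    have hv : v 0 = (v 0).1 • ((1, 0) : ℝ × E) + (0, (v 0).2) := by ext <;> simp
    rw [← Matrix.cons_head_tail v, Matrix.vecHead, hv, η.vecCons_add, η.vecCons_smul,
      h₀ _ ⟨0, rfl⟩, smul_zero, zero_add]
    exact DFunLike.congr_fun (hw (v 0).2) (Matrix.vecTail v)

lemma form_ext {k : ℕ} {α α' : (ℝ × E) [⋀^Fin (k + 1)]→L[ℝ] ℝ}
    (ht : timePart E k α = timePart E k α') (hs : spacePart E (k + 1) α = spacePart E (k + 1) α') :
    α = α' := by
  rw [← sub_eq_zero] at ht hs ⊢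
  rw [← map_sub] at ht hs
  generalize α - α' = η at ht hs ⊢
  have hc : η.curryLeft (1, 0) = 0 := by
    refine form_eq_zero_of_forall _ (fun v ⟨s, hv⟩ => ?_) ht
    exact η.map_eq_zero_of_eq _ (i := 0) (j := s.succ) hv.symm (Fin.succ_ne_zero s).symm
  refine form_eq_zero_of_forall _ (fun v ⟨s, hv⟩ => ?_) hs
  -- The time part only controls the first slot; a transposition brings a time vector from any other
  -- slot there.
  have h0 : ∀ v : Fin (k + 1) → ℝ × E, v 0 = (1, 0) → η v = 0 := by
    intro v hv
    rw [← Matrix.cons_head_tail v, Matrix.vecHead, hv]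
    exact DFunLike.congr_fun hc (Matrix.vecTail v)
  rcases eq_or_ne s 0 with rfl | hs0
  · exact h0 v hv
  · have h := η.toAlternatingMap.map_swap v hs0
    have h' := h0 (v ∘ Equiv.swap s 0) (by simp [hv])
    have h'' : η v = - η (v ∘ Equiv.swap s 0) := by
      rw [eq_neg_iff_add_eq_zero, add_comm, ← eq_neg_iff_add_eq_zero]
      exact h
    rw [h'', h', neg_zero]

lemma spacePart_comp {k : ℕ} (α : (ℝ × E') [⋀^Fin k]→L[ℝ] ℝ) (L : E →L[ℝ] E') :
    spacePart E k (α.compContinuousLinearMap ((ContinuousLinearMap.id ℝ ℝ).prodMap L))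
      = (spacePart E' k α).compContinuousLinearMap L := rfl

lemma timePart_comp {k : ℕ} (α : (ℝ × E') [⋀^Fin (k + 1)]→L[ℝ] ℝ) (L : E →L[ℝ] E') :
    timePart E k (α.compContinuousLinearMap ((ContinuousLinearMap.id ℝ ℝ).prodMap L))
      = (timePart E' k α).compContinuousLinearMap L := by
  ext v
  change α _ = α _
  congr 1
  ext1 s
  refine Fin.cases ?_ (fun s => ?_) s
  · exact Prod.ext rfl (map_zero L)
  · rfl

/-- The form `dt ∧ ψ + F` on `ℝ × E`. -/
def cylForm (E : Type*) [NormedAddCommGroup E] [NormedSpace ℝ E] (k : ℕ) :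
    (E [⋀^Fin k]→L[ℝ] ℝ) × (E [⋀^Fin (k + 1)]→L[ℝ] ℝ) →L[ℝ] (ℝ × E) [⋀^Fin (k + 1)]→L[ℝ] ℝ :=
  (ContinuousAlternatingMap.alternatizeUncurryFinCLM ℝ (ℝ × E) ℝ ∘L
    ContinuousLinearMap.smulRightL ℝ (ℝ × E) _ (ContinuousLinearMap.fst ℝ ℝ E) ∘L
    ContinuousAlternatingMap.compContinuousLinearMapCLM (ContinuousLinearMap.snd ℝ ℝ E)).coprod
  (ContinuousAlternatingMap.compContinuousLinearMapCLM (ContinuousLinearMap.snd ℝ ℝ E))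

/-- The alternatization of `dt ⊗ ψ` sums over the slot fed to `dt`, without a factorial, so
contraction with `(1, 0)` returns `ψ` itself. -/
lemma cylForm_apply {k : ℕ} (ψ : E [⋀^Fin k]→L[ℝ] ℝ) (F : E [⋀^Fin (k + 1)]→L[ℝ] ℝ)
    (v : Fin (k + 1) → ℝ × E) :
    cylForm E k (ψ, F) v
      = ∑ i : Fin (k + 1), (-1) ^ (i : ℕ) • ((v i).1 * ψ (fun s => (i.removeNth v s).2))
        + F (fun s => (v s).2) := by
  change ContinuousAlternatingMap.alternatizeUncurryFin _ v + F _ = _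
  rw [ContinuousAlternatingMap.alternatizeUncurryFin_apply]
  rfl

lemma timePart_cylForm {k : ℕ} (ψ : E [⋀^Fin k]→L[ℝ] ℝ) (F : E [⋀^Fin (k + 1)]→L[ℝ] ℝ) :
    timePart E k (cylForm E k (ψ, F)) = ψ := by
  ext v
  rw [timePart_apply, cylForm_apply, Fin.sum_univ_succ]
  have h : F (fun s => ((Matrix.vecCons ((1, 0) : ℝ × E) (fun s => (0, v s)) : _) s).2) = 0 :=
    F.map_coord_zero 0 rfl
  rw [h]
  simp

lemma spacePart_cylForm {k : ℕ} (ψ : E [⋀^Fin k]→L[ℝ] ℝ) (F : E [⋀^Fin (k + 1)]→L[ℝ] ℝ) :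
    spacePart E (k + 1) (cylForm E k (ψ, F)) = F := by
  ext v
  rw [spacePart_apply, cylForm_apply]
  simp

lemma cylForm_comp {k : ℕ} (ψ : E' [⋀^Fin k]→L[ℝ] ℝ) (F : E' [⋀^Fin (k + 1)]→L[ℝ] ℝ)
    (L : E →L[ℝ] E') :
    (cylForm E' k (ψ, F)).compContinuousLinearMap ((ContinuousLinearMap.id ℝ ℝ).prodMap L)
      = cylForm E k (ψ.compContinuousLinearMap L, F.compContinuousLinearMap L) := by
  apply form_ext
  · rw [timePart_comp, timePart_cylForm, timePart_cylForm]
  · rw [spacePart_comp, spacePart_cylForm, spacePart_cylForm]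

lemma differentiableAt_form_apply {k : ℕ} {β : E → E' [⋀^Fin k]→L[ℝ] ℝ} {y : E}
    (hβ : DifferentiableAt ℝ β y) (v : Fin k → E') : DifferentiableAt ℝ (fun u => β u v) y :=
  (ContinuousAlternatingMap.apply ℝ E' ℝ v).differentiableAt.comp y hβ

variable {k : ℕ} {β : ℝ × E → (ℝ × E) [⋀^Fin (k + 1)]→L[ℝ] ℝ} {t : ℝ} {y : E}

lemma spacePart_extDeriv {k : ℕ} {β : ℝ × E → (ℝ × E) [⋀^Fin k]→L[ℝ] ℝ}
    (hβ : DifferentiableAt ℝ β (t, y)) :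
    spacePart E (k + 1) (extDeriv β (t, y)) = extDeriv (fun z => spacePart E k (β (t, z))) y := by
  have hz : DifferentiableAt ℝ (fun z => spacePart E k (β (t, z))) y :=
    (spacePart E k).differentiableAt.comp y
      (hβ.comp y ((differentiableAt_const t).prodMk differentiableAt_id))
  ext v
  rw [spacePart_apply, extDeriv_apply hβ, extDeriv_apply hz]
  refine Finset.sum_congr rfl fun i _ => congrArg _ ?_
  exact (dirDeriv_prodMk_left (f := fun u => β u (i.removeNth fun s => (0, v s)))
    (differentiableAt_form_apply hβ _) (v i)).symm

/-- The term of `d` that differentiates along the leading vector `(1, 0)` is the time derivative of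
the space part. The others form the exterior derivative of the time part, with the opposite sign. -/
lemma timePart_extDeriv (hβ : DifferentiableAt ℝ β (t, y)) (v : Fin (k + 1) → E) :
    timePart E (k + 1) (extDeriv β (t, y)) v
      = deriv (fun s => spacePart E (k + 1) (β (s, y)) v) t
        - extDeriv (fun z => timePart E k (β (t, z))) y v := by
  have hz : DifferentiableAt ℝ (fun z => timePart E k (β (t, z))) y :=
    (timePart E k).differentiableAt.comp y
      (hβ.comp y ((differentiableAt_const t).prodMk differentiableAt_id))
  rw [timePart_apply, extDeriv_apply hβ, extDeriv_apply hz, Fin.sum_univ_succ, sub_eq_add_neg,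
    ← Finset.sum_neg_distrib]
  congr 1
  · have h := deriv_prodMk_right (f := fun u => β u (fun s => (0, v s)))
      (differentiableAt_form_apply hβ _)
    simp only [spacePart_apply, h, Fin.val_zero, pow_zero, one_smul]
    rfl
  · refine Finset.sum_congr rfl fun i _ => ?_
    have h := dirDeriv_prodMk_left
      (f := fun u => β u (Matrix.vecCons (1, 0) (fun s => (0, i.removeNth v s))))
      (differentiableAt_form_apply hβ _) (v i)
    have hr : i.succ.removeNth (Matrix.vecCons ((1, 0) : ℝ × E) (fun s => (0, v s)))
        = Matrix.vecCons (1, 0) (fun s => (0, i.removeNth v s)) := by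
      ext1 s
      refine Fin.cases ?_ (fun s => ?_) s
      · simp [Fin.removeNth]
      · simp [Fin.removeNth]
    -- The leading time vector shifts every spatial slot by one, which reverses the sign `(-1) ^ i`.
    rw [hr, Fin.val_succ, pow_succ, mul_neg_one, neg_smul]
    exact congrArg (fun r => -((-1) ^ (i : ℕ) • r)) h.symm

end ProductForms

/-! ### Exterior derivatives of forms on the cylinder and on its slices. -/

section ModelValues

variable {E : Type*} [NormedAddCommGroup E] [NormedSpace ℝ E]
  {H : Type*} [TopologicalSpace H] {I : ModelWithCorners ℝ E H}
  {M : Type*} [TopologicalSpace M] [ChartedSpace H M]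
  {E' : Type*} [NormedAddCommGroup E'] [NormedSpace ℝ E']
  {H' : Type*} [TopologicalSpace H'] {I' : ModelWithCorners ℝ E' H'}
  {N : Type*} [TopologicalSpace N] [ChartedSpace H' N] {k : ℕ}

/-- The value of a field of forms at a point, as a form on the model space. -/
def FormField.model (α : FormField I M k) (x : M) : E [⋀^Fin k]→L[ℝ] ℝ := α x

/-- The derivative of a map at a point, as a map of the model spaces. -/
def modelDeriv (I : ModelWithCorners ℝ E H) (I' : ModelWithCorners ℝ E' H') (f : M → N) (x : M) :
    E →L[ℝ] E' := mfderiv I I' f x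

lemma FormField.inChart_eq_model (α : FormField I M k) (x : M) (u : E) :
    α.inChart x u
      = (α.model ((extChartAt I x).symm u)).compContinuousLinearMap (chartDeriv I x u) := rfl

lemma FormField.model_pullback (f : N → M) (α : FormField I M k) (y : N) :
    (FormField.pullback (I' := I') f α).model y
      = (α.model (f y)).compContinuousLinearMap (modelDeriv I' I f y) := rfl

lemma FormField.inChart_self (α : FormField I M k) [I.Boundaryless] [IsManifold I ∞ M] (x : M) :
    α.inChart x (extChartAt I x x) = α.model x := by
  rw [α.inChart_eq_model, chartDeriv_self, extChartAt_to_inv]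
  rfl

end ModelValues

section CylinderForms

variable {J : Opens ℝ}
  {E : Type*} [NormedAddCommGroup E] [NormedSpace ℝ E]
  {H : Type*} [TopologicalSpace H] {I : ModelWithCorners ℝ E H}
  {S : Type*} [TopologicalSpace S] [ChartedSpace H S] {k : ℕ}

lemma model_sliceForm (α : FormField (𝓘(ℝ, ℝ).prod I) (J × S) k) (t : J) (x : S) :
    (sliceForm α t).model x = spacePart E k (α.model (t, x)) := by
  change (α.model (t, x)).compContinuousLinearMap (sliceMap I t x : E →L[ℝ] ℝ × E) = _
  rw [sliceMap_eq]
  rfl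

lemma model_sliceContraction (α : FormField (𝓘(ℝ, ℝ).prod I) (J × S) (k + 1)) (t : J)
    (x : S) : (sliceContraction α t).model x = timePart E k (α.model (t, x)) := by
  ext v
  exact sliceContraction_apply α t x v

variable [I.Boundaryless] [IsManifold I ∞ S]

lemma inChart_cyl (α : FormField (𝓘(ℝ, ℝ).prod I) (J × S) k) (τ : J) (x : S) (t : J) {y : E}
    (hy : y ∈ (extChartAt I x).target) :
    α.inChart (τ, x) ((t : ℝ), y)
      = (α.model (t, (extChartAt I x).symm y)).compContinuousLinearMap
        ((ContinuousLinearMap.id ℝ ℝ).prodMap (chartDeriv I x y)) := by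
  rw [α.inChart_eq_model, chartDeriv_cyl τ x t hy, extChartAt_cyl_symm]

lemma inChart_sliceForm (α : FormField (𝓘(ℝ, ℝ).prod I) (J × S) k) (τ : J) (x : S) (t : J) {y : E}
    (hy : y ∈ (extChartAt I x).target) :
    (sliceForm α t).inChart x y = spacePart E k (α.inChart (τ, x) ((t : ℝ), y)) := by
  rw [inChart_cyl α τ x t hy, spacePart_comp, FormField.inChart_eq_model, model_sliceForm]

lemma inChart_sliceContraction (α : FormField (𝓘(ℝ, ℝ).prod I) (J × S) (k + 1)) (τ : J) (x : S)
    (t : J) {y : E} (hy : y ∈ (extChartAt I x).target) :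
    (sliceContraction α t).inChart x y = timePart E k (α.inChart (τ, x) ((t : ℝ), y)) := by
  rw [inChart_cyl α τ x t hy, timePart_comp, FormField.inChart_eq_model, model_sliceContraction]

omit [IsManifold I ∞ S] in
lemma DiffForm.differentiableAt_inChart (α : DiffForm (𝓘(ℝ, ℝ).prod I) (J × S) k) (τ : J) (x : S) :
    DifferentiableAt ℝ (α.toField.inChart (τ, x)) ((τ : ℝ), extChartAt I x x) := by
  refine ContDiffOn.differentiableAt_of_isOpen ?_ (isOpen_cylTarget x) (mem_cylTarget_self τ x)
  rw [← extChartAt_cyl_target τ x]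
  exact α.smooth (τ, x)

lemma DiffForm.spacePart_d (α : DiffForm (𝓘(ℝ, ℝ).prod I) (J × S) k) (τ : J) (x : S) :
    spacePart E (k + 1) (α.toField.d (τ, x)) = (sliceForm α.toField τ).d x := by
  unfold FormField.d
  rw [extChartAt_cyl_apply]
  refine (spacePart_extDeriv (α.differentiableAt_inChart τ x)).trans ?_
  refine Filter.EventuallyEq.extDeriv_eq ?_
  filter_upwards [(isOpen_extChartAt_target x).mem_nhds (mem_extChartAt_target x)] with z hz
  exact (inChart_sliceForm α.toField τ x τ hz).symm

/-- Near the centre, the representatives of the slice forms are the parts of the representative on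
the cylinder, so the identity for forms on `ℝ × E` applies. -/
lemma DiffForm.timePart_d (α : DiffForm (𝓘(ℝ, ℝ).prod I) (J × S) (k + 1)) (τ : J) (x : S)
    (v : Fin (k + 1) → E) :
    timePart E (k + 1) (α.toField.d (τ, x)) v
      = dotTensor (fun t => (sliceForm α.toField t).toTensor) τ x v
        - (sliceContraction α.toField τ).d x v := by
  have hd := α.differentiableAt_inChart τ x
  unfold FormField.d
  rw [extChartAt_cyl_apply]
  refine (timePart_extDeriv hd v).trans ?_
  congr 1
  · refine (timeDeriv_eq_deriv ?_ fun s => ?_).symm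
    · have h1 : DifferentiableAt ℝ (fun s : ℝ => α.toField.inChart (τ, x) (s, extChartAt I x x))
          (τ : ℝ) :=
        DifferentiableAt.comp (τ : ℝ) (f := fun s : ℝ => (s, extChartAt I x x)) hd
          (differentiableAt_id.prodMk (differentiableAt_const _))
      exact differentiableAt_form_apply ((spacePart E (k + 1)).differentiableAt.comp (τ : ℝ) h1) v
    · rw [← inChart_sliceForm α.toField τ x s (mem_extChartAt_target x), FormField.inChart_self]
      rfl
  · refine DFunLike.congr_fun (Filter.EventuallyEq.extDeriv_eq ?_) v
    filter_upwards [(isOpen_extChartAt_target x).mem_nhds (mem_extChartAt_target x)] with z hz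
    exact (inChart_sliceContraction α.toField τ x τ hz).symm

end CylinderForms

/-! ### Splitting the curvature of the curving. -/

section Curvature

variable {J : Opens ℝ}
  {ES : Type*} [NormedAddCommGroup ES] [NormedSpace ℝ ES]
  {HS : Type*} [TopologicalSpace HS] {IS : ModelWithCorners ℝ ES HS}
  {S : Type*} [TopologicalSpace S] [ChartedSpace HS S] [IsManifold IS ∞ S]
  {EY : Type*} [NormedAddCommGroup EY] [NormedSpace ℝ EY]
  {HY : Type*} [TopologicalSpace HY] {IY : ModelWithCorners ℝ EY HY} [IY.Boundaryless]
  {Y : Type*} [TopologicalSpace Y] [ChartedSpace HY Y] [IsManifold IY ∞ Y]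
  {EP : Type*} [NormedAddCommGroup EP] [NormedSpace ℝ EP]
  {HP : Type*} [TopologicalSpace HP] {IP : ModelWithCorners ℝ EP HP}
  {P : Type*} [TopologicalSpace P] [ChartedSpace HP P]
  (G : BundleGerbe IS S IY Y IP P)

omit [IY.Boundaryless] in
lemma BundleGerbe.modelDeriv_cylinder_proj (τ : J) (y : Y) :
    modelDeriv (𝓘(ℝ, ℝ).prod IY) (𝓘(ℝ, ℝ).prod IS) (G.cylinder J).proj (τ, y)
      = (ContinuousLinearMap.id ℝ ℝ).prodMap (modelDeriv IY IS G.proj y) := by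
  have hπ : MDifferentiableAt IY IS G.proj y :=
    G.isSubmersion_proj.contMDiff.mdifferentiableAt (by simp)
  have h := mfderiv_prodMap (p := (τ, y)) (f := (id : J → J)) (I := 𝓘(ℝ, ℝ)) (J := 𝓘(ℝ, ℝ))
    (I' := IY) (J' := IS) mdifferentiableAt_id hπ
  rw [mfderiv_id] at h
  exact h

/-- The derivative of the cylinder's submersion is `id × dπ`, so pull-back commutes with taking time
and space parts. A form on `ℝ × EY` is determined by these parts, and those of `db` are `∂_τ b - d_Y
a` and `d_Y b`. -/
theorem BundleGerbe.isCurvature_cylinder_iff (b : DiffForm (𝓘(ℝ, ℝ).prod IY) (J × Y) 2)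
    (F : FormField (𝓘(ℝ, ℝ).prod IS) (J × S) 3) :
    (G.cylinder J).IsCurvature b.toField F ↔
      G.IsDerivedFamily (sliceContraction b.toField) (sliceForm b.toField) (sliceContraction F) ∧
        ∀ τ, G.IsCurvature (sliceForm b.toField τ) (sliceForm F τ) := by
  have hs : ∀ (τ : J) (y : Y), spacePart EY 3
      ((FormField.pullback (I' := 𝓘(ℝ, ℝ).prod IY) (G.cylinder J).proj F).model (τ, y))
      = (FormField.pullback (I' := IY) G.proj (sliceForm F τ)).model y := by
    intro τ y
    rw [FormField.model_pullback, FormField.model_pullback, G.modelDeriv_cylinder_proj,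
      spacePart_comp, model_sliceForm]
    rfl
  have ht : ∀ (τ : J) (y : Y), timePart EY 2
      ((FormField.pullback (I' := 𝓘(ℝ, ℝ).prod IY) (G.cylinder J).proj F).model (τ, y))
      = (FormField.pullback (I' := IY) G.proj (sliceContraction F τ)).model y := by
    intro τ y
    rw [FormField.model_pullback, FormField.model_pullback, G.modelDeriv_cylinder_proj,
      timePart_comp, model_sliceContraction]
    rfl
  constructor
  · intro h
    refine ⟨fun τ y v => ?_, fun τ => ?_⟩
    · refine Eq.trans ?_ (b.timePart_d τ y v)
      rw [← h]
      exact DFunLike.congr_fun (ht τ y).symm v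
    · ext1 y
      refine Eq.trans ?_ (b.spacePart_d τ y)
      rw [← h]
      exact (hs τ y).symm
  · rintro ⟨h₁, h₂⟩
    funext ⟨τ, y⟩
    refine form_ext (E := EY) ?_ ?_
    · refine (ht τ y).trans (ContinuousAlternatingMap.ext fun v => ?_)
      exact (h₁ τ y v).trans (b.timePart_d τ y v).symm
    · exact (hs τ y).trans ((congrFun (h₂ τ) y).trans (b.spacePart_d τ y).symm)

end Curvature

/-! ### Passing between forms on the cylinder and pairs of smooth families. -/

section Families

variable {J : Opens ℝ}
  {E : Type*} [NormedAddCommGroup E] [NormedSpace ℝ E]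
  {H : Type*} [TopologicalSpace H] {I : ModelWithCorners ℝ E H} [I.Boundaryless]
  {S : Type*} [TopologicalSpace S] [ChartedSpace H S] [IsManifold I ∞ S] {k : ℕ}

omit [I.Boundaryless] [IsManifold I ∞ S] in
lemma DiffForm.contMDiffOn_inChart (α : DiffForm (𝓘(ℝ, ℝ).prod I) (J × S) k) (τ : J) (x : S) :
    ContMDiffOn (𝓘(ℝ, ℝ).prod 𝓘(ℝ, E)) 𝓘(ℝ, (ℝ × E) [⋀^Fin k]→L[ℝ] ℝ) ∞
      (fun p : J × E => α.toField.inChart (τ, x) ((p.1 : ℝ), p.2))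
      (Set.univ ×ˢ (extChartAt I x).target) := by
  have h := (α.smooth (τ, x)).contMDiffOn
  rw [extChartAt_cyl_target] at h
  have hc : ContMDiff (𝓘(ℝ, ℝ).prod 𝓘(ℝ, E)) 𝓘(ℝ, ℝ × E) ∞
      (fun p : J × E => ((p.1 : ℝ), p.2)) :=
    (contMDiff_subtype_val.comp contMDiff_fst).prodMk_space contMDiff_snd
  exact h.comp hc.contMDiffOn fun p hp => ⟨p.1.2, hp.2⟩

/-- The family of forms induced on the slices by a form on the cylinder. -/
def DiffForm.sliceFamily (α : DiffForm (𝓘(ℝ, ℝ).prod I) (J × S) k) : FormFamily J I S k where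
  toField := sliceForm α.toField
  smooth x₀ p hp := by
    refine ((((spacePart E k).contMDiff.comp_contMDiffOn
      (α.contMDiffOn_inChart p.1 x₀))) p hp).congr (fun q hq => ?_) ?_
    · exact inChart_sliceForm α.toField p.1 x₀ q.1 hq.2
    · exact inChart_sliceForm α.toField p.1 x₀ p.1 hp.2

/-- The family of forms induced on the slices by the contraction of a form on the cylinder
with `∂_τ`. -/
def DiffForm.contractionFamily (α : DiffForm (𝓘(ℝ, ℝ).prod I) (J × S) (k + 1)) :
    FormFamily J I S k where
  toField := sliceContraction α.toField
  smooth x₀ p hp := by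
    refine ((((timePart E k).contMDiff.comp_contMDiffOn
      (α.contMDiffOn_inChart p.1 x₀))) p hp).congr (fun q hq => ?_) ?_
    · exact inChart_sliceContraction α.toField p.1 x₀ q.1 hq.2
    · exact inChart_sliceContraction α.toField p.1 x₀ p.1 hp.2

omit [I.Boundaryless] [IsManifold I ∞ S] in
lemma FormFamily.contDiffOn_inChart (ψ : FormFamily J I S k) (τ : J) (x : S) :
    ContDiffOn ℝ ∞ (fun u : ℝ × E =>
      (ψ.toField ((extChartAt 𝓘(ℝ, ℝ) τ).symm u.1)).inChart x u.2) (cylTarget J I x) := by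
  have h1 : ContMDiffOn 𝓘(ℝ, ℝ × E) 𝓘(ℝ, ℝ) ∞
      (fun u : ℝ × E => (extChartAt 𝓘(ℝ, ℝ) τ).symm u.1) (cylTarget J I x) := by
    refine (contMDiffOn_extChartAt_symm τ).comp contDiff_fst.contMDiff.contMDiffOn fun u hu => ?_
    rw [extChartAt_opens_target]
    exact hu.1
  have h2 : ContMDiffOn 𝓘(ℝ, ℝ × E) (𝓘(ℝ, ℝ).prod 𝓘(ℝ, E)) ∞
      (fun u : ℝ × E => ((extChartAt 𝓘(ℝ, ℝ) τ).symm u.1, u.2)) (cylTarget J I x) :=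
    h1.prodMk contDiff_snd.contMDiff.contMDiffOn
  exact ((ψ.smooth x).comp h2 fun u hu => ⟨trivial, hu.2⟩).contDiffOn

/-- The form `dτ ∧ ψ_τ + F_τ` on the cylinder. -/
def cylDiffForm (ψ : FormFamily J I S k) (F : FormFamily J I S (k + 1)) :
    DiffForm (𝓘(ℝ, ℝ).prod I) (J × S) (k + 1) where
  toField p := cylForm E k ((ψ.toField p.1).model p.2, (F.toField p.1).model p.2)
  smooth := by
    rintro ⟨τ, x⟩
    rw [extChartAt_cyl_target]
    refine ((cylForm E k).contDiff.comp_contDiffOn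
      ((ψ.contDiffOn_inChart τ x).prodMk (F.contDiffOn_inChart τ x))).congr fun u hu => ?_
    obtain ⟨t, y⟩ := u
    lift t to J using hu.1
    refine (inChart_cyl _ τ x t hu.2).trans ?_
    have ht : (extChartAt 𝓘(ℝ, ℝ) τ).symm (t : ℝ) = t := extChartAt_opens_symm τ t.2
    simp only [Function.comp_apply, ht]
    -- Forming `dτ ∧ ψ + F` commutes with pull-back by the chart, so its representative is a
    -- continuous linear function of those of `ψ` and `F`.
    exact cylForm_comp _ _ _

lemma sliceForm_cylDiffForm (ψ : FormFamily J I S k) (F : FormFamily J I S (k + 1)) :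
    sliceForm (cylDiffForm ψ F).toField = F.toField := by
  ext1 t
  funext x
  exact (model_sliceForm _ t x).trans (spacePart_cylForm _ _)

lemma sliceContraction_cylDiffForm (ψ : FormFamily J I S k) (F : FormFamily J I S (k + 1)) :
    sliceContraction (cylDiffForm ψ F).toField = ψ.toField := by
  ext1 t
  funext x
  exact (model_sliceContraction _ t x).trans (timePart_cylForm _ _)

end Families

/-! ### The reduction theorem. -/

section Reduction

variable {J : Opens ℝ}
  {ES : Type*} [NormedAddCommGroup ES] [NormedSpace ℝ ES]
  {HS : Type*} [TopologicalSpace HS] {IS : ModelWithCorners ℝ ES HS} [IS.Boundaryless]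
  {S : Type*} [TopologicalSpace S] [ChartedSpace HS S] [IsManifold IS ∞ S]
  {EY : Type*} [NormedAddCommGroup EY] [NormedSpace ℝ EY]
  {HY : Type*} [TopologicalSpace HY] {IY : ModelWithCorners ℝ EY HY} [IY.Boundaryless]
  {Y : Type*} [TopologicalSpace Y] [ChartedSpace HY Y] [IsManifold IY ∞ Y]
  {EP : Type*} [NormedAddCommGroup EP] [NormedSpace ℝ EP]
  {HP : Type*} [TopologicalSpace HP] {IP : ModelWithCorners ℝ EP HP}
  {P : Type*} [TopologicalSpace P] [ChartedSpace HP P]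
  {ι : Type*} [Fintype ι] [DecidableEq ι] (e : Module.Basis ι ℝ ES)

/-- A witness for one side is turned directly into a witness for the other: a three-form is split
into its two families, or two families are assembled into `dτ ∧ ψ + F`, whose parts are the given
ones. -/
theorem isGradientSolitonWith_cylinder_iff (hn : 2 ≤ Fintype.card ι)
    (G : BundleGerbe IS S IY Y IP P)
    {g : Bundle.ContMDiffRiemannianMetric (𝓘(ℝ, ℝ).prod IS) ∞ (ℝ × ES)
      (fun p : J × S => TangentSpace (𝓘(ℝ, ℝ).prod IS) p)}
    (hg : IsCylindrical (metricTensor g)) (b : DiffForm (𝓘(ℝ, ℝ).prod IY) (J × Y) 2)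
    {φ : J × S → ℝ} (hφ : ContMDiff (𝓘(ℝ, ℝ).prod IS) 𝓘(ℝ, ℝ) ∞ φ) (lam : ℝ) :
    IsGradientSolitonWith (cylBasisOf e) (G.cylinder J) (Fintype.card ι) lam (metricTensor g) b φ ↔
      SatisfiesReducedSystem e G (Fintype.card ι) lam (sliceTensor (metricTensor g))
        (sliceContraction b.toField) (sliceForm b.toField) (fun τ x => φ (τ, x)) := by
  constructor
  · rintro ⟨F, hF, hE⟩
    obtain ⟨h₁, h₂⟩ := (G.isCurvature_cylinder_iff b F.toField).1 hF
    exact ⟨F.contractionFamily, F.sliceFamily, h₁, h₂, (nsnsEquations_cyl_iff e hg hφ F hn).1 hE⟩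
  · rintro ⟨ψ, F, h₁, h₂, hE⟩
    refine ⟨cylDiffForm ψ F, (G.isCurvature_cylinder_iff b _).2 ?_,
      (nsnsEquations_cyl_iff e hg hφ _ hn).2 ?_⟩
    · rw [sliceForm_cylDiffForm, sliceContraction_cylDiffForm]
      exact ⟨h₁, h₂⟩
    · rw [sliceForm_cylDiffForm, sliceContraction_cylDiffForm]
      exact hE

end Reduction

end GerbeSoliton

end

theorem mainTheorem6 {n dY dP : ℕ} (hn : 2 ≤ n)
    (J : TopologicalSpace.Opens ℝ) (hJ : (J : Set ℝ).OrdConnected)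
    {S : Type*} [TopologicalSpace S] [T2Space S] [SecondCountableTopology S]
    [ChartedSpace (EuclideanSpace ℝ (Fin n)) S] [IsManifold (𝓡 n) ∞ S]
    {Y : Type*} [TopologicalSpace Y] [T2Space Y] [SecondCountableTopology Y]
    [ChartedSpace (EuclideanSpace ℝ (Fin dY)) Y] [IsManifold (𝓡 dY) ∞ Y]
    {P : Type*} [TopologicalSpace P] [T2Space P] [SecondCountableTopology P]
    [ChartedSpace (EuclideanSpace ℝ (Fin dP)) P] [IsManifold (𝓡 dP) ∞ P]
    (G : GerbeSoliton.BundleGerbe (𝓡 n) S (𝓡 dY) Y (𝓡 dP) P)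
    (A : GerbeSoliton.DiffForm (𝓘(ℝ, ℝ).prod (𝓡 dP)) (J × P) 1)
    (hA : (G.cylinder J).IsConnectiveStructure A)
    (g : Bundle.ContMDiffRiemannianMetric (𝓘(ℝ, ℝ).prod (𝓡 n)) ∞
      (ℝ × EuclideanSpace ℝ (Fin n))
      (fun p : J × S => TangentSpace (𝓘(ℝ, ℝ).prod (𝓡 n)) p))
    (hg : GerbeSoliton.IsCylindrical (GerbeSoliton.metricTensor g))
    (b : GerbeSoliton.DiffForm (𝓘(ℝ, ℝ).prod (𝓡 dY)) (J × Y) 2)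
    (hb : (G.cylinder J).IsCurving A b)
    (φ : J × S → ℝ) (hφ : ContMDiff (𝓘(ℝ, ℝ).prod (𝓡 n)) 𝓘(ℝ, ℝ) ∞ φ) :
    (∀ lam : ℝ,
      GerbeSoliton.IsGradientSolitonWith (GerbeSoliton.cylBasis n) (G.cylinder J) n lam
          (GerbeSoliton.metricTensor g) b φ ↔
        GerbeSoliton.SatisfiesReducedSystem (GerbeSoliton.stdBasis n) G n lam
          (GerbeSoliton.sliceTensor (GerbeSoliton.metricTensor g))
          (GerbeSoliton.sliceContraction b.toField) (GerbeSoliton.sliceForm b.toField)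
          (fun τ x => φ (τ, x))) ∧
    (GerbeSoliton.IsGradientSoliton (GerbeSoliton.cylBasis n) (G.cylinder J) n
          (GerbeSoliton.metricTensor g) b φ ↔
        ∃ lam : ℝ, GerbeSoliton.SatisfiesReducedSystem (GerbeSoliton.stdBasis n) G n lam
          (GerbeSoliton.sliceTensor (GerbeSoliton.metricTensor g))
          (GerbeSoliton.sliceContraction b.toField) (GerbeSoliton.sliceForm b.toField)
          (fun τ x => φ (τ, x))) := by
  have h := GerbeSoliton.isGradientSolitonWith_cylinder_iff (J := J) (GerbeSoliton.stdBasis n)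
    (by rwa [Fintype.card_fin]) G hg b hφ
  rw [Fintype.card_fin] at h
  -- `cylBasis n` is by definition the basis of `ℝ × ℝⁿ` induced by `stdBasis n`. Since `λ` is the
  -- same on both sides, the second equivalence follows by quantifying over it.
  exact ⟨h, exists_congr h⟩
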